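/- Let $(M^{n+1},g)$ be a smooth Riemannian manifold (without boundary, Hausdorff, second countable), $f:M\to\mathbb R$ smooth, and let $\Sigma^n\to M$ be a smoothly immersed hypersurface with a smooth unit normal field $N$ (for instance, $M$ and $\Sigma$ oriented). A compactly supported variation of $\Sigma$ is a smooth family of immersed hypersurfaces $\Sigma_t$, $-\varepsilon<t<\varepsilon$, with $\Sigma_0=\Sigma$, which is independent of $t$ outside a compact set $K\subset\Sigma$; its weighted area $\int_{\Sigma_t}e^{-f}$ is taken over $K$ with respect to the area measure of the metric induced by $g$ at time $t$. Let $A(X,Y)=-\langle\nabla_XY,N\rangle$ be the second fundamental form of $\Sigma$, $H=\operatorname{tr}A$ its mean curvature, and $\mathrm{Ric}_f=\mathrm{Ric}+\nabla^2f$. Assume that $\Sigma$ is $f$-minimal, i.e. $\frac{d}{dt}\big|_{t=0}\int_{\Sigma_t}e^{-f}=0$ for every compactly supported variation. Then: 1. $H=f_n$ on $\Sigma$, where $f_n=df(N)$. 2. For every smooth compactly supported function $\lambda$ on $\Sigma$ and every compactly supported variation $\Sigma_t$ with variational field $\lambda N$ at $t=0$, the function $t\mapsto\int_{\Sigma_t}e^{-f}$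 is differentiable near $t=0$, twice differentiable at $t=0$, and $$\frac{d^2}{dt^2}\Big|_{t=0}\int_{\Sigma_t}e^{-f}=\int_{\Sigma}\big(|\nabla\lambda|^2-\lambda^2(\mathrm{Ric}_f(N,N)+|A|^2)\big)e^{-f},$$ where the integrand on the right is integrable. 3. Consequently $\Sigma$ is stable (the second variation of weighted area is nonnegative for every compactly supported variation whose variational field at $t=0$ is $\lambda N$ with $\lambda$ smooth and compactly supported) if and only if $$\int_{\Sigma}\big(|\nabla\lambda|^2-\lambda^2(\mathrm{Ric}_f(N,N)+|A|^2)\big)e^{-f}\ge0$$ for every smooth compactly supported function $\lambda$ on $\Sigma$. -/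

import Mathlib

open scoped Manifold ContDiff Topology

noncomputable section

namespace WeightedHypersurface

/-! ### Coordinate calculus on open subsets of Euclidean space -/

/-- Partial derivative in the `i`-th coordinate direction. -/
def pd {n : ℕ} (i : Fin n) (u : EuclideanSpace ℝ (Fin n) → ℝ)
    (y : EuclideanSpace ℝ (Fin n)) : ℝ :=
  fderiv ℝ u y (EuclideanSpace.single i 1)

/-- Christoffel symbols `Γ^k_{ij}` of the Levi-Civita connection of a metric `G = (G_{ij})` given in
coordinates. -/
def christoffel {n : ℕ} (G : EuclideanSpace ℝ (Fin n) → Matrix (Fin n) (Fin n) ℝ)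
    (k i j : Fin n) (y : EuclideanSpace ℝ (Fin n)) : ℝ :=
  (1 / 2) * ∑ l, (G y)⁻¹ k l *
    (pd i (fun z => G z j l) y + pd j (fun z => G z i l) y - pd l (fun z => G z i j) y)

/-- Ricci tensor in coordinates,
`R_{ij} = ∂_k Γ^k_{ij} - ∂_j Γ^k_{ik} + Γ^k_{kl} Γ^l_{ij} - Γ^k_{jl} Γ^l_{ik}`
(positive on round spheres). -/
def ricciCoord {n : ℕ} (G : EuclideanSpace ℝ (Fin n) → Matrix (Fin n) (Fin n) ℝ)
    (i j : Fin n) (y : EuclideanSpace ℝ (Fin n)) : ℝ :=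
  ∑ k, (pd k (christoffel G k i j) y - pd j (christoffel G k i k) y)
    + ∑ k, ∑ l, (christoffel G k k l y * christoffel G l i j y
        - christoffel G k j l y * christoffel G l i k y)

/-- Hessian in coordinates, `(∇²u)_{ij} = ∂_i ∂_j u - Γ^k_{ij} ∂_k u`. -/
def hessCoord {n : ℕ} (G : EuclideanSpace ℝ (Fin n) → Matrix (Fin n) (Fin n) ℝ)
    (u : EuclideanSpace ℝ (Fin n) → ℝ) (i j : Fin n) (y : EuclideanSpace ℝ (Fin n)) : ℝ :=
  pd i (pd j u) y - ∑ k, christoffel G k i j y * pd k u y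

/-! ### Metrics and volume on a manifold -/

section Manifold

variable {n : ℕ} {X : Type*} [TopologicalSpace X] [ChartedSpace (EuclideanSpace ℝ (Fin n)) X]

/-- The coordinate vector field `∂_i` of the preferred chart at `p`, at the point with
coordinates `y`. -/
def coordVec (p : X) (y : EuclideanSpace ℝ (Fin n)) (i : Fin n) :
    TangentSpace (𝓡 n) ((extChartAt (𝓡 n) p).symm y) :=
  mfderiv (𝓡 n) (𝓡 n) (extChartAt (𝓡 n) p).symm y (EuclideanSpace.single i (1 : ℝ))

/-- Components of a tangent vector at `p` in the preferred chart at `p`. -/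
def comps (p : X) (v : TangentSpace (𝓡 n) p) : EuclideanSpace ℝ (Fin n) :=
  mfderiv (𝓡 n) (𝓡 n) (extChartAt (𝓡 n) p) p v

/-- The matrix `h(∂_i, ∂_j)` of a field of bilinear forms in the preferred chart at `p`. -/
def metricMatrix (h : ∀ q : X, TangentSpace (𝓡 n) q → TangentSpace (𝓡 n) q → ℝ) (p : X)
    (y : EuclideanSpace ℝ (Fin n)) : Matrix (Fin n) (Fin n) ℝ :=
  Matrix.of fun i j => h _ (coordVec p y i) (coordVec p y j)

/-- The volume measure `√(det h_{ij}) dy` on the domain of the preferred chart at `p`, extended by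
zero to `X`. -/
def chartVolume [MeasurableSpace X]
    (h : ∀ q : X, TangentSpace (𝓡 n) q → TangentSpace (𝓡 n) q → ℝ) (p : X) :
    MeasureTheory.Measure X :=
  MeasureTheory.Measure.map (extChartAt (𝓡 n) p).symm
    ((MeasureTheory.volume.restrict (extChartAt (𝓡 n) p).target).withDensity
      fun y => ENNReal.ofReal (Real.sqrt (metricMatrix h p y).det))

/-- The Riemannian volume measure of `h`. The chart volumes agree on overlaps of charts, so their
supremum in the lattice of measures is the measure which restricts to each of them
(on a second countable manifold). -/
def volumeMeasure [MeasurableSpace X]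
    (h : ∀ q : X, TangentSpace (𝓡 n) q → TangentSpace (𝓡 n) q → ℝ) : MeasureTheory.Measure X :=
  ⨆ p : X, chartVolume h p

/-- Smooth Riemannian metrics on `X`. -/
abbrev Metric (n : ℕ) (X : Type*) [TopologicalSpace X]
    [ChartedSpace (EuclideanSpace ℝ (Fin n)) X] [IsManifold (𝓡 n) ∞ X] :=
  haveI : IsManifold (𝓡 n) 1 X := IsManifold.of_le (n := ∞) (by simp)
  Bundle.ContMDiffRiemannianMetric (𝓡 n) ∞ (EuclideanSpace ℝ (Fin n))
    (fun x : X => TangentSpace (𝓡 n) x)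

variable [IsManifold (𝓡 n) ∞ X]

/-- The metric as a field of bilinear forms. -/
def Metric.form (g : Metric n X) (q : X) (v w : TangentSpace (𝓡 n) q) : ℝ := g.inner q v w

/-- The Ricci curvature `Ric(v, w)` at `p`. -/
def ricci (g : Metric n X) (p : X) (v w : TangentSpace (𝓡 n) p) : ℝ :=
  ∑ i, ∑ j, comps p v i * comps p w j *
    ricciCoord (metricMatrix g.form p) i j (extChartAt (𝓡 n) p p)

/-- The Hessian `∇²f(v, w)` at `p`. -/
def hessian (g : Metric n X) (f : X → ℝ) (p : X) (v w : TangentSpace (𝓡 n) p) : ℝ :=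
  ∑ i, ∑ j, comps p v i * comps p w j *
    hessCoord (metricMatrix g.form p) (fun y => f ((extChartAt (𝓡 n) p).symm y)) i j
      (extChartAt (𝓡 n) p p)

/-- The Bakry-Émery Ricci curvature `Ric_f = Ric + ∇²f`. -/
def ricciF (g : Metric n X) (f : X → ℝ) (p : X) (v w : TangentSpace (𝓡 n) p) : ℝ :=
  ricci g p v w + hessian g f p v w

end Manifold

/-! ### Hypersurfaces -/

section Hypersurface

variable {n : ℕ}
  {M : Type*} [TopologicalSpace M] [ChartedSpace (EuclideanSpace ℝ (Fin (n + 1))) M]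
  [IsManifold (𝓡 (n + 1)) ∞ M]
  {S : Type*} [TopologicalSpace S] [ChartedSpace (EuclideanSpace ℝ (Fin n)) S]

/-- Smooth immersion of a hypersurface. -/
structure IsImmersedHypersurface (n : ℕ)
    {M : Type*} [TopologicalSpace M] [ChartedSpace (EuclideanSpace ℝ (Fin (n + 1))) M]
    {S : Type*} [TopologicalSpace S] [ChartedSpace (EuclideanSpace ℝ (Fin n)) S] (φ : S → M) : Prop where
  smooth : ContMDiff (𝓡 n) (𝓡 (n + 1)) ∞ φ
  injective : ∀ x, Function.Injective (mfderiv (𝓡 n) (𝓡 (n + 1)) φ x)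

/-- `N` is a smooth unit normal vector field along `φ`. -/
structure IsUnitNormal (g : Metric (n + 1) M) (φ : S → M)
    (N : ∀ x : S, TangentSpace (𝓡 (n + 1)) (φ x)) : Prop where
  smooth : ContMDiff (𝓡 n) (𝓡 (n + 1)).tangent ∞
    (fun x => (⟨φ x, N x⟩ : TangentBundle (𝓡 (n + 1)) M))
  unit : ∀ x, g.form (φ x) (N x) (N x) = 1
  normal : ∀ x (v : TangentSpace (𝓡 n) x),
    g.form (φ x) (N x) (mfderiv (𝓡 n) (𝓡 (n + 1)) φ x v) = 0

/-- The metric induced on the hypersurface, `(φ^* g)(v, w) = g(dφ v, dφ w)`. -/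
def inducedForm (g : Metric (n + 1) M) (φ : S → M) (x : S) (v w : TangentSpace (𝓡 n) x) : ℝ :=
  g.form (φ x) (mfderiv (𝓡 n) (𝓡 (n + 1)) φ x v) (mfderiv (𝓡 n) (𝓡 (n + 1)) φ x w)

/-- The induced area measure. -/
def areaMeasure [MeasurableSpace S] (g : Metric (n + 1) M) (φ : S → M) :
    MeasureTheory.Measure S :=
  volumeMeasure (inducedForm g φ)

/-- The weighted area `∫_K e^{-f}` of the part `K` of the hypersurface `φ`. -/
def weightedArea [MeasurableSpace S] (g : Metric (n + 1) M) (f : M → ℝ) (φ : S → M)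
    (K : Set S) : ℝ :=
  ∫ x in K, Real.exp (-f (φ x)) ∂(areaMeasure g φ)

/-- The matrix `(h_{ij})` of the induced metric at `x`, in the preferred chart at `x`. -/
def firstFF (g : Metric (n + 1) M) (φ : S → M) (x : S) : Matrix (Fin n) (Fin n) ℝ :=
  metricMatrix (inducedForm g φ) x (extChartAt (𝓡 n) x x)

/-- `φ` read in the preferred charts at `x` and at `φ x`. -/
def inCharts (φ : S → M) (x : S) (y : EuclideanSpace ℝ (Fin n)) :
    EuclideanSpace ℝ (Fin (n + 1)) :=
  extChartAt (𝓡 (n + 1)) (φ x) (φ ((extChartAt (𝓡 n) x).symm y))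

/-- The `a`-th component (in the preferred chart at `φ x`) of `∇_{∂_i} ∂_j` at `x`, where `∇` is
the Levi-Civita connection of `g` and `∂_i`, `∂_j` are the coordinate fields of the hypersurface. -/
def covDerivCoord (g : Metric (n + 1) M) (φ : S → M) (x : S) (i j : Fin n) (a : Fin (n + 1)) : ℝ :=
  pd i (pd j (fun y => inCharts φ x y a)) (extChartAt (𝓡 n) x x)
    + ∑ b, ∑ c, christoffel (metricMatrix g.form (φ x)) a b c (extChartAt (𝓡 (n + 1)) (φ x) (φ x))
        * pd i (fun y => inCharts φ x y b) (extChartAt (𝓡 n) x x)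
        * pd j (fun y => inCharts φ x y c) (extChartAt (𝓡 n) x x)

/-- The second fundamental form `A_{ij} = -⟨∇_{∂_i} ∂_j, N⟩` at `x`. -/
def secondFF (g : Metric (n + 1) M) (φ : S → M) (N : ∀ x : S, TangentSpace (𝓡 (n + 1)) (φ x))
    (x : S) : Matrix (Fin n) (Fin n) ℝ :=
  Matrix.of fun i j => -∑ a, ∑ b,
    metricMatrix g.form (φ x) (extChartAt (𝓡 (n + 1)) (φ x) (φ x)) a b
      * covDerivCoord g φ x i j a * comps (φ x) (N x) b

/-- The mean curvature `H = h^{ij} A_{ij}`. -/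
def meanCurvature (g : Metric (n + 1) M) (φ : S → M)
    (N : ∀ x : S, TangentSpace (𝓡 (n + 1)) (φ x)) (x : S) : ℝ :=
  ∑ i, ∑ j, (firstFF g φ x)⁻¹ i j * secondFF g φ N x i j

/-- `|A|² = h^{ik} h^{jl} A_{ij} A_{kl}`. -/
def normSqSecondFF (g : Metric (n + 1) M) (φ : S → M)
    (N : ∀ x : S, TangentSpace (𝓡 (n + 1)) (φ x)) (x : S) : ℝ :=
  ∑ i, ∑ j, ∑ k, ∑ l, (firstFF g φ x)⁻¹ i k * (firstFF g φ x)⁻¹ j l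
    * secondFF g φ N x i j * secondFF g φ N x k l

/-- `|∇u|² = h^{ij} ∂_i u ∂_j u`, for the induced metric. -/
def normSqGrad (g : Metric (n + 1) M) (φ : S → M) (u : S → ℝ) (x : S) : ℝ :=
  ∑ i, ∑ j, (firstFF g φ x)⁻¹ i j
    * pd i (fun y => u ((extChartAt (𝓡 n) x).symm y)) (extChartAt (𝓡 n) x x)
    * pd j (fun y => u ((extChartAt (𝓡 n) x).symm y)) (extChartAt (𝓡 n) x x)

/-- `(|∇u|² - u² (Ric_f(N, N) + |A|²)) e^{-f}`. -/
def stabilityIntegrand (g : Metric (n + 1) M) (f : M → ℝ) (φ : S → M)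
    (N : ∀ x : S, TangentSpace (𝓡 (n + 1)) (φ x)) (u : S → ℝ) (x : S) : ℝ :=
  (normSqGrad g φ u x
    - u x ^ 2 * (ricciF g f (φ x) (N x) (N x) + normSqSecondFF g φ N x)) * Real.exp (-f (φ x))

/-- `F t`, `-ε < t < ε`, is a smooth family of immersed hypersurfaces with `F 0 = φ`, which is
constant in `t` outside the compact set `K`. -/
structure IsVariation (n : ℕ)
    {M : Type*} [TopologicalSpace M] [ChartedSpace (EuclideanSpace ℝ (Fin (n + 1))) M]
    {S : Type*} [TopologicalSpace S] [ChartedSpace (EuclideanSpace ℝ (Fin n)) S]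
    (φ : S → M) (F : ℝ → S → M) (K : Set S) : Prop where
  zero : F 0 = φ
  compact : IsCompact K
  family : ∃ ε > 0,
    ContMDiffOn (𝓘(ℝ, ℝ).prod (𝓡 n)) (𝓡 (n + 1)) ∞ (fun q : ℝ × S => F q.1 q.2)
      (Set.Ioo (-ε) ε ×ˢ Set.univ) ∧
    (∀ t ∈ Set.Ioo (-ε) ε, ∀ x, Function.Injective (mfderiv (𝓡 n) (𝓡 (n + 1)) (F t) x)) ∧
    ∀ t ∈ Set.Ioo (-ε) ε, ∀ x ∉ K, F t x = φ x

/-- The initial velocity `∂F/∂t` at `t = 0` is the vector field `V` along `φ`. -/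
def HasInitialVelocity (φ : S → M) (F : ℝ → S → M)
    (V : ∀ x : S, TangentSpace (𝓡 (n + 1)) (φ x)) : Prop :=
  ∀ x, (⟨F 0 x, mfderiv 𝓘(ℝ, ℝ) (𝓡 (n + 1)) (fun t => F t x) 0 (1 : ℝ)⟩ :
      TangentBundle (𝓡 (n + 1)) M) = ⟨φ x, V x⟩

/-- `φ` is `f`-minimal: the first variation of the weighted area vanishes, for all compactly
supported variations. -/
def IsFMinimal [MeasurableSpace S] (g : Metric (n + 1) M) (f : M → ℝ) (φ : S → M) : Prop :=
  ∀ (F : ℝ → S → M) (K : Set S), IsVariation n φ F K →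
    HasDerivAt (fun t => weightedArea g f (F t) K) 0 0

/-- Stability: the second variation of the weighted area is nonnegative along every compactly
supported smooth normal vector field `u N`. -/
def IsStable [MeasurableSpace S] (g : Metric (n + 1) M) (f : M → ℝ) (φ : S → M)
    (N : ∀ x : S, TangentSpace (𝓡 (n + 1)) (φ x)) : Prop :=
  ∀ u : S → ℝ, ContMDiff (𝓡 n) 𝓘(ℝ, ℝ) ∞ u → HasCompactSupport u →
    ∀ (F : ℝ → S → M) (K : Set S), IsVariation n φ F K →
      HasInitialVelocity φ F (fun x => u x • N x) →
        0 ≤ deriv (deriv fun t => weightedArea g f (F t) K) 0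

end Hypersurface

end WeightedHypersurface

end

open WeightedHypersurface

set_option linter.unusedSectionVars false

/-! All areas are referred to the fixed area measure of `φ`. By the change of variables formula the
area measure of `F t` is `√(det h_t / det h_0)` times that of `φ`, where `h_t` is the induced
metric. The weighted area is therefore the integral over `K` of a density `D(t, x) = e^{-f(F t x)}
√(det h_t / det h_0)` against a measure independent of `t`. This density is smooth near `t = 0` and
`K` is compact, so one differentiates under the integral, for `t` near `0` and then once more at `0`
(`weightedArea_eq`, `hasDerivAt_setIntegral`).

Pointwise computation. Jacobi's formula gives `D'/D = tr(h⁻¹h')/2 - (f ∘ F)'`. Let `T` be the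
velocity. Since the Levi-Civita connection is metric and torsion-free, `h'_ij = ⟨∇_i T, ∂_j⟩ + ⟨∂_i,
∇_j T⟩`, hence `D'(0) = (div T - df(T)) e^{-f}`. In the second derivative, commuting `∇_T` with
`∇_i` produces curvature. If `T = λN`, then `∇_i T = λ_i N + λ ∇_i N`. The gradients give `|∇λ|²`,
the curvature gives `-λ² Ric(N,N)`, and `|A|²` appears with coefficient `λ²` from `⟨∇_i T, ∇_j T⟩`
and `-2λ²` from the derivative of `h⁻¹`. With the acceleration `W = ∇_T T` the result is `D''(0) =
(λ²(H - f_n)² + div W - df(W) + |∇λ|² - λ²(Ric_f(N,N) + |A|²)) e^{-f}`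
(`hasDerivAt_deriv_weightedDensity`).

Integration. Every smooth compactly supported field `V` along `φ`, normal or not, is the velocity of
some variation (`exists_isVariation`), so minimality says `∫ (div V - df(V)) e^{-f} = 0` for all
such `V` (`IsFMinimal.integral_firstVariation`). For `V = uN` this reads `∫ u (H - f_n) e^{-f} = 0`,
whence `H = f_n`. For `V = W` it removes the acceleration terms, whichever variation was chosen.
Only the stability integrand is left, and no integration by parts is needed. The equivalence with
stability follows because every `λN` is realised by a variation.

Ricci, Hessian, `A` and the volume are all defined through preferred charts, which change with the
point. Regularity in `x` therefore rests on transformation laws: that of the connection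
(`chartConn_transition`, from uniqueness of the Levi-Civita connection) and that of the Gram
determinant (`det_metricMatrix_transition`). -/

noncomputable section

namespace WeightedHypersurface

/-! ### Covariant differentiation along maps between vector spaces -/

section Calculus

variable {Q E F : Type*} [NormedAddCommGroup Q] [NormedSpace ℝ Q] [NormedAddCommGroup E]
  [NormedSpace ℝ E] [NormedAddCommGroup F] [NormedSpace ℝ F]

/-- Directional derivative. -/
def dd (a : Q) (u : Q → E) (q : Q) : E := fderiv ℝ u q a

lemma contDiffAt_dd {u : Q → E} {q : Q} (hu : ContDiffAt ℝ ∞ u q) (a : Q) :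
    ContDiffAt ℝ ∞ (dd a u) q :=
  (hu.fderiv_right (m := ∞) (by simp)).clm_apply contDiffAt_const

lemma dd_congr {u v : Q → E} {q : Q} (h : u =ᶠ[𝓝 q] v) (a : Q) : dd a u q = dd a v q := by
  rw [dd, dd, h.fderiv_eq]

lemma two_le_infty : (2 : WithTop ℕ∞) ≤ ∞ := WithTop.coe_le_coe.2 le_top

lemma isSymm_of_contDiffAt {u : Q → E} {q : Q} (hu : ContDiffAt ℝ 2 u q) :
    IsSymmSndFDerivAt ℝ u q :=
  hu.isSymmSndFDerivAt (by rw [minSmoothness_of_isRCLikeNormedField])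

lemma eventually_contDiffAt_two {u : Q → E} {q : Q} (hu : ContDiffAt ℝ ∞ u q) :
    ∀ᶠ r in 𝓝 q, ContDiffAt ℝ 2 u r :=
  (hu.of_le two_le_infty).eventually (by simp)

lemma eventually_differentiableAt {u : Q → E} {q : Q} (hu : ContDiffAt ℝ ∞ u q) :
    ∀ᶠ r in 𝓝 q, DifferentiableAt ℝ u r :=
  (eventually_contDiffAt_two hu).mono fun _ h => h.differentiableAt (by simp)

lemma dd_dd {u : Q → E} {q : Q} (hu : ContDiffAt ℝ 2 u q) (a b : Q) :
    dd a (dd b u) q = fderiv ℝ (fderiv ℝ u) q a b := by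
  have h1 : DifferentiableAt ℝ (fderiv ℝ u) q :=
    (hu.fderiv_right (m := 1) (by norm_num)).differentiableAt (by simp)
  have : fderiv ℝ (fun x => fderiv ℝ u x b) q a = _ :=
    congrArg (fun L => L a) (h1.hasFDerivAt.clm_apply (hasFDerivAt_const b q)).fderiv
  rw [dd]
  exact this.trans (by simp)

lemma dd_comm {u : Q → E} {q : Q} (hu : ContDiffAt ℝ 2 u q) (a b : Q) :
    dd a (dd b u) q = dd b (dd a u) q := by
  rw [dd_dd hu, dd_dd hu, isSymm_of_contDiffAt hu a b]

/-- Product rule for a point-dependent bilinear map evaluated on two fields along `γ`. The target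
`F` is left general because it serves both the metric (`F = ℝ`) and the connection (`F = E`). -/
lemma dd_trilinear {B : E → E →L[ℝ] E →L[ℝ] F} {γ X Y : Q → E} {q : Q}
    (hB : DifferentiableAt ℝ B (γ q)) (hγ : DifferentiableAt ℝ γ q)
    (hX : DifferentiableAt ℝ X q) (hY : DifferentiableAt ℝ Y q) (a : Q) :
    dd a (fun r => B (γ r) (X r) (Y r)) q
      = fderiv ℝ B (γ q) (dd a γ q) (X q) (Y q) + B (γ q) (dd a X q) (Y q)
        + B (γ q) (X q) (dd a Y q) := by
  have h0 : HasFDerivAt (fun r => B (γ r)) ((fderiv ℝ B (γ q)).comp (fderiv ℝ γ q)) q :=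
    HasFDerivAt.comp (g := B) q hB.hasFDerivAt hγ.hasFDerivAt
  have h := (h0.clm_apply hX.hasFDerivAt).clm_apply hY.hasFDerivAt
  have : fderiv ℝ (fun r => B (γ r) (X r) (Y r)) q a = _ := congrArg (fun L => L a) h.fderiv
  rw [dd, this]
  simp [dd]
  abel

/-- Covariant derivative, along `γ`, of a vector field `X` along `γ`. -/
def cov (Γ : E → E →L[ℝ] E →L[ℝ] E) (γ : Q → E) (a : Q) (X : Q → E) (q : Q) : E :=
  dd a X q + Γ (γ q) (dd a γ q) (X q)

/-- `Γ` is, at `z`, the Levi-Civita connection of `G`. -/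
structure IsLeviCivitaAt (G : E → E →L[ℝ] E →L[ℝ] ℝ) (Γ : E → E →L[ℝ] E →L[ℝ] E) (z : E) :
    Prop where
  symm : ∀ u v, Γ z u v = Γ z v u
  compat : ∀ u v w, fderiv ℝ G z u v w = G z (Γ z u v) w + G z v (Γ z u w)

/-- Riemann curvature of a connection. -/
def riem (Γ : E → E →L[ℝ] E →L[ℝ] E) (z u v w : E) : E :=
  fderiv ℝ Γ z u v w - fderiv ℝ Γ z v u w + Γ z u (Γ z v w) - Γ z v (Γ z u w)

lemma contDiffAt_cov {Γ : E → E →L[ℝ] E →L[ℝ] E} {γ X : Q → E} {q : Q}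
    (hΓ : ContDiffAt ℝ ∞ Γ (γ q)) (hγ : ContDiffAt ℝ ∞ γ q) (hX : ContDiffAt ℝ ∞ X q) (a : Q) :
    ContDiffAt ℝ ∞ (cov Γ γ a X) q :=
  (contDiffAt_dd hX a).add (((hΓ.comp q hγ).clm_apply (contDiffAt_dd hγ a)).clm_apply hX)

/-- Metric compatibility along a map: the derivative of `G` itself supplies exactly the two
connection terms that turn `dd` into `cov`. -/
lemma dd_inner {G : E → E →L[ℝ] E →L[ℝ] ℝ} {Γ : E → E →L[ℝ] E →L[ℝ] E} {γ X Y : Q → E} {q : Q}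
    (h : IsLeviCivitaAt G Γ (γ q)) (hG : DifferentiableAt ℝ G (γ q))
    (hγ : DifferentiableAt ℝ γ q) (hX : DifferentiableAt ℝ X q) (hY : DifferentiableAt ℝ Y q)
    (a : Q) :
    dd a (fun r => G (γ r) (X r) (Y r)) q
      = G (γ q) (cov Γ γ a X q) (Y q) + G (γ q) (X q) (cov Γ γ a Y q) := by
  rw [dd_trilinear hG hγ hX hY, h.compat]
  simp only [cov, map_add, add_apply]
  ring

/-- Torsion-freeness: partial derivatives of `γ` commute and `Γ` is symmetric. -/
lemma cov_dd_comm {G : E → E →L[ℝ] E →L[ℝ] ℝ} {Γ : E → E →L[ℝ] E →L[ℝ] E} {γ : Q → E} {q : Q}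
    (h : IsLeviCivitaAt G Γ (γ q)) (hγ : ContDiffAt ℝ 2 γ q) (a b : Q) :
    cov Γ γ a (dd b γ) q = cov Γ γ b (dd a γ) q := by
  rw [cov, cov, dd_comm hγ, h.symm]

/-- After expansion, the second partials of `X` and of `γ` are symmetric in `a` and `b`, as are
together the mixed terms containing one derivative of `X`. What remains is the curvature. -/
lemma cov_cov_sub {Γ : E → E →L[ℝ] E →L[ℝ] E} {γ X : Q → E} {q : Q}
    (hΓ : DifferentiableAt ℝ Γ (γ q)) (hγ : ContDiffAt ℝ ∞ γ q) (hX : ContDiffAt ℝ ∞ X q)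
    (a b : Q) :
    cov Γ γ a (cov Γ γ b X) q
      = cov Γ γ b (cov Γ γ a X) q + riem Γ (γ q) (dd a γ q) (dd b γ q) (X q) := by
  have dγ : DifferentiableAt ℝ γ q := hγ.differentiableAt (by simp)
  have dX : DifferentiableAt ℝ X q := hX.differentiableAt (by simp)
  have key : ∀ a b : Q, cov Γ γ a (cov Γ γ b X) q = dd a (dd b X) q
      + (fderiv ℝ Γ (γ q) (dd a γ q) (dd b γ q) (X q) + Γ (γ q) (dd a (dd b γ) q) (X q)
        + Γ (γ q) (dd b γ q) (dd a X q))
      + Γ (γ q) (dd a γ q) (dd b X q + Γ (γ q) (dd b γ q) (X q)) := by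
    intro a b
    have d1 : DifferentiableAt ℝ (dd b γ) q := (contDiffAt_dd hγ b).differentiableAt (by simp)
    have d2 : DifferentiableAt ℝ (dd b X) q := (contDiffAt_dd hX b).differentiableAt (by simp)
    have d3 : DifferentiableAt ℝ (fun r => Γ (γ r) (dd b γ r) (X r)) q :=
      (((hΓ.comp q dγ).clm_apply d1).clm_apply dX)
    have : dd a (cov Γ γ b X) q
        = dd a (dd b X) q + dd a (fun r => Γ (γ r) (dd b γ r) (X r)) q := by
      change fderiv ℝ (dd b X + fun r => Γ (γ r) (dd b γ r) (X r)) q a = _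
      rw [fderiv_add d2 d3]; rfl
    rw [cov, this, dd_trilinear hΓ dγ d1 dX]
    rfl
  rw [key, key, dd_comm (hX.of_le two_le_infty) a b, dd_comm (hγ.of_le two_le_infty) a b, riem]
  simp only [map_add]
  abel

/-- Uniqueness of the Levi-Civita connection, in the form of its transformation law under a change
of coordinates. -/
lemma IsLeviCivitaAt.transform {G₁ G₂ : E → E →L[ℝ] E →L[ℝ] ℝ} {Γ₁ Γ₂ : E → E →L[ℝ] E →L[ℝ] E}
    {τ : E → E} {z : E} (hτ : ContDiffAt ℝ ∞ τ z)
    (hG : ∀ᶠ y in 𝓝 z, ∀ u v, G₁ y u v = G₂ (τ y) (fderiv ℝ τ y u) (fderiv ℝ τ y v))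
    (d₁ : DifferentiableAt ℝ G₁ z) (d₂ : DifferentiableAt ℝ G₂ (τ z))
    (h₁ : IsLeviCivitaAt G₁ Γ₁ z) (h₂ : IsLeviCivitaAt G₂ Γ₂ (τ z))
    (symm₂ : ∀ u v, G₂ (τ z) u v = G₂ (τ z) v u)
    (nondeg : ∀ u, (∀ w, G₂ (τ z) u (fderiv ℝ τ z w) = 0) → u = 0) (u v : E) :
    fderiv ℝ τ z (Γ₁ z u v)
      = fderiv ℝ (fderiv ℝ τ) z u v + Γ₂ (τ z) (fderiv ℝ τ z u) (fderiv ℝ τ z v) := by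
  have dτ : DifferentiableAt ℝ τ z := hτ.differentiableAt (by simp)
  have hs := isSymm_of_contDiffAt (hτ.of_le two_le_infty)
  set T := fderiv ℝ τ z with hT
  have ddT : ∀ u v, dd u (dd v τ) z = fderiv ℝ (fderiv ℝ τ) z u v :=
    dd_dd (hτ.of_le two_le_infty)
  -- `Δ` is the defect in the transformation law. It is symmetric because both connections and the
  -- second derivative of `τ` are.
  set Δ : E → E → E := fun u v => T (Γ₁ z u v) - (fderiv ℝ (fderiv ℝ τ) z u v + Γ₂ (τ z) (T u) (T v))
    with hΔ
  have Δs : ∀ u v, Δ u v = Δ v u := by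
    intro u v
    simp only [hΔ]
    rw [h₁.symm u v, hs u v, h₂.symm]
  have e0 : ∀ u v, G₁ z u v = G₂ (τ z) (T u) (T v) := hG.self_of_nhds
  -- Differentiating the isometry relation `hG` and using compatibility on both sides makes the
  -- defect skew in its last two slots.
  have comp : ∀ u v w, G₂ (τ z) (Δ u v) (T w) + G₂ (τ z) (T v) (Δ u w) = 0 := by
    intro u v w
    have l : dd u (fun y => G₁ y v w) z = fderiv ℝ G₁ z u v w := by
      have := dd_trilinear (B := G₁) (γ := id) (X := fun _ => v) (Y := fun _ => w) (q := z) d₁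
        differentiableAt_id (differentiableAt_const _) (differentiableAt_const _) u
      simpa [dd] using this
    have r : dd u (fun y => G₂ (τ y) (dd v τ y) (dd w τ y)) z = _ :=
      dd_trilinear (B := G₂) (γ := τ) (X := dd v τ) (Y := dd w τ) (q := z) d₂ dτ
        ((contDiffAt_dd hτ v).differentiableAt (by simp))
        ((contDiffAt_dd hτ w).differentiableAt (by simp)) u
    have e : (fun y => G₁ y v w) =ᶠ[𝓝 z] fun y => G₂ (τ y) (dd v τ y) (dd w τ y) :=
      hG.mono fun y hy => hy v w
    rw [← dd_congr e, l, h₁.compat, e0, e0] at r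
    have c2 : fderiv ℝ G₂ (τ z) (dd u τ z) (dd v τ z) (dd w τ z)
        = G₂ (τ z) (Γ₂ (τ z) (T u) (T v)) (T w) + G₂ (τ z) (T v) (Γ₂ (τ z) (T u) (T w)) :=
      h₂.compat _ _ _
    rw [c2, ddT, ddT] at r
    change _ = _ + G₂ (τ z) _ (T w) + G₂ (τ z) (T v) _ at r
    simp only [hΔ, map_sub, map_add, sub_apply, add_apply]
    linarith
  have zero : Δ u v = 0 := by
    apply nondeg
    intro w
    -- A trilinear expression symmetric in the first two slots and skew in the last two vanishes:
    -- combine the three cyclic instances, as in the Koszul argument.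
    have a1 := comp u v w
    have a2 := comp v w u
    have a3 := comp w u v
    rw [symm₂ (T v)] at a1
    rw [symm₂ (T w)] at a2
    rw [symm₂ (T u)] at a3
    rw [Δs w u] at a3
    rw [Δs w v] at a3
    rw [Δs v u] at a2
    linarith
  exact sub_eq_zero.mp zero

end Calculus

/-! ### Derivatives of determinants -/

section Determinant

variable {n : ℕ}

lemma differentiable_det :
    Differentiable ℝ fun A : Fin n → Fin n → ℝ => Matrix.det (Matrix.of A) := by
  simp only [Matrix.det_apply, Matrix.of_apply]
  fun_prop

/-- Jacobi's formula. The chain rule reduces it to the derivative of `det` at `H t` in the direction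
`H'`. -/
lemma hasDerivAt_det {H : ℝ → Matrix (Fin n) (Fin n) ℝ} {H' : Matrix (Fin n) (Fin n) ℝ} {t : ℝ}
    (h : ∀ i j, HasDerivAt (fun s => H s i j) (H' i j) t) (h0 : (H t).det ≠ 0) :
    HasDerivAt (fun s => (H s).det) ((H t).det * ((H t)⁻¹ * H').trace) t := by
  have hu : IsUnit (H t).det := isUnit_iff_ne_zero.2 h0
  set d := fun A : Fin n → Fin n → ℝ => Matrix.det (Matrix.of A) with hd
  have hA : HasDerivAt (fun s => (fun i j => H s i j : Fin n → Fin n → ℝ)) (fun i j => H' i j) t :=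
    hasDerivAt_pi.2 fun i => hasDerivAt_pi.2 fun j => h i j
  have hF := (differentiable_det (n := n) (fun i j => H t i j)).hasFDerivAt
  -- This directional derivative is computed along the line `H + r H' = H (1 + r H⁻¹H')`, where
  -- `Matrix.det_one_add_smul` exhibits the coefficient of `r` as a trace.
  have key : fderiv ℝ d (fun i j => H t i j) (fun i j => H' i j)
      = (H t).det * ((H t)⁻¹ * H').trace := by
    have l1 : HasDerivAt (fun r : ℝ => (fun i j => H t i j + r * H' i j : Fin n → Fin n → ℝ))
        (fun i j => H' i j) 0 :=
      hasDerivAt_pi.2 fun i => hasDerivAt_pi.2 fun j => by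
        simpa using ((hasDerivAt_id (0 : ℝ)).mul_const (H' i j)).const_add (H t i j)
    have l2 : HasDerivAt (fun r : ℝ => d (fun i j => H t i j + r * H' i j))
        (fderiv ℝ d (fun i j => H t i j) (fun i j => H' i j)) 0 := by
      have hF' : HasFDerivAt d (fderiv ℝ d (fun i j => H t i j))
          ((fun r : ℝ => (fun i j => H t i j + r * H' i j : Fin n → Fin n → ℝ)) 0) := by
        simpa using hF
      exact hF'.comp_hasDerivAt (0 : ℝ) l1
    have e : ∀ r : ℝ, d (fun i j => H t i j + r * H' i j)
        = (H t).det * (1 + ((H t)⁻¹ * H').trace * r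
          + ((Matrix.det (1 + (Polynomial.X : Polynomial ℝ) •
            ((H t)⁻¹ * H').map Polynomial.C)).divX.divX.eval r) * r ^ 2) := by
      intro r
      have em : (Matrix.of fun i j => H t i j + r * H' i j)
          = H t * (1 + r • ((H t)⁻¹ * H')) := by
        rw [mul_add, mul_one, Matrix.mul_smul, Matrix.mul_nonsing_inv_cancel_left _ _ hu]
        ext i j
        simp
      rw [← Matrix.det_one_add_smul, ← Matrix.det_mul, ← em]
    have l3 := l2
    simp_rw [e] at l3
    refine l3.unique ?_
    set P := (Matrix.det (1 + (Polynomial.X : Polynomial ℝ) •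
      ((H t)⁻¹ * H').map Polynomial.C)).divX.divX
    have := ((((hasDerivAt_id (0 : ℝ)).const_mul ((H t)⁻¹ * H').trace).const_add 1).add
      ((P.hasDerivAt 0).mul ((hasDerivAt_id (0 : ℝ)).pow 2))).const_mul (H t).det
    simpa using this
  rw [← key]
  exact hF.comp_hasDerivAt t hA

/-- The constant `c` will be the determinant at time `0`: the quotient, unlike the determinant, does
not depend on the chart. -/
lemma hasDerivAt_sqrt_det {H : ℝ → Matrix (Fin n) (Fin n) ℝ} {H' : Matrix (Fin n) (Fin n) ℝ}
    {t c : ℝ} (h : ∀ i j, HasDerivAt (fun s => H s i j) (H' i j) t) (h0 : 0 < (H t).det)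
    (hc : 0 < c) :
    HasDerivAt (fun s => √((H s).det / c)) (√((H t).det / c) * (((H t)⁻¹ * H').trace / 2)) t := by
  have h1 := ((hasDerivAt_det h h0.ne').div_const c).sqrt (div_pos h0 hc).ne'
  convert h1 using 1
  have hp : 0 < (H t).det / c := div_pos h0 hc
  have hs : 0 < √((H t).det / c) := Real.sqrt_pos.2 hp
  rw [eq_div_iff (by positivity)]
  have := Real.mul_self_sqrt hp.le
  calc _ = (√((H t).det / c) * √((H t).det / c)) * ((H t)⁻¹ * H').trace := by ring
    _ = _ := by rw [this]; ring

/-- Cramer's rule shows that the entries of the inverse are differentiable; their derivative is then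
solved for by differentiating `H H⁻¹ = 1`. -/
lemma hasDerivAt_inv_matrix {H : ℝ → Matrix (Fin n) (Fin n) ℝ} {H' : Matrix (Fin n) (Fin n) ℝ}
    {t : ℝ} (h : ∀ i j, HasDerivAt (fun s => H s i j) (H' i j) t) (h0 : (H t).det ≠ 0) (i j) :
    HasDerivAt (fun s => (H s)⁻¹ i j) ((-((H t)⁻¹ * H' * (H t)⁻¹)) i j) t := by
  have hA : HasDerivAt (fun s => (fun i j => H s i j : Fin n → Fin n → ℝ)) (fun i j => H' i j) t :=
    hasDerivAt_pi.2 fun i => hasDerivAt_pi.2 fun j => h i j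
  have dd : ∀ i j, DifferentiableAt ℝ (fun s => (H s)⁻¹ i j) t := by
    intro i j
    have e : ∀ s, (H s)⁻¹ i j = ((H s).det)⁻¹ * ((H s).updateRow j (Pi.single i 1)).det := by
      intro s
      rw [Matrix.inv_def, Matrix.smul_apply, Matrix.adjugate_apply, Ring.inverse_eq_inv', smul_eq_mul]
    simp_rw [e]
    refine ((hasDerivAt_det h h0).differentiableAt.inv h0).mul ?_
    refine (differentiable_det (n := n)).differentiableAt.comp t
      (f := fun s => fun a b => ((H s).updateRow j (Pi.single i 1)) a b) ?_
    refine differentiableAt_pi.2 fun a => differentiableAt_pi.2 fun b => ?_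
    by_cases ha : a = j
    · subst ha; simp
    · simpa [Matrix.updateRow_ne ha] using (h a b).differentiableAt
  set I' : Matrix (Fin n) (Fin n) ℝ := Matrix.of fun i j => deriv (fun s => (H s)⁻¹ i j) t with hI
  have hI' : ∀ i j, HasDerivAt (fun s => (H s)⁻¹ i j) (I' i j) t := fun i j => (dd i j).hasDerivAt
  suffices I' = -((H t)⁻¹ * H' * (H t)⁻¹) by rw [← this]; exact hI' i j
  have ev : ∀ᶠ s in 𝓝 t, (H s).det ≠ 0 :=
    (hasDerivAt_det h h0).continuousAt.eventually_ne h0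
  have prod : H' * (H t)⁻¹ + H t * I' = 0 := by
    ext a b
    have l : HasDerivAt (fun s => (H s * (H s)⁻¹) a b) ((H' * (H t)⁻¹ + H t * I') a b) t := by
      simp only [Matrix.mul_apply, Matrix.add_apply, ← Finset.sum_add_distrib]
      exact HasDerivAt.fun_sum fun k _ => (h a k).mul (hI' k b)
    have r : HasDerivAt (fun s => (H s * (H s)⁻¹) a b) 0 t := by
      refine (hasDerivAt_const t ((1 : Matrix (Fin n) (Fin n) ℝ) a b)).congr_of_eventuallyEq ?_
      filter_upwards [ev] with s hs
      rw [Matrix.mul_nonsing_inv _ (isUnit_iff_ne_zero.2 hs)]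
    simpa using l.unique r
  have := congrArg (fun A => (H t)⁻¹ * A) prod
  simp only [mul_add, Matrix.mul_zero,
    Matrix.nonsing_inv_mul_cancel_left _ _ (isUnit_iff_ne_zero.2 h0)] at this
  rw [eq_neg_iff_add_eq_zero, mul_assoc, add_comm]
  exact this

/-- Applied with `K = H'`, this is the source of the term `-tr(h⁻¹h'h⁻¹h')`, hence of the negative
contribution of `|A|²`. -/
lemma hasDerivAt_trace_inv_mul {H K : ℝ → Matrix (Fin n) (Fin n) ℝ}
    {H' K' : Matrix (Fin n) (Fin n) ℝ}
    {t : ℝ} (h : ∀ i j, HasDerivAt (fun s => H s i j) (H' i j) t)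
    (k : ∀ i j, HasDerivAt (fun s => K s i j) (K' i j) t) (h0 : (H t).det ≠ 0) :
    HasDerivAt (fun s => ((H s)⁻¹ * K s).trace)
      (((H t)⁻¹ * K').trace - ((H t)⁻¹ * H' * ((H t)⁻¹ * K t)).trace) t := by
  have e : ((H t)⁻¹ * K').trace - ((H t)⁻¹ * H' * ((H t)⁻¹ * K t)).trace
      = (-((H t)⁻¹ * H' * (H t)⁻¹) * K t + (H t)⁻¹ * K').trace := by
    rw [Matrix.trace_add, neg_mul, Matrix.trace_neg, mul_assoc ((H t)⁻¹ * H')]; ring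
  rw [e]
  simp only [Matrix.trace, Matrix.diag, Matrix.mul_apply (M := (H _)⁻¹), Matrix.add_apply,
    Matrix.mul_apply (N := K t), ← Finset.sum_add_distrib]
  exact HasDerivAt.fun_sum fun i _ => HasDerivAt.fun_sum fun j _ =>
    (hasDerivAt_inv_matrix h h0 i j).mul (k j i)

end Determinant

/-! ### Orthogonal decomposition along a hyperplane -/

section Frame

variable {n : ℕ} {E : Type*} [NormedAddCommGroup E] [NormedSpace ℝ E]

/-- `p` is a frame of the orthogonal complement of the unit vector `ν`, for the symmetric
bilinear form `G`. -/
structure IsAdaptedFrame (G : E →L[ℝ] E →L[ℝ] ℝ) (p : Fin n → E) (ν : E) : Prop where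
  symm : ∀ u v, G u v = G v u
  normal : ∀ i, G (p i) ν = 0
  unit : G ν ν = 1
  det_ne : (Matrix.of fun i j => G (p i) (p j)).det ≠ 0

namespace IsAdaptedFrame

variable {G : E →L[ℝ] E →L[ℝ] ℝ} {p : Fin n → E} {ν : E}

lemma inv_symm (h : IsAdaptedFrame G p ν) (i j : Fin n) :
    (Matrix.of fun i j => G (p i) (p j))⁻¹ i j = (Matrix.of fun i j => G (p i) (p j))⁻¹ j i := by
  have : (Matrix.of fun i j => G (p i) (p j)).IsSymm := by
    ext i j; simp [h.symm]
  have h2 : ((Matrix.of fun i j => G (p i) (p j))⁻¹).transpose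
      = (Matrix.of fun i j => G (p i) (p j))⁻¹ := by
    rw [Matrix.transpose_nonsing_inv, this.eq]
  exact (congrFun (congrFun h2 j) i)

/-- The nonzero Gram determinant and the orthogonality of `ν` make the `n + 1` vectors independent,
hence a basis. The right-hand side is linear in `u`, so it suffices to compare on that basis. -/
lemma decomp (h : IsAdaptedFrame G p ν) [FiniteDimensional ℝ E]
    (hd : Module.finrank ℝ E = n + 1) (u : E) :
    u = ∑ i, ∑ j, ((Matrix.of fun i j => G (p i) (p j))⁻¹ i j * G u (p j)) • p i + G u ν • ν := by
  set A := Matrix.of fun i j => G (p i) (p j) with hA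
  have hu : IsUnit A.det := isUnit_iff_ne_zero.2 h.det_ne
  have lin : LinearIndependent ℝ (Sum.elim p fun _ : Unit => ν) := by
    rw [Fintype.linearIndependent_iff]
    intro c hc
    simp only [Fintype.sum_sum_type, Sum.elim_inl, Sum.elim_inr, Finset.univ_unique,
      Finset.sum_singleton] at hc
    have c0 : c (Sum.inr default) = 0 := by
      have := congrArg (fun x => G x ν) hc
      simpa [h.normal, h.unit] using this
    rw [c0, zero_smul, add_zero] at hc
    have hv : Matrix.vecMul (fun i => c (Sum.inl i)) A = 0 := by
      ext j
      have := congrArg (fun x => G x (p j)) hc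
      simpa [Matrix.vecMul, dotProduct, hA] using this
    have hz := Matrix.eq_zero_of_vecMul_eq_zero h.det_ne hv
    rintro (i | i)
    · exact congrFun hz i
    · exact c0
  let b := basisOfLinearIndependentOfCardEqFinrank lin (by simp [hd])
  have hb : ∀ k, b k = Sum.elim p (fun _ : Unit => ν) k := fun k => by simp [b]
  let L : E →ₗ[ℝ] E := ∑ i, ∑ j, A⁻¹ i j • (G.flip (p j) : E →ₗ[ℝ] ℝ).smulRight (p i)
    + (G.flip ν : E →ₗ[ℝ] ℝ).smulRight ν
  have hL : L = LinearMap.id := by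
    refine b.ext ?_
    rintro (k | k)
    · have : ∀ i, (∑ j, A⁻¹ i j * G (p k) (p j)) = if i = k then 1 else 0 := by
        intro i
        have := congrFun (congrFun (Matrix.nonsing_inv_mul A hu) i) k
        rw [Matrix.mul_apply, Matrix.one_apply] at this
        rw [← this]
        exact Finset.sum_congr rfl fun j _ => by rw [h.symm]; rfl
      simp [L, hb, h.normal, smul_smul, ← Finset.sum_smul, this]
    · have hn : ∀ i, G ν (p i) = 0 := fun i => by rw [h.symm, h.normal]
      simp [L, hb, hn, h.unit]
  have := congrArg (fun l => l u) hL
  simpa [L, smul_smul] using this.symm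

/-- Pairing `decomp` with `w`. It will express `⟨∇_i N, ∇_j N⟩` through the shape matrix. -/
lemma inner_eq (h : IsAdaptedFrame G p ν) [FiniteDimensional ℝ E]
    (hd : Module.finrank ℝ E = n + 1) (u w : E) :
    G u w = ∑ i, ∑ j, (Matrix.of fun i j => G (p i) (p j))⁻¹ i j * G u (p j) * G w (p i)
      + G u ν * G w ν := by
  conv_lhs => rw [h.decomp hd u]
  simp only [map_add, map_sum, add_apply, FunLike.coe_sum, Finset.sum_apply, map_smul,
    FunLike.coe_smul, Pi.smul_apply, smul_eq_mul, h.symm w]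

/-- By `decomp`, `T` is a sum of rank-one maps, whose traces are immediate. This splits the Ricci
trace into a tangential sum and a normal term. -/
lemma trace_eq (h : IsAdaptedFrame G p ν) [FiniteDimensional ℝ E]
    (hd : Module.finrank ℝ E = n + 1) (T : E →ₗ[ℝ] E) :
    LinearMap.trace ℝ E T
      = ∑ i, ∑ j, (Matrix.of fun i j => G (p i) (p j))⁻¹ i j * G (T (p i)) (p j) + G (T ν) ν := by
  set A := Matrix.of fun i j => G (p i) (p j) with hA
  have hT : T = ∑ i, ∑ j, A⁻¹ i j • (G.flip (p j) : E →ₗ[ℝ] ℝ).smulRight (T (p i))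
      + (G.flip ν : E →ₗ[ℝ] ℝ).smulRight (T ν) := by
    ext u
    conv_lhs => rw [h.decomp hd u]
    simp [smul_smul, hA]
  conv_lhs => rw [hT]
  simp

end IsAdaptedFrame

end Frame

/-! ### First and second variation in coordinates -/

section Variation

variable {n : ℕ} {Q E : Type*} [NormedAddCommGroup Q] [NormedSpace ℝ Q] [NormedAddCommGroup E]
  [NormedSpace ℝ E]

/-- `G` is a smooth symmetric metric with Levi-Civita connection `Γ` near `z`. -/
structure IsLocalGeometry (G : E → E →L[ℝ] E →L[ℝ] ℝ) (Γ : E → E →L[ℝ] E →L[ℝ] E) (z : E) :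
    Prop where
  smooth_metric : ContDiffAt ℝ ∞ G z
  smooth_connection : ContDiffAt ℝ ∞ Γ z
  levi_civita : ∀ᶠ y in 𝓝 z, IsLeviCivitaAt G Γ y
  symm : ∀ᶠ y in 𝓝 z, ∀ u v, G y u v = G y v u

/-- The Gram matrix of the vectors `dγ(e_i)`. -/
def gram (G : E → E →L[ℝ] E →L[ℝ] ℝ) (γ : Q → E) (e : Fin n → Q) (q : Q) :
    Matrix (Fin n) (Fin n) ℝ :=
  Matrix.of fun i j => G (γ q) (dd (e i) γ q) (dd (e j) γ q)

/-- The tangential divergence of a vector field along `γ`. -/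
def tdiv (G : E → E →L[ℝ] E →L[ℝ] ℝ) (Γ : E → E →L[ℝ] E →L[ℝ] E) (γ : Q → E) (e : Fin n → Q)
    (X : Q → E) (q : Q) : ℝ :=
  ∑ i, ∑ j, (gram G γ e q)⁻¹ i j * G (γ q) (cov Γ γ (e i) X q) (dd (e j) γ q)

/-- The Hessian of a function with respect to a connection. -/
def hess (Γ : E → E →L[ℝ] E →L[ℝ] E) (f : E → ℝ) (z u v : E) : ℝ :=
  fderiv ℝ (fderiv ℝ f) z u v - fderiv ℝ f z (Γ z u v)

/-- The linear map `u ↦ R(u, v)w`. -/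
def riemMap (Γ : E → E →L[ℝ] E →L[ℝ] E) (z v w : E) : E →ₗ[ℝ] E where
  toFun u := riem Γ z u v w
  map_add' a b := by simp only [riem, map_add, add_apply]; abel
  map_smul' c a := by
    simp only [riem, map_smul, FunLike.coe_smul, Pi.smul_apply, RingHom.id_apply, smul_sub,
      smul_add]

/-- The Ricci curvature of a connection. -/
def ric (Γ : E → E →L[ℝ] E →L[ℝ] E) (z v w : E) : ℝ := LinearMap.trace ℝ E (riemMap Γ z v w)

lemma hasDerivAt_line {u : Q → E} {q T : Q} {t : ℝ} (hu : DifferentiableAt ℝ u (q + t • T)) :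
    HasDerivAt (fun s : ℝ => u (q + s • T)) (dd T u (q + t • T)) t := by
  have : HasDerivAt (fun s : ℝ => q + s • T) T t := by
    simpa using ((hasDerivAt_id t).smul_const T).const_add q
  exact hu.hasFDerivAt.comp_hasDerivAt t this

lemma tendsto_line (q T : Q) : Filter.Tendsto (fun s : ℝ => q + s • T) (𝓝 0) (𝓝 q) := by
  have : Continuous fun s : ℝ => q + s • T := by fun_prop
  simpa using this.tendsto 0

variable {G : E → E →L[ℝ] E →L[ℝ] ℝ} {Γ : E → E →L[ℝ] E →L[ℝ] E} {γ : Q → E} {q : Q}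

lemma contDiffAt_gram (hG : ContDiffAt ℝ ∞ G (γ q)) (hγ : ContDiffAt ℝ ∞ γ q) (e : Fin n → Q)
    (i j : Fin n) : ContDiffAt ℝ ∞ (fun r => gram G γ e r i j) q :=
  ((hG.comp q hγ).clm_apply (contDiffAt_dd hγ (e i))).clm_apply (contDiffAt_dd hγ (e j))

lemma contDiffAt_det {A : Q → Matrix (Fin n) (Fin n) ℝ}
    (hA : ∀ i j, ContDiffAt ℝ ∞ (fun r => A r i j) q) : ContDiffAt ℝ ∞ (fun r => (A r).det) q := by
  simp only [Matrix.det_apply']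
  refine ContDiffAt.sum fun σ _ => ?_
  exact contDiffAt_const.mul (contDiffAt_prod fun i _ => hA _ _)

lemma gram_symm (h : IsLocalGeometry G Γ (γ q)) (e : Fin n → Q) (i j : Fin n) :
    gram G γ e q i j = gram G γ e q j i := h.symm.self_of_nhds _ _

lemma gram_inv_symm (h : IsLocalGeometry G Γ (γ q)) (e : Fin n → Q) (i j : Fin n) :
    (gram G γ e q)⁻¹ i j = (gram G γ e q)⁻¹ j i := by
  have : (gram G γ e q).transpose = gram G γ e q := by
    ext i j; exact gram_symm h e j i
  have h2 : ((gram G γ e q)⁻¹).transpose = (gram G γ e q)⁻¹ := by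
    rw [Matrix.transpose_nonsing_inv, this]
  exact congrFun (congrFun h2 j) i

lemma trace_mul_eq_sum (A B : Matrix (Fin n) (Fin n) ℝ) :
    (A * B).trace = ∑ i, ∑ j, A i j * B j i := by
  simp [Matrix.trace, Matrix.mul_apply]

/-- Metric compatibility, followed by `∇_T ∂_i = ∇_i ∂_T`. It is stated on a neighbourhood because
it is differentiated again in `dd_dd_gram`. -/
lemma dd_gram_eventually (h : IsLocalGeometry G Γ (γ q)) (hγ : ContDiffAt ℝ ∞ γ q)
    (e : Fin n → Q) (T : Q) (i j : Fin n) :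
    dd T (fun r => gram G γ e r i j) =ᶠ[𝓝 q] fun r =>
      G (γ r) (cov Γ γ (e i) (dd T γ) r) (dd (e j) γ r)
        + G (γ r) (dd (e i) γ r) (cov Γ γ (e j) (dd T γ) r) := by
  have c := hγ.continuousAt
  filter_upwards [c.eventually (eventually_differentiableAt h.smooth_metric),
    c.eventually h.levi_civita, eventually_contDiffAt_two hγ,
    eventually_differentiableAt (contDiffAt_dd hγ (e i)),
    eventually_differentiableAt (contDiffAt_dd hγ (e j))] with r h1 h2 h3 h4 h5
  rw [← cov_dd_comm h2 h3 T, ← cov_dd_comm h2 h3 T]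
  exact dd_inner h2 h1 (h3.differentiableAt (by simp)) h4 h5 T

/-- The inverse Gram matrix is symmetric, so both halves of the derivative contribute the same
divergence. -/
lemma trace_dd_gram (h : IsLocalGeometry G Γ (γ q)) (hγ : ContDiffAt ℝ ∞ γ q)
    (e : Fin n → Q) (T : Q) :
    ((gram G γ e q)⁻¹ * Matrix.of fun i j => dd T (fun r => gram G γ e r i j) q).trace
      = 2 * tdiv G Γ γ e (dd T γ) q := by
  rw [trace_mul_eq_sum, two_mul]
  have h0 : ∀ i j, dd T (fun r => gram G γ e r i j) q = _ := fun i j =>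
    (dd_gram_eventually h hγ e T i j).eq_of_nhds
  simp only [Matrix.of_apply, h0, mul_add, Finset.sum_add_distrib, tdiv]
  congr 1
  · rw [Finset.sum_comm]
    exact Finset.sum_congr rfl fun i _ => Finset.sum_congr rfl fun j _ => by
      rw [gram_inv_symm h]
  · exact Finset.sum_congr rfl fun i _ => Finset.sum_congr rfl fun j _ => by
      rw [h.symm.self_of_nhds]

/-- Moving `∇_T` past `∇_i` turns `∇_T ∇_i T` into `∇_i` of the acceleration plus curvature; when
`∇_T` falls on `∂_j` it gives `∇_j T`, hence the product term. -/
lemma dd_dd_gram (h : IsLocalGeometry G Γ (γ q)) (hγ : ContDiffAt ℝ ∞ γ q)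
    (e : Fin n → Q) (T : Q) (i j : Fin n) :
    dd T (dd T (fun r => gram G γ e r i j)) q =
      G (γ q) (cov Γ γ (e i) (cov Γ γ T (dd T γ)) q) (dd (e j) γ q)
      + G (γ q) (riem Γ (γ q) (dd T γ q) (dd (e i) γ q) (dd T γ q)) (dd (e j) γ q)
      + G (γ q) (cov Γ γ (e i) (dd T γ) q) (cov Γ γ (e j) (dd T γ) q)
      + (G (γ q) (cov Γ γ (e j) (cov Γ γ T (dd T γ)) q) (dd (e i) γ q)
      + G (γ q) (riem Γ (γ q) (dd T γ q) (dd (e j) γ q) (dd T γ q)) (dd (e i) γ q)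
      + G (γ q) (cov Γ γ (e j) (dd T γ) q) (cov Γ γ (e i) (dd T γ) q)) := by
  have lc := h.levi_civita.self_of_nhds
  have sym := h.symm.self_of_nhds
  have dG := h.smooth_metric.differentiableAt (by simp)
  have dΓ := h.smooth_connection.differentiableAt (by simp)
  have dγ := hγ.differentiableAt (by simp)
  have sT := contDiffAt_dd hγ T
  have sc : ∀ i, ContDiffAt ℝ ∞ (cov Γ γ (e i) (dd T γ)) q := fun i =>
    contDiffAt_cov h.smooth_connection hγ sT (e i)
  have se : ∀ i, ContDiffAt ℝ ∞ (dd (e i) γ) q := fun i => contDiffAt_dd hγ (e i)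
  have d1 : DifferentiableAt ℝ
      (fun r => G (γ r) (cov Γ γ (e i) (dd T γ) r) (dd (e j) γ r)) q :=
    (((h.smooth_metric.comp q hγ).clm_apply (sc i)).clm_apply (se j)).differentiableAt (by simp)
  have d2 : DifferentiableAt ℝ
      (fun r => G (γ r) (dd (e i) γ r) (cov Γ γ (e j) (dd T γ) r)) q :=
    (((h.smooth_metric.comp q hγ).clm_apply (se i)).clm_apply (sc j)).differentiableAt (by simp)
  rw [dd_congr (dd_gram_eventually h hγ e T i j)]
  have hadd : dd T (fun r => G (γ r) (cov Γ γ (e i) (dd T γ) r) (dd (e j) γ r)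
        + G (γ r) (dd (e i) γ r) (cov Γ γ (e j) (dd T γ) r)) q
      = dd T (fun r => G (γ r) (cov Γ γ (e i) (dd T γ) r) (dd (e j) γ r)) q
        + dd T (fun r => G (γ r) (dd (e i) γ r) (cov Γ γ (e j) (dd T γ) r)) q :=
    congrArg (fun L => L T) (fderiv_fun_add d1 d2)
  have e1 : ∀ i, cov Γ γ T (cov Γ γ (e i) (dd T γ)) q
      = cov Γ γ (e i) (cov Γ γ T (dd T γ)) q
        + riem Γ (γ q) (dd T γ q) (dd (e i) γ q) (dd T γ q) := fun i =>
    cov_cov_sub dΓ hγ sT T (e i)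
  have e2 : ∀ i, cov Γ γ T (dd (e i) γ) q = cov Γ γ (e i) (dd T γ) q := fun i =>
    cov_dd_comm lc (hγ.of_le two_le_infty) T (e i)
  rw [hadd, dd_inner lc dG dγ ((sc i).differentiableAt (by simp))
    ((se j).differentiableAt (by simp)), dd_inner lc dG dγ ((se i).differentiableAt (by simp))
    ((sc j).differentiableAt (by simp)), e1, e1, e2, e2,
    sym (dd (e i) γ q), sym (cov Γ γ (e i) (dd T γ) q) (cov Γ γ (e j) (dd T γ) q)]
  simp only [map_add, add_apply]
  ring

lemma trace_dd_dd_gram (h : IsLocalGeometry G Γ (γ q)) (hγ : ContDiffAt ℝ ∞ γ q)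
    (e : Fin n → Q) (T : Q) :
    ((gram G γ e q)⁻¹ * Matrix.of fun i j => dd T (dd T (fun r => gram G γ e r i j)) q).trace
      = 2 * (tdiv G Γ γ e (cov Γ γ T (dd T γ)) q
        + ∑ i, ∑ j, (gram G γ e q)⁻¹ i j *
            G (γ q) (riem Γ (γ q) (dd T γ q) (dd (e i) γ q) (dd T γ q)) (dd (e j) γ q)
        + ∑ i, ∑ j, (gram G γ e q)⁻¹ i j *
            G (γ q) (cov Γ γ (e i) (dd T γ) q) (cov Γ γ (e j) (dd T γ) q)) := by
  rw [trace_mul_eq_sum, two_mul]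
  simp only [Matrix.of_apply, dd_dd_gram h hγ, tdiv, mul_add, Finset.sum_add_distrib]
  have sw : ∀ B : Fin n → Fin n → ℝ, ∑ i, ∑ j, (gram G γ e q)⁻¹ i j * B j i
      = ∑ i, ∑ j, (gram G γ e q)⁻¹ i j * B i j := by
    intro B
    rw [Finset.sum_comm]
    exact Finset.sum_congr rfl fun i _ => Finset.sum_congr rfl fun j _ => by
      rw [gram_inv_symm h]
  rw [sw (fun i j => G (γ q) (cov Γ γ (e i) (cov Γ γ T (dd T γ)) q) (dd (e j) γ q)),
    sw (fun i j => G (γ q) (riem Γ (γ q) (dd T γ q) (dd (e i) γ q) (dd T γ q)) (dd (e j) γ q)),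
    sw (fun i j => G (γ q) (cov Γ γ (e i) (dd T γ) q) (cov Γ γ (e j) (dd T γ) q))]

/-- The weighted area density relative to the one at `q`, along the line `q + t T`. -/
def density (G : E → E →L[ℝ] E →L[ℝ] ℝ) (f : E → ℝ) (γ : Q → E) (e : Fin n → Q) (T q : Q)
    (t : ℝ) : ℝ :=
  Real.exp (-f (γ (q + t • T))) * √((gram G γ e (q + t • T)).det / (gram G γ e q).det)

/-- The derivative is written as density times logarithmic derivative, for all small `t`, so that
the next differentiation is a product rule. -/
lemma hasDerivAt_density_eventually (h : IsLocalGeometry G Γ (γ q)) (hγ : ContDiffAt ℝ ∞ γ q)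
    {f : E → ℝ} (hf : ContDiffAt ℝ ∞ f (γ q)) (e : Fin n → Q) (T : Q)
    (hdet : 0 < (gram G γ e q).det) :
    ∀ᶠ t : ℝ in 𝓝 0, HasDerivAt (density G f γ e T q) (density G f γ e T q t *
      (((gram G γ e (q + t • T))⁻¹ * Matrix.of fun i j =>
        dd T (fun r => gram G γ e r i j) (q + t • T)).trace / 2
        - dd T (fun r => f (γ r)) (q + t • T))) t := by
  have sg : ∀ i j, ContDiffAt ℝ ∞ (fun r => gram G γ e r i j) q := fun i j =>
    contDiffAt_gram h.smooth_metric hγ e i j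
  have hpos : ∀ᶠ r in 𝓝 q, 0 < (gram G γ e r).det :=
    (contDiffAt_det sg).continuousAt.eventually (lt_mem_nhds hdet)
  have hdiff : ∀ᶠ r in 𝓝 q, ∀ i j, DifferentiableAt ℝ (fun r => gram G γ e r i j) r := by
    rw [Filter.eventually_all]; intro i
    rw [Filter.eventually_all]; intro j
    exact eventually_differentiableAt (sg i j)
  filter_upwards [(tendsto_line q T).eventually hpos, (tendsto_line q T).eventually hdiff,
    (tendsto_line q T).eventually (eventually_differentiableAt (hf.comp q hγ))] with t h1 h2 h3
  have a := hasDerivAt_sqrt_det (H := fun s => gram G γ e (q + s • T)) (c := (gram G γ e q).det)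
    (H' := Matrix.of fun i j => dd T (fun r => gram G γ e r i j) (q + t • T)) (t := t)
    (fun i j => hasDerivAt_line (u := fun r => gram G γ e r i j) (h2 i j)) h1 hdet
  have b := (hasDerivAt_line (u := fun r => f (γ r)) h3).neg.exp
  refine (b.mul a).congr_deriv ?_
  simp only [density, Pi.neg_apply]
  ring

lemma density_zero {f : E → ℝ} (e : Fin n → Q) (T : Q) (hdet : 0 < (gram G γ e q).det) :
    density G f γ e T q 0 = Real.exp (-f (γ q)) := by
  simp [density, div_self hdet.ne']

lemma dd_comp {f : E → ℝ} (hγ : DifferentiableAt ℝ γ q) (hf : DifferentiableAt ℝ f (γ q)) (T : Q) :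
    dd T (fun r => f (γ r)) q = fderiv ℝ f (γ q) (dd T γ q) := by
  have := hf.hasFDerivAt.comp q hγ.hasFDerivAt
  change fderiv ℝ (f ∘ γ) q T = _
  rw [this.fderiv]; rfl

/-- The term `df(Γ(T,T))` is subtracted in the Hessian and added in the acceleration, so the
identity holds for any `Γ`. -/
lemma dd_dd_comp (hγ : ContDiffAt ℝ ∞ γ q) {f : E → ℝ}
    (hf : ContDiffAt ℝ ∞ f (γ q)) (T : Q) :
    dd T (dd T (fun r => f (γ r))) q
      = hess Γ f (γ q) (dd T γ q) (dd T γ q) + fderiv ℝ f (γ q) (cov Γ γ T (dd T γ) q) := by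
  have ev : dd T (fun r => f (γ r)) =ᶠ[𝓝 q] fun r => fderiv ℝ f (γ r) (dd T γ r) := by
    filter_upwards [eventually_differentiableAt hγ,
      hγ.continuousAt.eventually (eventually_differentiableAt hf)] with r h1 h2
    exact dd_comp h1 h2 T
  rw [dd_congr ev]
  have d1 : DifferentiableAt ℝ (fderiv ℝ f) (γ q) :=
    (hf.fderiv_right (m := ∞) (by simp)).differentiableAt (by simp)
  have d2 : DifferentiableAt ℝ (dd T γ) q := (contDiffAt_dd hγ T).differentiableAt (by simp)
  have h0 : HasFDerivAt (fun r => fderiv ℝ f (γ r))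
      ((fderiv ℝ (fderiv ℝ f) (γ q)).comp (fderiv ℝ γ q)) q :=
    HasFDerivAt.comp (g := fderiv ℝ f) q d1.hasFDerivAt
      (hγ.differentiableAt (by simp)).hasFDerivAt
  have := congrArg (fun L => L T) (h0.clm_apply d2.hasFDerivAt).fderiv
  rw [dd, this]
  simp only [hess, cov, map_add]
  simp [dd]
  ring

lemma hasDerivAt_density (h : IsLocalGeometry G Γ (γ q)) (hγ : ContDiffAt ℝ ∞ γ q)
    {f : E → ℝ} (hf : ContDiffAt ℝ ∞ f (γ q)) (e : Fin n → Q) (T : Q)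
    (hdet : 0 < (gram G γ e q).det) :
    HasDerivAt (density G f γ e T q) ((tdiv G Γ γ e (dd T γ) q
      - fderiv ℝ f (γ q) (dd T γ q)) * Real.exp (-f (γ q))) 0 := by
  have := (hasDerivAt_density_eventually h hγ hf e T hdet).self_of_nhds
  refine this.congr_deriv ?_
  simp only [zero_smul, add_zero]
  rw [density_zero e T hdet, trace_dd_gram h hγ, dd_comp (hγ.differentiableAt (by simp))
    (hf.differentiableAt (by simp))]
  ring

/-- If `D' = D L`, then `D'' = D (L² + L')`: the square is the first summand, and `L'` comes from
`hasDerivAt_trace_inv_mul`, `trace_dd_dd_gram` and `dd_dd_comp`. -/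
lemma hasDerivAt_deriv_density (h : IsLocalGeometry G Γ (γ q)) (hγ : ContDiffAt ℝ ∞ γ q)
    {f : E → ℝ} (hf : ContDiffAt ℝ ∞ f (γ q)) (e : Fin n → Q) (T : Q)
    (hdet : 0 < (gram G γ e q).det) :
    HasDerivAt (deriv (density G f γ e T q))
      (((tdiv G Γ γ e (dd T γ) q - fderiv ℝ f (γ q) (dd T γ q)) ^ 2
        + (tdiv G Γ γ e (cov Γ γ T (dd T γ)) q
        + ∑ i, ∑ j, (gram G γ e q)⁻¹ i j *
            G (γ q) (riem Γ (γ q) (dd T γ q) (dd (e i) γ q) (dd T γ q)) (dd (e j) γ q)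
        + ∑ i, ∑ j, (gram G γ e q)⁻¹ i j *
            G (γ q) (cov Γ γ (e i) (dd T γ) q) (cov Γ γ (e j) (dd T γ) q))
        - ((gram G γ e q)⁻¹ * (Matrix.of fun i j => dd T (fun r => gram G γ e r i j) q) *
          ((gram G γ e q)⁻¹ * Matrix.of fun i j => dd T (fun r => gram G γ e r i j) q)).trace / 2
        - hess Γ f (γ q) (dd T γ q) (dd T γ q)
        - fderiv ℝ f (γ q) (cov Γ γ T (dd T γ) q)) * Real.exp (-f (γ q))) 0 := by
  have ev := hasDerivAt_density_eventually h hγ hf e T hdet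
  have ev' : deriv (density G f γ e T q) =ᶠ[𝓝 0] fun t => density G f γ e T q t *
      (((gram G γ e (q + t • T))⁻¹ * Matrix.of fun i j =>
        dd T (fun r => gram G γ e r i j) (q + t • T)).trace / 2
        - dd T (fun r => f (γ r)) (q + t • T)) := ev.mono fun t ht => ht.deriv
  refine HasDerivAt.congr_of_eventuallyEq ?_ ev'
  have sg : ∀ i j, ContDiffAt ℝ ∞ (fun r => gram G γ e r i j) q := fun i j =>
    contDiffAt_gram h.smooth_metric hγ e i j
  have q0 : q + (0 : ℝ) • T = q := by simp
  have a := hasDerivAt_trace_inv_mul (H := fun s : ℝ => gram G γ e (q + s • T))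
    (H' := Matrix.of fun i j => dd T (fun r => gram G γ e r i j) (q + (0 : ℝ) • T))
    (K := fun s => Matrix.of fun i j => dd T (fun r => gram G γ e r i j) (q + s • T))
    (K' := Matrix.of fun i j => dd T (dd T (fun r => gram G γ e r i j)) (q + (0 : ℝ) • T))
    (t := 0)
    (fun i j => hasDerivAt_line (u := fun r => gram G γ e r i j)
      (by rw [q0]; exact (sg i j).differentiableAt (by simp)))
    (fun i j => hasDerivAt_line (u := dd T fun r => gram G γ e r i j)
      (by rw [q0]; exact (contDiffAt_dd (sg i j) T).differentiableAt (by simp)))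
    (by rw [q0]; exact hdet.ne')
  have b := hasDerivAt_line (u := dd T (fun r => f (γ r))) (q := q) (T := T) (t := 0)
      (by rw [q0]; exact (contDiffAt_dd (hf.comp q hγ) T).differentiableAt (by simp))
  refine ((hasDerivAt_density h hγ hf e T hdet).mul ((a.div_const 2).sub b)).congr_deriv ?_
  simp only [Pi.sub_apply, zero_smul, add_zero]
  rw [density_zero e T hdet, trace_dd_gram h hγ, trace_dd_dd_gram h hγ,
    dd_dd_comp hγ hf T (Γ := Γ), dd_comp (hγ.differentiableAt (by simp))
    (hf.differentiableAt (by simp))]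
  ring

end Variation

/-! ### Normal variations in coordinates -/

section NormalVariation

variable {n : ℕ} {Q E : Type*} [NormedAddCommGroup Q] [NormedSpace ℝ Q] [NormedAddCommGroup E]
  [NormedSpace ℝ E] {G : E → E →L[ℝ] E →L[ℝ] ℝ} {Γ : E → E →L[ℝ] E →L[ℝ] E} {γ : Q → E} {q : Q}

lemma riem_swap (Γ : E → E →L[ℝ] E →L[ℝ] E) (z u v w : E) :
    riem Γ z u v w = -riem Γ z v u w := by
  simp only [riem]; abel

lemma trace_mul_mul_eq_sum (A B C D : Matrix (Fin n) (Fin n) ℝ) :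
    (A * B * (C * D)).trace = ∑ i, ∑ j, ∑ k, ∑ l, A i j * B j k * C k l * D l i := by
  simp only [Matrix.trace, Matrix.diag, Matrix.mul_apply, Finset.sum_mul, Finset.mul_sum]
  refine Finset.sum_congr rfl fun i _ => ?_
  refine (Finset.sum_congr rfl fun k _ => Finset.sum_comm).trans ?_
  rw [Finset.sum_comm]
  refine Finset.sum_congr rfl fun j _ => Finset.sum_congr rfl fun k _ =>
    Finset.sum_congr rfl fun l _ => by ring

variable {e : Fin n → Q} {T : Q} {ν : E} {B : Fin n → E} {lam : ℝ} {dlam : Fin n → ℝ}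

/-- Data of a normal variation at a point: `γ` moves with velocity `lam • ν`, where `ν` is the unit
normal, `dlam` is the differential of `lam` and `B` that of `ν`. -/
structure IsNormalVariationAt (G : E → E →L[ℝ] E →L[ℝ] ℝ) (Γ : E → E →L[ℝ] E →L[ℝ] E) (γ : Q → E)
    (e : Fin n → Q) (T q : Q) (ν : E) (B : Fin n → E) (lam : ℝ) (dlam : Fin n → ℝ) : Prop where
  frame : IsAdaptedFrame (G (γ q)) (fun i => dd (e i) γ q) ν
  velocity : dd T γ q = lam • ν
  cov_velocity : ∀ i, cov Γ γ (e i) (dd T γ) q = dlam i • ν + lam • B i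
  tangent : ∀ i, G (γ q) (B i) ν = 0
  symm_shape : ∀ i j, G (γ q) (B i) (dd (e j) γ q) = G (γ q) (B j) (dd (e i) γ q)

namespace IsNormalVariationAt

/-- The shape operator of the normal variation, as a bilinear form. -/
def shape (G : E → E →L[ℝ] E →L[ℝ] ℝ) (γ : Q → E) (e : Fin n → Q) (q : Q) (B : Fin n → E) :
    Matrix (Fin n) (Fin n) ℝ :=
  Matrix.of fun i j => G (γ q) (B i) (dd (e j) γ q)

lemma inner_velocity (hN : IsNormalVariationAt G Γ γ e T q ν B lam dlam) (i j : Fin n) :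
    G (γ q) (cov Γ γ (e i) (dd T γ) q) (dd (e j) γ q) = lam * shape G γ e q B i j := by
  have : G (γ q) ν (dd (e j) γ q) = 0 := by rw [hN.frame.symm]; exact hN.frame.normal j
  simp [hN.cov_velocity, this, shape]

lemma tdiv_velocity (hN : IsNormalVariationAt G Γ γ e T q ν B lam dlam) :
    tdiv G Γ γ e (dd T γ) q = lam * ∑ i, ∑ j, (gram G γ e q)⁻¹ i j * shape G γ e q B i j := by
  simp only [tdiv, hN.inner_velocity, Finset.mul_sum]
  exact Finset.sum_congr rfl fun i _ => Finset.sum_congr rfl fun j _ => by ring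

/-- The two halves of the derivative of the metric coincide because the shape operator is
self-adjoint. -/
lemma dd_gram (hN : IsNormalVariationAt G Γ γ e T q ν B lam dlam)
    (h : IsLocalGeometry G Γ (γ q)) (hγ : ContDiffAt ℝ ∞ γ q) :
    (Matrix.of fun i j => dd T (fun r => gram G γ e r i j) q) = (2 * lam) • shape G γ e q B := by
  ext i j
  have s : shape G γ e q B j i = shape G γ e q B i j := hN.symm_shape j i
  rw [Matrix.of_apply, (dd_gram_eventually h hγ e T i j).eq_of_nhds,
    h.symm.self_of_nhds (dd (e i) γ q), hN.inner_velocity, hN.inner_velocity, s,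
    Matrix.smul_apply, smul_eq_mul]
  ring

/-- Antisymmetry gives `R(λν, u)λν = -λ² R(u, ν)ν`. Since `R(ν, ν)ν = 0`, the normal term of
`trace_eq` drops out and the tangential sum is already the full Ricci trace. -/
lemma sum_riem (hN : IsNormalVariationAt G Γ γ e T q ν B lam dlam) [FiniteDimensional ℝ E]
    (hd : Module.finrank ℝ E = n + 1) :
    ∑ i, ∑ j, (gram G γ e q)⁻¹ i j *
      G (γ q) (riem Γ (γ q) (dd T γ q) (dd (e i) γ q) (dd T γ q)) (dd (e j) γ q)
      = -lam ^ 2 * ric Γ (γ q) ν ν := by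
  have h0 : riem Γ (γ q) ν ν ν = 0 := by
    simp only [riem]; abel
  have h1 : ∀ u, riem Γ (γ q) (lam • ν) u (lam • ν) = (-lam ^ 2) • riemMap Γ (γ q) ν ν u := by
    intro u
    rw [riem_swap]
    change -riem Γ (γ q) u (lam • ν) (lam • ν) = (-lam ^ 2) • riem Γ (γ q) u ν ν
    simp only [riem, map_smul, FunLike.coe_smul, Pi.smul_apply]
    module
  have h2 : riemMap Γ (γ q) ν ν ν = 0 := h0
  rw [ric, hN.frame.trace_eq hd, h2, map_zero, zero_apply, add_zero, hN.velocity]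
  simp only [h1, map_smul, FunLike.coe_smul, Pi.smul_apply, smul_eq_mul, Finset.mul_sum]
  exact Finset.sum_congr rfl fun i _ => Finset.sum_congr rfl fun j _ => by
    rw [gram]; ring

/-- The parts `dlam i • ν` and `lam • B i` of `∇_i T` are orthogonal, so there are no cross terms;
`inner_eq` then writes `⟨B_i, B_j⟩` as a quadratic expression in the shape matrix. -/
lemma sum_inner (hN : IsNormalVariationAt G Γ γ e T q ν B lam dlam) [FiniteDimensional ℝ E]
    (hd : Module.finrank ℝ E = n + 1) :
    ∑ i, ∑ j, (gram G γ e q)⁻¹ i j *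
      G (γ q) (cov Γ γ (e i) (dd T γ) q) (cov Γ γ (e j) (dd T γ) q)
      = ∑ i, ∑ j, (gram G γ e q)⁻¹ i j * dlam i * dlam j
        + lam ^ 2 * ((gram G γ e q)⁻¹ * shape G γ e q B
          * ((gram G γ e q)⁻¹ * shape G γ e q B)).trace := by
  have h1 : ∀ i j, G (γ q) (cov Γ γ (e i) (dd T γ) q) (cov Γ γ (e j) (dd T γ) q)
      = dlam i * dlam j + lam ^ 2 * G (γ q) (B i) (B j) := by
    intro i j
    have a : G (γ q) ν (B j) = 0 := by rw [hN.frame.symm]; exact hN.tangent j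
    simp only [hN.cov_velocity, map_add, map_smul, add_apply, FunLike.coe_smul, Pi.smul_apply,
      smul_eq_mul, hN.tangent, a, hN.frame.unit]
    ring
  have h2 : ∀ i j, G (γ q) (B i) (B j) = ∑ k, ∑ l, (gram G γ e q)⁻¹ k l *
      shape G γ e q B i l * shape G γ e q B j k := by
    intro i j
    rw [hN.frame.inner_eq hd, hN.tangent, zero_mul, add_zero]
    rfl
  have s : ∀ i j, shape G γ e q B j i = shape G γ e q B i j := fun i j => hN.symm_shape j i
  simp only [h1, h2, mul_add, Finset.sum_add_distrib, trace_mul_mul_eq_sum, Finset.mul_sum]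
  congr 1
  · exact Finset.sum_congr rfl fun i _ => Finset.sum_congr rfl fun j _ => by ring
  · exact Finset.sum_congr rfl fun i _ => Finset.sum_congr rfl fun j _ =>
      Finset.sum_congr rfl fun k _ => Finset.sum_congr rfl fun l _ => by rw [s i l]; ring

/-- The second variation of the weighted area density for a normal variation. -/
lemma hasDerivAt_deriv_density (hN : IsNormalVariationAt G Γ γ e T q ν B lam dlam)
    [FiniteDimensional ℝ E] (hd : Module.finrank ℝ E = n + 1)
    (h : IsLocalGeometry G Γ (γ q)) (hγ : ContDiffAt ℝ ∞ γ q)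
    {f : E → ℝ} (hf : ContDiffAt ℝ ∞ f (γ q)) (hdet : 0 < (gram G γ e q).det) :
    HasDerivAt (deriv (density G f γ e T q))
      (((lam * (∑ i, ∑ j, (gram G γ e q)⁻¹ i j * shape G γ e q B i j - fderiv ℝ f (γ q) ν)) ^ 2
        + (tdiv G Γ γ e (cov Γ γ T (dd T γ)) q - fderiv ℝ f (γ q) (cov Γ γ T (dd T γ) q))
        + (∑ i, ∑ j, (gram G γ e q)⁻¹ i j * dlam i * dlam j
          - lam ^ 2 * (ric Γ (γ q) ν ν + hess Γ f (γ q) ν ν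
          + ((gram G γ e q)⁻¹ * shape G γ e q B
            * ((gram G γ e q)⁻¹ * shape G γ e q B)).trace))) * Real.exp (-f (γ q))) 0 := by
  refine (WeightedHypersurface.hasDerivAt_deriv_density h hγ hf e T hdet).congr_deriv ?_
  rw [hN.sum_riem hd, hN.sum_inner hd, hN.dd_gram h hγ, hN.tdiv_velocity, hN.velocity]
  have hh : hess Γ f (γ q) (lam • ν) (lam • ν) = lam ^ 2 * hess Γ f (γ q) ν ν := by
    simp only [hess, map_smul, FunLike.coe_smul, Pi.smul_apply, smul_eq_mul]; ring
  rw [hh]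
  -- Coefficient of `tr((h⁻¹A)²)`: `λ²` from `sum_inner`, and `-(2λ)²/2 = -2λ²` from the square of
  -- the metric derivative, together `-λ²`.
  simp only [Matrix.mul_smul, Matrix.smul_mul, Matrix.trace_smul, smul_eq_mul, map_smul]
  ring

end IsNormalVariationAt

end NormalVariation

/-! ### Metrics in charts -/

section Charts

variable {d : ℕ} {X : Type*} [TopologicalSpace X] [ChartedSpace (EuclideanSpace ℝ (Fin d)) X]

/-- Derivative of the preferred chart at `p`, at the point `x`. -/
def chartD (p x : X) : EuclideanSpace ℝ (Fin d) →L[ℝ] EuclideanSpace ℝ (Fin d) :=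
  mfderiv (𝓡 d) (𝓡 d) (extChartAt (𝓡 d) p) x

/-- Derivative of the inverse of the preferred chart at `p`. -/
def chartDSymm (p : X) (y : EuclideanSpace ℝ (Fin d)) :
    EuclideanSpace ℝ (Fin d) →L[ℝ] EuclideanSpace ℝ (Fin d) :=
  mfderiv (𝓡 d) (𝓡 d) (extChartAt (𝓡 d) p).symm y

lemma isOpen_target (p : X) : IsOpen (extChartAt (𝓡 d) p).target := isOpen_extChartAt_target p

lemma isOpen_source (p : X) : IsOpen (extChartAt (𝓡 d) p).source := isOpen_extChartAt_source p

/-- All tangent spaces are definitionally the model space, so the base point can be replaced without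
transporting the vectors. -/
lemma form_congr (h : ∀ q : X, TangentSpace (𝓡 d) q → TangentSpace (𝓡 d) q → ℝ) {x x' : X}
    (e : x = x') (v w : EuclideanSpace ℝ (Fin d)) :
    h x v w = h x' v w := by subst e; rfl

variable [IsManifold (𝓡 d) ∞ X]

lemma contMDiffAt_chart {p x : X} (hx : x ∈ (extChartAt (𝓡 d) p).source) :
    ContMDiffAt (𝓡 d) (𝓡 d) ∞ (extChartAt (𝓡 d) p) x :=
  contMDiffAt_extChartAt' (by rwa [extChartAt_source] at hx)

lemma contMDiffAt_chart_symm {p : X} {y : EuclideanSpace ℝ (Fin d)}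
    (hy : y ∈ (extChartAt (𝓡 d) p).target) :
    ContMDiffAt (𝓡 d) (𝓡 d) ∞ (extChartAt (𝓡 d) p).symm y :=
  (contMDiffOn_extChartAt_symm p).contMDiffAt ((isOpen_target p).mem_nhds hy)

lemma chartD_chartDSymm {p : X} {y : EuclideanSpace ℝ (Fin d)}
    (hy : y ∈ (extChartAt (𝓡 d) p).target) (u : EuclideanSpace ℝ (Fin d)) :
    chartD p ((extChartAt (𝓡 d) p).symm y) (chartDSymm p y u) = u := by
  have : IsManifold (𝓡 d) 1 X := IsManifold.of_le (n := ∞) (by simp)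
  have h := mfderiv_extChartAt_comp_mfderivWithin_extChartAt_symm (I := 𝓡 d) hy
  rw [ModelWithCorners.range_eq_univ, mfderivWithin_univ] at h
  exact congrArg (fun L => L u) h

lemma chartDSymm_chartD {p x : X} (hx : x ∈ (extChartAt (𝓡 d) p).source)
    (v : EuclideanSpace ℝ (Fin d)) :
    chartDSymm p (extChartAt (𝓡 d) p x) (chartD p x v) = v := by
  have : IsManifold (𝓡 d) 1 X := IsManifold.of_le (n := ∞) (by simp)
  have h := mfderivWithin_extChartAt_symm_comp_mfderiv_extChartAt' (I := 𝓡 d) hx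
  rw [ModelWithCorners.range_eq_univ, mfderivWithin_univ] at h
  exact congrArg (fun L => L v) h

/-- The metric in the preferred chart at `p`. -/
def chartMetric (g : Metric d X) (p : X) (z : EuclideanSpace ℝ (Fin d)) :
    EuclideanSpace ℝ (Fin d) →L[ℝ] EuclideanSpace ℝ (Fin d) →L[ℝ] ℝ :=
  ContinuousLinearMap.bilinearComp
    -- The identity only changes the type: the inner product on the fibre is read as a bilinear map
    -- on the model space.
    (@id (EuclideanSpace ℝ (Fin d) →L[ℝ] EuclideanSpace ℝ (Fin d) →L[ℝ] ℝ)
      (g.inner ((extChartAt (𝓡 d) p).symm z))) (chartDSymm p z) (chartDSymm p z)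

lemma chartMetric_apply (g : Metric d X) (p : X) (z u v : EuclideanSpace ℝ (Fin d)) :
    chartMetric g p z u v
      = g.form ((extChartAt (𝓡 d) p).symm z) (chartDSymm p z u) (chartDSymm p z v) := rfl

lemma form_eq_chartMetric (g : Metric d X) {p x : X} (hx : x ∈ (extChartAt (𝓡 d) p).source)
    (v w : EuclideanSpace ℝ (Fin d)) :
    g.form x v w = chartMetric g p (extChartAt (𝓡 d) p x) (chartD p x v) (chartD p x w) := by
  rw [chartMetric_apply]
  have h1 := chartDSymm_chartD hx v
  have h2 := chartDSymm_chartD hx w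
  have h3 := form_congr g.form ((extChartAt (𝓡 d) p).left_inv hx) v w
  rw [← h3]
  exact congrArg₂ (g.form _) h1.symm h2.symm

lemma metricMatrix_eq_chartMetric (g : Metric d X) (p : X) (z : EuclideanSpace ℝ (Fin d))
    (i j : Fin d) : metricMatrix g.form p z i j
      = chartMetric g p z (EuclideanSpace.single i 1) (EuclideanSpace.single j 1) := rfl

lemma chartMetric_symm (g : Metric d X) (p : X) (z u v : EuclideanSpace ℝ (Fin d)) :
    chartMetric g p z u v = chartMetric g p z v u := g.symm _ _ _

lemma chartMetric_pos (g : Metric d X) {p : X} {z : EuclideanSpace ℝ (Fin d)}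
    (hz : z ∈ (extChartAt (𝓡 d) p).target) {u : EuclideanSpace ℝ (Fin d)} (hu : u ≠ 0) :
    0 < chartMetric g p z u u := by
  refine g.pos _ _ fun h => hu ?_
  have := chartD_chartDSymm hz u
  exact this.symm.trans ((congrArg (chartD p _) h).trans (map_zero _))

/-- Smoothness of a vector field along a map, in a chart. -/
lemma contMDiffAt_tangent_iff {EA HA A : Type*} [NormedAddCommGroup EA] [NormedSpace ℝ EA]
    [TopologicalSpace HA] {IA : ModelWithCorners ℝ EA HA} [TopologicalSpace A] [ChartedSpace HA A]
    {b : A → X} {V : A → EuclideanSpace ℝ (Fin d)} {a₀ : A} (hb : ContMDiffAt IA (𝓡 d) ∞ b a₀)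
    {p : X} (hp : b a₀ ∈ (extChartAt (𝓡 d) p).source) :
    ContMDiffAt IA (𝓡 d).tangent ∞ (fun a => (⟨b a, V a⟩ : TangentBundle (𝓡 d) X)) a₀ ↔
      ContMDiffAt IA 𝓘(ℝ, EuclideanSpace ℝ (Fin d)) ∞ (fun a => chartD p (b a) (V a)) a₀ := by
  have : IsManifold (𝓡 d) 1 X := IsManifold.of_le (n := ∞) (by simp)
  rw [extChartAt_source] at hp
  set e := trivializationAt (EuclideanSpace ℝ (Fin d)) (TangentSpace (𝓡 d) : X → Type _) p with he
  have hs : (⟨b a₀, V a₀⟩ : TangentBundle (𝓡 d) X) ∈ e.source := by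
    rw [e.mem_source, TangentBundle.trivializationAt_baseSet]
    exact hp
  have : MemTrivializationAtlas e := inferInstance
  refine Iff.trans (Bundle.Trivialization.contMDiffAt_iff (e := e) hs) ?_
  have ev : (fun a => (e (⟨b a, V a⟩ : TangentBundle (𝓡 d) X)).2) =ᶠ[𝓝 a₀]
      fun a => chartD p (b a) (V a) := by
    have : ∀ᶠ a in 𝓝 a₀, b a ∈ (chartAt (EuclideanSpace ℝ (Fin d)) p).source :=
      hb.continuousAt.eventually ((chartAt _ p).open_source.mem_nhds hp)
    filter_upwards [this] with a ha
    let v : TangentSpace (𝓡 d) (b a) := V a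
    -- On fibres over the chart domain, the tangent bundle trivialization centred at `p` is the
    -- derivative of the chart at `p`.
    have h1 : (e (⟨b a, v⟩ : TangentBundle (𝓡 d) X)).2 = e.continuousLinearMapAt ℝ (b a) v := by
      rw [Bundle.Trivialization.continuousLinearMapAt_apply,
        Bundle.Trivialization.coe_linearMapAt_of_mem e
          (by rw [TangentBundle.trivializationAt_baseSet]; exact ha)]
    exact h1.trans (congrArg (fun L => L v)
      (TangentBundle.continuousLinearMapAt_trivializationAt ha))
  constructor
  · intro h
    exact h.2.congr_of_eventuallyEq ev.symm
  · intro h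
    exact ⟨hb, h.congr_of_eventuallyEq ev⟩

/-- Since `E` is finite-dimensional, `E →L[ℝ] F` is a finite power of `F` via the values on a basis,
and smoothness is tested coordinatewise. -/
lemma contDiffAt_clm_apply {D E F : Type*} [NormedAddCommGroup D] [NormedSpace ℝ D]
    [NormedAddCommGroup E] [NormedSpace ℝ E] [NormedAddCommGroup F] [NormedSpace ℝ F]
    [FiniteDimensional ℝ E] {k : WithTop ℕ∞} {f : D → E →L[ℝ] F} {x : D}
    (h : ∀ u, ContDiffAt ℝ k (fun y => f y u) x) : ContDiffAt ℝ k f x := by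
  let e₁ := ContinuousLinearEquiv.ofFinrankEq (𝕜 := ℝ) (E := E)
    (F := Fin (Module.finrank ℝ E) → ℝ) (by simp)
  let e₂ := (e₁.arrowCongr (1 : F ≃L[ℝ] F)).trans
    (ContinuousLinearEquiv.piRing (Fin (Module.finrank ℝ E)))
  rw [← Function.id_comp f, ← e₂.symm_comp_self]
  exact e₂.symm.contDiff.contDiffAt.comp x (contDiffAt_pi.2 fun i => h _)

/-- The coordinate fields of the chart are smooth sections, being constant when read in that chart.
Pairing the smooth metric section with two of them gives smooth coefficients. -/
lemma contDiffAt_chartMetric (g : Metric d X) {p : X} {z : EuclideanSpace ℝ (Fin d)}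
    (hz : z ∈ (extChartAt (𝓡 d) p).target) : ContDiffAt ℝ ∞ (chartMetric g p) z := by
  have : IsManifold (𝓡 d) 1 X := IsManifold.of_le (n := ∞) (by simp)
  have hb : ContMDiffAt (𝓡 d) (𝓡 d) ∞ (extChartAt (𝓡 d) p).symm z := contMDiffAt_chart_symm hz
  have hs : ∀ u, ContMDiffAt (𝓡 d) (𝓡 d).tangent ∞ (fun y =>
      (⟨(extChartAt (𝓡 d) p).symm y, chartDSymm p y u⟩ : TangentBundle (𝓡 d) X)) z := by
    intro u
    refine (contMDiffAt_tangent_iff hb ((extChartAt (𝓡 d) p).map_target hz)).2 ?_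
    refine contMDiffAt_const (c := u) |>.congr_of_eventuallyEq ?_
    filter_upwards [(isOpen_target p).mem_nhds hz] with y hy
    exact chartD_chartDSymm hy u
  have key : ∀ u v, ContDiffAt ℝ ∞ (fun y => chartMetric g p y u v) z := by
    intro u v
    have : ContMDiffAt (𝓡 d) ((𝓡 d).prod 𝓘(ℝ)) ∞ (fun y ↦ Bundle.TotalSpace.mk' ℝ
        (E := Bundle.Trivial X ℝ) ((extChartAt (𝓡 d) p).symm y)
        (g.inner ((extChartAt (𝓡 d) p).symm y) (chartDSymm p y u) (chartDSymm p y v))) z := by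
      apply ContMDiffAt.clm_bundle_apply₂ (F₁ := EuclideanSpace ℝ (Fin d))
        (F₂ := EuclideanSpace ℝ (Fin d))
      · exact ContMDiffAt.comp z g.contMDiff.contMDiffAt hb
      · exact hs u
      · exact hs v
    simp only [Bundle.contMDiffAt_totalSpace] at this
    exact this.2.contDiffAt
  exact contDiffAt_clm_apply fun u => contDiffAt_clm_apply fun v => key u v

end Charts

/-! ### The Levi-Civita connection in coordinates -/

section Connection

variable {d : ℕ}

lemma linear_eq_zero {C : EuclideanSpace ℝ (Fin d) → ℝ} (h : IsLinearMap ℝ C)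
    (h0 : ∀ i, C (EuclideanSpace.single i 1) = 0) (u : EuclideanSpace ℝ (Fin d)) : C u = 0 := by
  have : h.mk' C = 0 := (EuclideanSpace.basisFun (Fin d) ℝ).toBasis.ext fun i => by
    simpa using h0 i
  exact congrArg (fun L => L u) this

lemma sum_single_smul (u : EuclideanSpace ℝ (Fin d)) :
    ∑ i, u i • EuclideanSpace.single i (1 : ℝ) = u := by
  have := (EuclideanSpace.basisFun (Fin d) ℝ).sum_repr u
  simpa using this

/-- The connection with Christoffel symbols those of the metric with matrix `A`. -/
def christoffelMap (A : EuclideanSpace ℝ (Fin d) → Matrix (Fin d) (Fin d) ℝ)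
    (z : EuclideanSpace ℝ (Fin d)) :
    EuclideanSpace ℝ (Fin d) →L[ℝ] EuclideanSpace ℝ (Fin d) →L[ℝ] EuclideanSpace ℝ (Fin d) :=
  ∑ k, ∑ i, ∑ j, christoffel A k i j z •
    (EuclideanSpace.proj i : EuclideanSpace ℝ (Fin d) →L[ℝ] ℝ).smulRight
      ((EuclideanSpace.proj j : EuclideanSpace ℝ (Fin d) →L[ℝ] ℝ).smulRight
        (EuclideanSpace.single k (1 : ℝ)))

lemma christoffelMap_apply (A : EuclideanSpace ℝ (Fin d) → Matrix (Fin d) (Fin d) ℝ)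
    (z u v : EuclideanSpace ℝ (Fin d)) (k : Fin d) :
    christoffelMap A z u v k = ∑ i, ∑ j, christoffel A k i j z * u i * v j := by
  simp only [christoffelMap, sum_apply, smul_apply, ContinuousLinearMap.smulRight_apply,
    PiLp.proj_apply, WithLp.ofLp_sum, WithLp.ofLp_smul, Finset.sum_apply, Pi.smul_apply,
    PiLp.single_apply, smul_eq_mul]
  rw [Finset.sum_eq_single k (fun b _ hb => by simp [hb.symm]) (by simp)]
  exact Finset.sum_congr rfl fun i _ => Finset.sum_congr rfl fun j _ => by simp [mul_assoc]

/-- The matrix of a field of bilinear forms. -/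
def toMatrix (G : EuclideanSpace ℝ (Fin d) →
      EuclideanSpace ℝ (Fin d) →L[ℝ] EuclideanSpace ℝ (Fin d) →L[ℝ] ℝ)
    (z : EuclideanSpace ℝ (Fin d)) : Matrix (Fin d) (Fin d) ℝ :=
  Matrix.of fun i j => G z (EuclideanSpace.single i 1) (EuclideanSpace.single j 1)

variable {G : EuclideanSpace ℝ (Fin d) →
      EuclideanSpace ℝ (Fin d) →L[ℝ] EuclideanSpace ℝ (Fin d) →L[ℝ] ℝ}
    {z : EuclideanSpace ℝ (Fin d)}

lemma fderiv_bilinear_apply (hG : DifferentiableAt ℝ G z) (u v w : EuclideanSpace ℝ (Fin d)) :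
    fderiv ℝ (fun y => G y v w) z u = fderiv ℝ G z u v w := by
  have := dd_trilinear (B := G) (γ := id) (X := fun _ => v) (Y := fun _ => w) (q := z) hG
    differentiableAt_id (differentiableAt_const _) (differentiableAt_const _) u
  simpa [dd] using this

lemma pd_toMatrix (hG : DifferentiableAt ℝ G z) (i j l : Fin d) :
    pd i (fun y => toMatrix G y j l) z = fderiv ℝ G z (EuclideanSpace.single i 1)
      (EuclideanSpace.single j 1) (EuclideanSpace.single l 1) :=
  fderiv_bilinear_apply hG _ _ _

lemma toMatrix_inv_symm (hs : ∀ y u v, G y u v = G y v u) (i j : Fin d) :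
    (toMatrix G z)⁻¹ i j = (toMatrix G z)⁻¹ j i := by
  have h1 : (toMatrix G z).transpose = toMatrix G z := by
    ext i j; exact hs z _ _
  have h2 : ((toMatrix G z)⁻¹).transpose = (toMatrix G z)⁻¹ := by
    rw [Matrix.transpose_nonsing_inv, h1]
  exact congrFun (congrFun h2 j) i

/-- Lowering the upper index of the Christoffel symbol multiplies its inverse matrix by the matrix
of `G`; the two cancel. -/
lemma koszul_single (hG : DifferentiableAt ℝ G z) (hs : ∀ y u v, G y u v = G y v u)
    (hdet : (toMatrix G z).det ≠ 0) (i j l : Fin d) :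
    2 * G z (christoffelMap (toMatrix G) z (EuclideanSpace.single i 1) (EuclideanSpace.single j 1))
        (EuclideanSpace.single l 1)
      = fderiv ℝ G z (EuclideanSpace.single i 1) (EuclideanSpace.single j 1)
          (EuclideanSpace.single l 1)
        + fderiv ℝ G z (EuclideanSpace.single j 1) (EuclideanSpace.single i 1)
          (EuclideanSpace.single l 1)
        - fderiv ℝ G z (EuclideanSpace.single l 1) (EuclideanSpace.single i 1)
          (EuclideanSpace.single j 1) := by
  have e1 : ∀ k, christoffelMap (toMatrix G) z (EuclideanSpace.single i 1)
      (EuclideanSpace.single j 1) k = christoffel (toMatrix G) k i j z := by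
    intro k
    rw [christoffelMap_apply, Finset.sum_eq_single i (fun b _ hb => by simp [hb]) (by simp),
      Finset.sum_eq_single j (fun b _ hb => by simp [hb]) (by simp)]
    simp
  have e2 : G z (christoffelMap (toMatrix G) z (EuclideanSpace.single i 1)
      (EuclideanSpace.single j 1)) (EuclideanSpace.single l 1)
      = ∑ k, christoffel (toMatrix G) k i j z * toMatrix G z k l := by
    rw [← sum_single_smul (christoffelMap (toMatrix G) z (EuclideanSpace.single i 1)
      (EuclideanSpace.single j 1))]
    simp only [map_sum, map_smul, sum_apply, smul_apply, e1, smul_eq_mul]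
    rfl
  set c : Fin d → ℝ := fun m => pd i (fun z => toMatrix G z j m) z
    + pd j (fun z => toMatrix G z i m) z - pd m (fun z => toMatrix G z i j) z with hc
  have e3 : ∑ k, christoffel (toMatrix G) k i j z * toMatrix G z k l = 1 / 2 * c l := by
    have key : ∀ m, ∑ k, (toMatrix G z)⁻¹ k m * toMatrix G z k l = if m = l then 1 else 0 := by
      intro m
      have := congrFun (congrFun (Matrix.nonsing_inv_mul (toMatrix G z)
        (isUnit_iff_ne_zero.2 hdet)) m) l
      rw [Matrix.mul_apply, Matrix.one_apply] at this
      rw [← this]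
      exact Finset.sum_congr rfl fun k _ => by rw [toMatrix_inv_symm hs]
    calc ∑ k, christoffel (toMatrix G) k i j z * toMatrix G z k l
        = ∑ k, ∑ m, 1 / 2 * c m * ((toMatrix G z)⁻¹ k m * toMatrix G z k l) := by
          refine Finset.sum_congr rfl fun k _ => ?_
          rw [christoffel, Finset.mul_sum, Finset.sum_mul]
          exact Finset.sum_congr rfl fun m _ => by rw [hc]; ring
      _ = ∑ m, 1 / 2 * c m * ∑ k, (toMatrix G z)⁻¹ k m * toMatrix G z k l := by
          rw [Finset.sum_comm]
          exact Finset.sum_congr rfl fun m _ => by rw [Finset.mul_sum]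
      _ = 1 / 2 * c l := by simp [key]
  rw [e2, e3, hc]
  simp only [pd_toMatrix hG]
  ring

/-- Both sides are linear in each argument, so the case of basis vectors suffices. -/
lemma koszul (hG : DifferentiableAt ℝ G z) (hs : ∀ y u v, G y u v = G y v u)
    (hdet : (toMatrix G z).det ≠ 0) (u v w : EuclideanSpace ℝ (Fin d)) :
    2 * G z (christoffelMap (toMatrix G) z u v) w
      = fderiv ℝ G z u v w + fderiv ℝ G z v u w - fderiv ℝ G z w u v := by
  rw [← sub_eq_zero]
  refine linear_eq_zero (C := fun u => 2 * G z (christoffelMap (toMatrix G) z u v) w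
    - (fderiv ℝ G z u v w + fderiv ℝ G z v u w - fderiv ℝ G z w u v)) ⟨?_, ?_⟩ (fun i => ?_) u
  · intro a b; simp only [map_add, add_apply]; ring
  · intro a b; simp only [map_smul, smul_apply, smul_eq_mul]; ring
  refine linear_eq_zero (C := fun v => 2 * G z (christoffelMap (toMatrix G) z
    (EuclideanSpace.single i 1) v) w
    - (fderiv ℝ G z (EuclideanSpace.single i 1) v w + fderiv ℝ G z v (EuclideanSpace.single i 1) w
    - fderiv ℝ G z w (EuclideanSpace.single i 1) v)) ⟨?_, ?_⟩ (fun j => ?_) v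
  · intro a b; simp only [map_add, add_apply]; ring
  · intro a b; simp only [map_smul, smul_apply, smul_eq_mul]; ring
  refine linear_eq_zero (C := fun w => 2 * G z (christoffelMap (toMatrix G) z
    (EuclideanSpace.single i 1) (EuclideanSpace.single j 1)) w
    - (fderiv ℝ G z (EuclideanSpace.single i 1) (EuclideanSpace.single j 1) w
    + fderiv ℝ G z (EuclideanSpace.single j 1) (EuclideanSpace.single i 1) w
    - fderiv ℝ G z w (EuclideanSpace.single i 1) (EuclideanSpace.single j 1)))
    ⟨?_, ?_⟩ (fun l => ?_) w
  · intro a b; simp only [map_add, add_apply]; ring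
  · intro a b; simp only [map_smul, smul_apply, smul_eq_mul]; ring
  rw [sub_eq_zero]
  exact koszul_single hG hs hdet i j l

lemma fderiv_bilinear_symm (hG : DifferentiableAt ℝ G z) (hs : ∀ y u v, G y u v = G y v u)
    (u v w : EuclideanSpace ℝ (Fin d)) : fderiv ℝ G z u v w = fderiv ℝ G z u w v := by
  rw [← fderiv_bilinear_apply hG, ← fderiv_bilinear_apply hG]
  simp_rw [hs _ v w]

lemma eq_zero_of_forall_inner (hs : ∀ y u v, G y u v = G y v u)
    (hdet : (toMatrix G z).det ≠ 0) {u : EuclideanSpace ℝ (Fin d)} (h : ∀ w, G z u w = 0) :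
    u = 0 := by
  have hv : Matrix.mulVec (toMatrix G z) (fun i => u i) = 0 := by
    ext j
    have := h (EuclideanSpace.single j 1)
    rw [hs, ← sum_single_smul u] at this
    simpa [Matrix.mulVec, dotProduct, toMatrix, mul_comm] using this
  have := Matrix.eq_zero_of_mulVec_eq_zero hdet hv
  ext i
  exact congrFun this i

/-- Both properties are read off the Koszul formula: its right side is symmetric in `u, v` and `G`
is nondegenerate; adding the formulas for `(u, v, w)` and `(u, w, v)` leaves only the derivative of
`G` along `u`. -/
lemma isLeviCivitaAt_christoffelMap (hG : DifferentiableAt ℝ G z)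
    (hs : ∀ y u v, G y u v = G y v u) (hdet : (toMatrix G z).det ≠ 0) :
    IsLeviCivitaAt G (christoffelMap (toMatrix G)) z where
  symm u v := by
    rw [← sub_eq_zero]
    refine eq_zero_of_forall_inner hs hdet fun w => ?_
    have h1 := koszul hG hs hdet u v w
    have h2 := koszul hG hs hdet v u w
    rw [fderiv_bilinear_symm hG hs w v u] at h2
    rw [map_sub, sub_apply]
    linarith
  compat u v w := by
    have h1 := koszul hG hs hdet u v w
    have h2 := koszul hG hs hdet u w v
    rw [hs z v]
    rw [fderiv_bilinear_symm hG hs u w v] at h2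
    linarith

lemma contDiffAt_toMatrix (hG : ContDiffAt ℝ ∞ G z) (i j : Fin d) :
    ContDiffAt ℝ ∞ (fun y => toMatrix G y i j) z :=
  (hG.clm_apply contDiffAt_const).clm_apply contDiffAt_const

lemma contDiffAt_inv_matrix {n : ℕ} {Q : Type*} [NormedAddCommGroup Q] [NormedSpace ℝ Q] {q : Q}
    {A : Q → Matrix (Fin n) (Fin n) ℝ}
    (hA : ∀ i j, ContDiffAt ℝ ∞ (fun r => A r i j) q) (h0 : (A q).det ≠ 0) (i j : Fin n) :
    ContDiffAt ℝ ∞ (fun r => (A r)⁻¹ i j) q := by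
  have e : ∀ r, (A r)⁻¹ i j = ((A r).det)⁻¹ * ((A r).updateRow j (Pi.single i 1)).det := by
    intro s
    rw [Matrix.inv_def, Matrix.smul_apply, Matrix.adjugate_apply, Ring.inverse_eq_inv', smul_eq_mul]
  simp_rw [e]
  refine ((contDiffAt_det hA).inv h0).mul (contDiffAt_det fun a b => ?_)
  by_cases ha : a = j
  · subst ha; simpa using contDiffAt_const
  · simpa [Matrix.updateRow_ne ha] using hA a b

lemma contDiffAt_pd {u : EuclideanSpace ℝ (Fin d) → ℝ} (hu : ContDiffAt ℝ ∞ u z) (i : Fin d) :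
    ContDiffAt ℝ ∞ (pd i u) z := contDiffAt_dd hu _

lemma contDiffAt_christoffel (hG : ContDiffAt ℝ ∞ G z) (hdet : (toMatrix G z).det ≠ 0)
    (k i j : Fin d) : ContDiffAt ℝ ∞ (christoffel (toMatrix G) k i j) z := by
  have hA := contDiffAt_toMatrix hG
  unfold christoffel
  refine contDiffAt_const.mul (ContDiffAt.sum fun l _ => ?_)
  exact (contDiffAt_inv_matrix hA hdet k l).mul
    (((contDiffAt_pd (hA j l) i).add (contDiffAt_pd (hA i l) j)).sub (contDiffAt_pd (hA i j) l))

lemma contDiffAt_christoffelMap (hG : ContDiffAt ℝ ∞ G z) (hdet : (toMatrix G z).det ≠ 0) :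
    ContDiffAt ℝ ∞ (christoffelMap (toMatrix G)) z := by
  refine contDiffAt_clm_apply fun u => contDiffAt_clm_apply fun v => ?_
  rw [contDiffAt_euclidean]
  intro k
  simp_rw [christoffelMap_apply]
  exact ContDiffAt.sum fun i _ => ContDiffAt.sum fun j _ =>
    ((contDiffAt_christoffel hG hdet k i j).mul contDiffAt_const).mul contDiffAt_const

lemma fderiv_christoffelMap_apply {A : EuclideanSpace ℝ (Fin d) → Matrix (Fin d) (Fin d) ℝ}
    (hA : ∀ k i j, DifferentiableAt ℝ (christoffel A k i j) z)
    (hd : DifferentiableAt ℝ (christoffelMap A) z)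
    (m : Fin d) (v w : EuclideanSpace ℝ (Fin d)) (k : Fin d) :
    fderiv ℝ (christoffelMap A) z (EuclideanSpace.single m 1) v w k
      = ∑ i, ∑ j, pd m (christoffel A k i j) z * v i * w j := by
  have h0 : fderiv ℝ (fun y => christoffelMap A y v w) z (EuclideanSpace.single m 1)
      = fderiv ℝ (christoffelMap A) z (EuclideanSpace.single m 1) v w := by
    have := dd_trilinear (B := christoffelMap A) (γ := id) (X := fun _ => v) (Y := fun _ => w)
      (q := z) hd differentiableAt_id (differentiableAt_const _) (differentiableAt_const _)
      (EuclideanSpace.single m 1)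
    simpa [dd] using this
  have h1 : fderiv ℝ (fun y => christoffelMap A y v w k) z (EuclideanSpace.single m 1)
      = fderiv ℝ (fun y => christoffelMap A y v w) z (EuclideanSpace.single m 1) k := by
    have b := (EuclideanSpace.proj k : EuclideanSpace ℝ (Fin d) →L[ℝ] ℝ).hasFDerivAt.comp z
      ((hd.clm_apply (differentiableAt_const v)).clm_apply
        (differentiableAt_const w)).hasFDerivAt
    exact congrArg (fun L => L (EuclideanSpace.single m 1)) b.fderiv
  have h2 : HasFDerivAt (fun y => christoffelMap A y v w k)
      (∑ i, ∑ j, (w j) • (v i) • fderiv ℝ (christoffel A k i j) z) z := by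
    simp_rw [christoffelMap_apply]
    exact HasFDerivAt.fun_sum fun i _ => HasFDerivAt.fun_sum fun j _ =>
      ((hA k i j).hasFDerivAt.mul_const _).mul_const _
  rw [← h0, ← h1, h2.fderiv]
  simp only [sum_apply, smul_apply, smul_eq_mul]
  exact Finset.sum_congr rfl fun i _ => Finset.sum_congr rfl fun j _ => by rw [pd]; ring

lemma trace_eq_sum_single (T : EuclideanSpace ℝ (Fin d) →ₗ[ℝ] EuclideanSpace ℝ (Fin d)) :
    LinearMap.trace ℝ _ T = ∑ k, T (EuclideanSpace.single k 1) k := by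
  rw [LinearMap.trace_eq_matrix_trace ℝ (EuclideanSpace.basisFun (Fin d) ℝ).toBasis]
  simp [Matrix.trace, LinearMap.toMatrix_apply]

lemma christoffel_symm {A : EuclideanSpace ℝ (Fin d) → Matrix (Fin d) (Fin d) ℝ}
    (hA : ∀ y i j, A y i j = A y j i) (k i j : Fin d) :
    christoffel A k i j = christoffel A k j i := by
  funext y
  simp only [christoffel]
  congr 1
  refine Finset.sum_congr rfl fun l _ => ?_
  rw [add_comm (pd i _ _)]
  simp_rw [hA _ i j]

lemma christoffelMap_single_left (A : EuclideanSpace ℝ (Fin d) → Matrix (Fin d) (Fin d) ℝ)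
    (v : EuclideanSpace ℝ (Fin d)) (k m : Fin d) :
    christoffelMap A z (EuclideanSpace.single m 1) v k = ∑ j, christoffel A k m j z * v j := by
  rw [christoffelMap_apply, Finset.sum_eq_single m (fun b _ hb => by simp [hb]) (by simp)]
  simp

/-- The Ricci curvature of the Levi-Civita connection in coordinates. -/
lemma ric_christoffelMap {A : EuclideanSpace ℝ (Fin d) → Matrix (Fin d) (Fin d) ℝ}
    (hA : ∀ k i j, DifferentiableAt ℝ (christoffel A k i j) z)
    (hd : DifferentiableAt ℝ (christoffelMap A) z)
    (hsymm : ∀ y i j, A y i j = A y j i) (v w : EuclideanSpace ℝ (Fin d)) :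
    ric (christoffelMap A) z v w = ∑ i, ∑ j, w i * v j * ricciCoord A i j z := by
  -- `t1` to `t4` match the four terms of `riem`, traced over `k`, with the four terms of
  -- `ricciCoord`. The index `j` belongs to `v` and `i` to `w`, so the lower indices of `Γ` have to
  -- be exchanged.
  have t1 : ∀ k, fderiv ℝ (christoffelMap A) z (EuclideanSpace.single k 1) v w k
      = ∑ i, ∑ j, w i * v j * pd k (christoffel A k i j) z := by
    intro k
    rw [fderiv_christoffelMap_apply hA hd, Finset.sum_comm]
    exact Finset.sum_congr rfl fun i _ => Finset.sum_congr rfl fun j _ => by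
      rw [christoffel_symm hsymm k j i]; ring
  have t2 : ∀ k, fderiv ℝ (christoffelMap A) z v (EuclideanSpace.single k 1) w k
      = ∑ i, ∑ j, w i * v j * pd j (christoffel A k i k) z := by
    intro k
    conv_lhs => rw [← sum_single_smul v]
    simp only [map_sum, map_smul, sum_apply, smul_apply, WithLp.ofLp_sum, WithLp.ofLp_smul,
      Finset.sum_apply, Pi.smul_apply, smul_eq_mul, fderiv_christoffelMap_apply hA hd]
    rw [Finset.sum_comm]
    refine Finset.sum_congr rfl fun j _ => ?_
    rw [Finset.sum_eq_single k (fun b _ hb => by simp [hb]) (by simp), Finset.mul_sum]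
    exact Finset.sum_congr rfl fun i _ => by
      rw [christoffel_symm hsymm k k i]; simp; ring
  have t3 : ∀ k, christoffelMap A z (EuclideanSpace.single k 1) (christoffelMap A z v w) k
      = ∑ i, ∑ j, w i * v j * ∑ l, christoffel A k k l z * christoffel A l i j z := by
    intro k
    rw [christoffelMap_single_left]
    simp only [christoffelMap_apply, Finset.mul_sum]
    refine (Finset.sum_congr rfl fun l _ => Finset.sum_comm).trans ?_
    rw [Finset.sum_comm]
    refine Finset.sum_congr rfl fun i _ => ?_
    rw [Finset.sum_comm]
    exact Finset.sum_congr rfl fun j _ => Finset.sum_congr rfl fun l _ => by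
      rw [christoffel_symm hsymm l j i]; ring
  have t4 : ∀ k, christoffelMap A z v (christoffelMap A z (EuclideanSpace.single k 1) w) k
      = ∑ i, ∑ j, w i * v j * ∑ l, christoffel A k j l z * christoffel A l i k z := by
    intro k
    rw [christoffelMap_apply]
    simp only [christoffelMap_single_left, Finset.mul_sum]
    refine (Finset.sum_congr rfl fun j _ => Finset.sum_comm).trans ?_
    rw [Finset.sum_comm]
    exact Finset.sum_congr rfl fun i _ => Finset.sum_congr rfl fun j _ =>
      Finset.sum_congr rfl fun l _ => by rw [christoffel_symm hsymm l k i]; ring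
  rw [ric, trace_eq_sum_single]
  have : ∀ k, riemMap (christoffelMap A) z v w (EuclideanSpace.single k 1) k
      = ∑ i, ∑ j, w i * v j * ((pd k (christoffel A k i j) z - pd j (christoffel A k i k) z)
        + ∑ l, (christoffel A k k l z * christoffel A l i j z
          - christoffel A k j l z * christoffel A l i k z)) := by
    intro k
    have : riemMap (christoffelMap A) z v w (EuclideanSpace.single k 1) k
      = fderiv ℝ (christoffelMap A) z (EuclideanSpace.single k 1) v w k
        - fderiv ℝ (christoffelMap A) z v (EuclideanSpace.single k 1) w k
        + christoffelMap A z (EuclideanSpace.single k 1) (christoffelMap A z v w) k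
        - christoffelMap A z v (christoffelMap A z (EuclideanSpace.single k 1) w) k := rfl
    rw [this, t1, t2, t3, t4, ← Finset.sum_sub_distrib, ← Finset.sum_add_distrib,
      ← Finset.sum_sub_distrib]
    refine Finset.sum_congr rfl fun i _ => ?_
    rw [← Finset.sum_sub_distrib, ← Finset.sum_add_distrib, ← Finset.sum_sub_distrib]
    refine Finset.sum_congr rfl fun j _ => ?_
    rw [Finset.sum_sub_distrib]
    ring
  simp only [this]
  rw [Finset.sum_comm]
  refine Finset.sum_congr rfl fun i _ => ?_
  rw [Finset.sum_comm]
  refine Finset.sum_congr rfl fun j _ => ?_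
  rw [← Finset.mul_sum, ricciCoord, Finset.sum_add_distrib]

lemma hess_christoffelMap {A : EuclideanSpace ℝ (Fin d) → Matrix (Fin d) (Fin d) ℝ}
    {f : EuclideanSpace ℝ (Fin d) → ℝ} (hf : ContDiffAt ℝ ∞ f z)
    (v w : EuclideanSpace ℝ (Fin d)) :
    hess (christoffelMap A) f z v w = ∑ i, ∑ j, v i * w j * hessCoord A f i j z := by
  have h1 : ∀ i j, pd i (pd j f) z = fderiv ℝ (fderiv ℝ f) z (EuclideanSpace.single i 1)
      (EuclideanSpace.single j 1) := fun i j => dd_dd (hf.of_le two_le_infty) _ _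
  have h2 : fderiv ℝ (fderiv ℝ f) z v w = ∑ i, ∑ j, v i * w j * pd i (pd j f) z := by
    conv_lhs => rw [← sum_single_smul v, ← sum_single_smul w]
    simp only [map_sum, map_smul, sum_apply, smul_apply, smul_eq_mul, h1, Finset.mul_sum]
    rw [Finset.sum_comm]
    exact Finset.sum_congr rfl fun i _ => Finset.sum_congr rfl fun j _ => by ring
  have h3 : fderiv ℝ f z (christoffelMap A z v w)
      = ∑ i, ∑ j, v i * w j * ∑ k, christoffel A k i j z * pd k f z := by
    conv_lhs => rw [← sum_single_smul (christoffelMap A z v w)]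
    simp only [map_sum, map_smul, smul_eq_mul, christoffelMap_apply, Finset.mul_sum,
      Finset.sum_mul]
    rw [Finset.sum_comm]
    refine Finset.sum_congr rfl fun i _ => ?_
    rw [Finset.sum_comm]
    exact Finset.sum_congr rfl fun j _ => Finset.sum_congr rfl fun k _ => by rw [pd]; ring
  rw [hess, h2, h3, ← Finset.sum_sub_distrib]
  refine Finset.sum_congr rfl fun i _ => ?_
  rw [← Finset.sum_sub_distrib]
  exact Finset.sum_congr rfl fun j _ => by rw [hessCoord]; ring

end Connection

/-! ### Change of charts -/

section ChartGeometry

variable {d : ℕ} {X : Type*} [TopologicalSpace X] [ChartedSpace (EuclideanSpace ℝ (Fin d)) X]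
  [IsManifold (𝓡 d) ∞ X]

lemma toMatrix_chartMetric (g : Metric d X) (p : X) :
    toMatrix (chartMetric g p) = metricMatrix g.form p := rfl

lemma det_toMatrix_chartMetric_ne (g : Metric d X) {p : X} {z : EuclideanSpace ℝ (Fin d)}
    (hz : z ∈ (extChartAt (𝓡 d) p).target) : (toMatrix (chartMetric g p) z).det ≠ 0 := by
  intro h
  obtain ⟨v, hv, h0⟩ := Matrix.exists_mulVec_eq_zero_iff.2 h
  have hu : WithLp.toLp 2 v ≠ 0 := fun h => hv (by simpa using h)
  have := chartMetric_pos g hz hu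
  have e : chartMetric g p z (WithLp.toLp 2 v) (WithLp.toLp 2 v)
      = ∑ i, v i * Matrix.mulVec (toMatrix (chartMetric g p) z) v i := by
    conv_lhs => rw [← sum_single_smul (WithLp.toLp 2 v)]
    simp only [map_sum, map_smul, sum_apply, smul_apply, smul_eq_mul, Matrix.mulVec, dotProduct,
      toMatrix, Matrix.of_apply, Finset.mul_sum]
    rw [Finset.sum_comm]
    exact Finset.sum_congr rfl fun i _ => Finset.sum_congr rfl fun j _ => by ring
  rw [e, h0] at this
  simp at this

/-- The Levi-Civita connection of `g` in the preferred chart at `p`. -/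
def chartConn (g : Metric d X) (p : X) : EuclideanSpace ℝ (Fin d) →
    EuclideanSpace ℝ (Fin d) →L[ℝ] EuclideanSpace ℝ (Fin d) →L[ℝ] EuclideanSpace ℝ (Fin d) :=
  christoffelMap (metricMatrix g.form p)

lemma isLeviCivitaAt_chartConn (g : Metric d X) {p : X} {z : EuclideanSpace ℝ (Fin d)}
    (hz : z ∈ (extChartAt (𝓡 d) p).target) :
    IsLeviCivitaAt (chartMetric g p) (chartConn g p) z :=
  isLeviCivitaAt_christoffelMap ((contDiffAt_chartMetric g hz).differentiableAt (by simp))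
    (chartMetric_symm g p) (det_toMatrix_chartMetric_ne g hz)

lemma contDiffAt_chartConn (g : Metric d X) {p : X} {z : EuclideanSpace ℝ (Fin d)}
    (hz : z ∈ (extChartAt (𝓡 d) p).target) : ContDiffAt ℝ ∞ (chartConn g p) z := by
  rw [chartConn, ← toMatrix_chartMetric]
  exact contDiffAt_christoffelMap (contDiffAt_chartMetric g hz) (det_toMatrix_chartMetric_ne g hz)

lemma isLocalGeometry_chart (g : Metric d X) {p : X} {z : EuclideanSpace ℝ (Fin d)}
    (hz : z ∈ (extChartAt (𝓡 d) p).target) :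
    IsLocalGeometry (chartMetric g p) (chartConn g p) z where
  smooth_metric := contDiffAt_chartMetric g hz
  smooth_connection := contDiffAt_chartConn g hz
  levi_civita := by
    filter_upwards [(isOpen_target p).mem_nhds hz] with y hy
    exact isLeviCivitaAt_chartConn g hy
  symm := Filter.Eventually.of_forall (chartMetric_symm g p)

/-- The derivative of a map into `X`, in a chart. -/
lemma chartD_mfderiv {EA HA A : Type*} [NormedAddCommGroup EA] [NormedSpace ℝ EA]
    [TopologicalSpace HA] {IA : ModelWithCorners ℝ EA HA} [TopologicalSpace A] [ChartedSpace HA A]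
    {F : A → X} {a : A} (hF : MDifferentiableAt IA (𝓡 d) F a) {q : X}
    (ha : F a ∈ (extChartAt (𝓡 d) q).source) (v : TangentSpace IA a) :
    chartD q (F a) (mfderiv IA (𝓡 d) F a v)
      = mfderiv IA 𝓘(ℝ, EuclideanSpace ℝ (Fin d)) (fun b => extChartAt (𝓡 d) q (F b)) a v := by
  have h := mfderiv_comp a ((contMDiffAt_chart ha).mdifferentiableAt (by simp)) hF
  exact (congrArg (fun L => L v) h).symm

lemma chartD_fderiv {A : Type*} [NormedAddCommGroup A] [NormedSpace ℝ A]
    {F : A → X} {a : A} (hF : MDifferentiableAt 𝓘(ℝ, A) (𝓡 d) F a) {q : X}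
    (ha : F a ∈ (extChartAt (𝓡 d) q).source) (v : A) :
    chartD q (F a) (mfderiv 𝓘(ℝ, A) (𝓡 d) F a v)
      = fderiv ℝ (fun b => extChartAt (𝓡 d) q (F b)) a v := by
  have h := chartD_mfderiv hF ha v
  rw [mfderiv_eq_fderiv] at h
  exact h

lemma contDiffAt_transition {p q : X} {y : EuclideanSpace ℝ (Fin d)}
    (hy : y ∈ (extChartAt (𝓡 d) p).target)
    (hq : (extChartAt (𝓡 d) p).symm y ∈ (extChartAt (𝓡 d) q).source) :
    ContDiffAt ℝ ∞ (fun y => extChartAt (𝓡 d) q ((extChartAt (𝓡 d) p).symm y)) y :=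
  ((contMDiffAt_chart hq).comp y (contMDiffAt_chart_symm hy)).contDiffAt

lemma fderiv_transition {p q : X} {y : EuclideanSpace ℝ (Fin d)}
    (hy : y ∈ (extChartAt (𝓡 d) p).target)
    (hq : (extChartAt (𝓡 d) p).symm y ∈ (extChartAt (𝓡 d) q).source)
    (u : EuclideanSpace ℝ (Fin d)) :
    fderiv ℝ (fun y => extChartAt (𝓡 d) q ((extChartAt (𝓡 d) p).symm y)) y u
      = chartD q ((extChartAt (𝓡 d) p).symm y) (chartDSymm p y u) :=
  (chartD_fderiv ((contMDiffAt_chart_symm hy).mdifferentiableAt (by simp)) hq u).symm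

lemma chartMetric_transition (g : Metric d X) {p q : X} {y : EuclideanSpace ℝ (Fin d)}
    (hy : y ∈ (extChartAt (𝓡 d) p).target)
    (hq : (extChartAt (𝓡 d) p).symm y ∈ (extChartAt (𝓡 d) q).source)
    (u v : EuclideanSpace ℝ (Fin d)) :
    chartMetric g p y u v
      = chartMetric g q (extChartAt (𝓡 d) q ((extChartAt (𝓡 d) p).symm y))
        (fderiv ℝ (fun y => extChartAt (𝓡 d) q ((extChartAt (𝓡 d) p).symm y)) y u)
        (fderiv ℝ (fun y => extChartAt (𝓡 d) q ((extChartAt (𝓡 d) p).symm y)) y v) := by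
  rw [fderiv_transition hy hq, fderiv_transition hy hq, ← form_eq_chartMetric g hq]
  rfl

lemma eventually_mem_transition {p q : X} {y : EuclideanSpace ℝ (Fin d)}
    (hy : y ∈ (extChartAt (𝓡 d) p).target)
    (hq : (extChartAt (𝓡 d) p).symm y ∈ (extChartAt (𝓡 d) q).source) :
    ∀ᶠ y' in 𝓝 y, y' ∈ (extChartAt (𝓡 d) p).target ∧
      (extChartAt (𝓡 d) p).symm y' ∈ (extChartAt (𝓡 d) q).source :=
  Filter.Eventually.and ((isOpen_target p).mem_nhds hy)
    ((contMDiffAt_chart_symm hy).continuousAt.eventually ((isOpen_source q).mem_nhds hq))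

lemma chartD_surjective {p x : X} (hx : x ∈ (extChartAt (𝓡 d) p).source)
    (w : EuclideanSpace ℝ (Fin d)) : ∃ v, chartD p x v = w := by
  have := chartD_chartDSymm ((extChartAt (𝓡 d) p).map_source hx) w
  rw [(extChartAt (𝓡 d) p).left_inv hx] at this
  exact ⟨_, this⟩

/-- The transformation law of the connection under a change of charts. -/
lemma chartConn_transition (g : Metric d X) {p q : X} {y : EuclideanSpace ℝ (Fin d)}
    (hy : y ∈ (extChartAt (𝓡 d) p).target)
    (hq : (extChartAt (𝓡 d) p).symm y ∈ (extChartAt (𝓡 d) q).source)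
    (u v : EuclideanSpace ℝ (Fin d)) :
    fderiv ℝ (fun y => extChartAt (𝓡 d) q ((extChartAt (𝓡 d) p).symm y)) y (chartConn g p y u v)
      = fderiv ℝ (fderiv ℝ (fun y => extChartAt (𝓡 d) q ((extChartAt (𝓡 d) p).symm y))) y u v
        + chartConn g q (extChartAt (𝓡 d) q ((extChartAt (𝓡 d) p).symm y))
        (fderiv ℝ (fun y => extChartAt (𝓡 d) q ((extChartAt (𝓡 d) p).symm y)) y u)
        (fderiv ℝ (fun y => extChartAt (𝓡 d) q ((extChartAt (𝓡 d) p).symm y)) y v) := by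
  have ht := (extChartAt (𝓡 d) q).map_source hq
  refine IsLeviCivitaAt.transform (contDiffAt_transition hy hq) ?_
    ((contDiffAt_chartMetric g hy).differentiableAt (by simp))
    ((contDiffAt_chartMetric g ht).differentiableAt (by simp))
    (isLeviCivitaAt_chartConn g hy) (isLeviCivitaAt_chartConn g ht)
    (chartMetric_symm g q _) (fun w hw => ?_) u v
  · filter_upwards [eventually_mem_transition hy hq] with y' h' u v
    exact chartMetric_transition g h'.1 h'.2 u v
  -- The derivative of the change of charts is onto, so `w` itself is among the test vectors, and
  -- positivity of the metric rules out `w ≠ 0`.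
  · by_contra hne
    obtain ⟨a, ha⟩ := chartD_surjective hq w
    have h1 : chartDSymm p y (chartD p ((extChartAt (𝓡 d) p).symm y) a) = a := by
      have := chartDSymm_chartD ((extChartAt (𝓡 d) p).map_target hy) a
      rwa [(extChartAt (𝓡 d) p).right_inv hy] at this
    have h2 := hw (chartD p ((extChartAt (𝓡 d) p).symm y) a)
    rw [fderiv_transition hy hq, h1, ha] at h2
    exact (chartMetric_pos g ht hne).ne' h2

/-- A field of bilinear forms. -/
def IsBilinear (h : ∀ q : X, TangentSpace (𝓡 d) q → TangentSpace (𝓡 d) q → ℝ) : Prop :=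
  ∀ x, ∃ B : EuclideanSpace ℝ (Fin d) →L[ℝ] EuclideanSpace ℝ (Fin d) →L[ℝ] ℝ, ∀ v w, h x v w = B v w

/-- The matrix of the derivative of a change of charts. -/
def transitionMatrix (p q : X) (y : EuclideanSpace ℝ (Fin d)) : Matrix (Fin d) (Fin d) ℝ :=
  Matrix.of fun k i =>
    fderiv ℝ (fun y => extChartAt (𝓡 d) q ((extChartAt (𝓡 d) p).symm y)) y
      (EuclideanSpace.single i 1) k

lemma det_transitionMatrix (p q : X) (y : EuclideanSpace ℝ (Fin d)) :
    (transitionMatrix p q y).det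
      = (fderiv ℝ (fun y => extChartAt (𝓡 d) q ((extChartAt (𝓡 d) p).symm y)) y).det := by
  rw [ContinuousLinearMap.det, ← LinearMap.det_toMatrix (EuclideanSpace.basisFun (Fin d) ℝ).toBasis]
  rfl

/-- The coordinate fields of the chart at `p` are combinations of those at `q` with coefficients the
Jacobian matrix, hence a congruence of matrices. -/
lemma metricMatrix_transition {h : ∀ q : X, TangentSpace (𝓡 d) q → TangentSpace (𝓡 d) q → ℝ}
    (hB : IsBilinear h) {p q : X} {y : EuclideanSpace ℝ (Fin d)}
    (hy : y ∈ (extChartAt (𝓡 d) p).target)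
    (hq : (extChartAt (𝓡 d) p).symm y ∈ (extChartAt (𝓡 d) q).source) :
    metricMatrix h p y = (transitionMatrix p q y).transpose
      * metricMatrix h q (extChartAt (𝓡 d) q ((extChartAt (𝓡 d) p).symm y))
      * transitionMatrix p q y := by
  set x := (extChartAt (𝓡 d) p).symm y with hx
  set y' := extChartAt (𝓡 d) q x with hy'
  obtain ⟨B, hBx⟩ := hB x
  have e : ∀ i, chartDSymm p y (EuclideanSpace.single i 1)
      = ∑ k, transitionMatrix p q y k i • chartDSymm q y' (EuclideanSpace.single k 1) := by
    intro i
    have h1 := chartDSymm_chartD hq (chartDSymm p y (EuclideanSpace.single i 1))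
    rw [← fderiv_transition hy hq, ← sum_single_smul (fderiv ℝ _ y _), map_sum] at h1
    rw [← h1]
    exact Finset.sum_congr rfl fun k _ => by rw [map_smul]; rfl
  have l : ∀ i j, metricMatrix h p y i j = B (chartDSymm p y (EuclideanSpace.single i 1))
      (chartDSymm p y (EuclideanSpace.single j 1)) := fun i j => hBx _ _
  have r : ∀ i j, metricMatrix h q y' i j = B (chartDSymm q y' (EuclideanSpace.single i 1))
      (chartDSymm q y' (EuclideanSpace.single j 1)) := fun i j =>
    (form_congr h ((extChartAt (𝓡 d) q).left_inv hq) _ _).trans (hBx _ _)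
  ext i j
  rw [l, e, e, Matrix.mul_apply]
  simp only [map_sum, map_smul, sum_apply, smul_apply, smul_eq_mul, Matrix.mul_apply,
    Matrix.transpose_apply, r, Finset.sum_mul, Finset.mul_sum]
  exact Finset.sum_congr rfl fun a _ => Finset.sum_congr rfl fun b _ => by ring

lemma det_metricMatrix_transition
    {h : ∀ q : X, TangentSpace (𝓡 d) q → TangentSpace (𝓡 d) q → ℝ}
    (hB : IsBilinear h) {p q : X} {y : EuclideanSpace ℝ (Fin d)}
    (hy : y ∈ (extChartAt (𝓡 d) p).target)
    (hq : (extChartAt (𝓡 d) p).symm y ∈ (extChartAt (𝓡 d) q).source) :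
    (metricMatrix h p y).det = (transitionMatrix p q y).det ^ 2 *
      (metricMatrix h q (extChartAt (𝓡 d) q ((extChartAt (𝓡 d) p).symm y))).det := by
  rw [metricMatrix_transition hB hy hq, Matrix.det_mul, Matrix.det_mul, Matrix.det_transpose]
  ring

end ChartGeometry

/-! ### The volume measure -/

section Volume

open MeasureTheory Set

variable {d : ℕ} {X : Type*} [TopologicalSpace X] [ChartedSpace (EuclideanSpace ℝ (Fin d)) X]
  [MeasurableSpace X] [BorelSpace X]

lemma continuousOn_chart_symm (p : X) :
    ContinuousOn (extChartAt (𝓡 d) p).symm (extChartAt (𝓡 d) p).target :=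
  continuousOn_extChartAt_symm p

lemma measurableSet_target (p : X) : MeasurableSet (extChartAt (𝓡 d) p).target :=
  (isOpen_target p).measurableSet

lemma aemeasurable_chart_symm (p : X) :
    AEMeasurable (extChartAt (𝓡 d) p).symm
      (volume.restrict (extChartAt (𝓡 d) p).target) :=
  (continuousOn_chart_symm p).aemeasurable (measurableSet_target p)

/-- Nothing is known about the inverse chart off its target, so measurability comes from continuity
on the open target. -/
lemma measurableSet_chart_preimage (p : X) {B : Set X} (hB : MeasurableSet B) :
    MeasurableSet ((extChartAt (𝓡 d) p).target ∩ (extChartAt (𝓡 d) p).symm ⁻¹' B) := by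
  have h1 : Measurable ((extChartAt (𝓡 d) p).target.domRestrict (extChartAt (𝓡 d) p).symm) :=
    (continuousOn_iff_continuous_domRestrict.1 (continuousOn_chart_symm p)).measurable
  have := (measurableSet_target p).subtype_image (h1 hB)
  convert this using 1
  ext y
  simp [Set.domRestrict, and_comm]

variable {h : ∀ q : X, TangentSpace (𝓡 d) q → TangentSpace (𝓡 d) q → ℝ}

lemma chartVolume_apply (p : X) {B : Set X} (hB : MeasurableSet B) :
    chartVolume h p B = ∫⁻ y in (extChartAt (𝓡 d) p).target ∩ (extChartAt (𝓡 d) p).symm ⁻¹' B,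
      ENNReal.ofReal √(metricMatrix h p y).det := by
  rw [chartVolume, Measure.map_apply_of_aemeasurable
    ((aemeasurable_chart_symm p).mono_ac (withDensity_absolutelyContinuous _ _)) hB,
    withDensity_apply', Measure.restrict_restrict' (measurableSet_target p), inter_comm]

lemma chartVolume_inter_source (p : X) {B : Set X} (hB : MeasurableSet B) :
    chartVolume h p (B ∩ (extChartAt (𝓡 d) p).source) = chartVolume h p B := by
  rw [chartVolume_apply p hB, chartVolume_apply p (hB.inter (isOpen_source p).measurableSet)]
  congr 2
  ext y
  constructor
  · rintro ⟨h1, h2⟩; exact ⟨h1, h2.1⟩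
  · rintro ⟨h1, h2⟩; exact ⟨h1, h2, (extChartAt (𝓡 d) p).map_target h1⟩

variable [IsManifold (𝓡 d) ∞ X]

/-- Change of variables under the transition map `τ`: by `det_metricMatrix_transition` the densities
differ by exactly `|det dτ|`. -/
lemma chartVolume_overlap (hb : IsBilinear h) {p q : X} {B : Set X} (hB : MeasurableSet B)
    (hp : B ⊆ (extChartAt (𝓡 d) p).source) (hq : B ⊆ (extChartAt (𝓡 d) q).source) :
    chartVolume h p B = chartVolume h q B := by
  rw [chartVolume_apply p hB, chartVolume_apply q hB]
  set τ := fun y => extChartAt (𝓡 d) q ((extChartAt (𝓡 d) p).symm y) with hτ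
  set s := (extChartAt (𝓡 d) p).target ∩ (extChartAt (𝓡 d) p).symm ⁻¹' B with hs
  have hsm : MeasurableSet s := measurableSet_chart_preimage p hB
  have himg : (extChartAt (𝓡 d) q).target ∩ (extChartAt (𝓡 d) q).symm ⁻¹' B = τ '' s := by
    ext z
    constructor
    · rintro ⟨h1, h2⟩
      have h3 := hp h2
      refine ⟨extChartAt (𝓡 d) p ((extChartAt (𝓡 d) q).symm z),
        ⟨(extChartAt (𝓡 d) p).map_source h3, ?_⟩, ?_⟩
      · rw [mem_preimage, (extChartAt (𝓡 d) p).left_inv h3]; exact h2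
      · rw [hτ]; simp only
        rw [(extChartAt (𝓡 d) p).left_inv h3, (extChartAt (𝓡 d) q).right_inv h1]
    · rintro ⟨y, ⟨h1, h2⟩, rfl⟩
      refine ⟨(extChartAt (𝓡 d) q).map_source (hq h2), ?_⟩
      rw [mem_preimage, (extChartAt (𝓡 d) q).left_inv (hq h2)]
      exact h2
  have hinj : InjOn τ s := by
    rintro y ⟨h1, h2⟩ y' ⟨h1', h2'⟩ e
    have e1 := (extChartAt (𝓡 d) q).injOn (hq h2) (hq h2') e
    have e2 := congrArg (extChartAt (𝓡 d) p) e1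
    rwa [(extChartAt (𝓡 d) p).right_inv h1, (extChartAt (𝓡 d) p).right_inv h1'] at e2
  have hder : ∀ y ∈ s, HasFDerivWithinAt τ (fderiv ℝ τ y) s y := fun y hy =>
    ((contDiffAt_transition hy.1 (hq hy.2)).differentiableAt
      (by simp)).hasFDerivAt.hasFDerivWithinAt
  rw [himg, lintegral_image_eq_lintegral_abs_det_fderiv_mul volume hsm hder hinj]
  refine setLIntegral_congr_fun hsm fun y hy => ?_
  rw [det_metricMatrix_transition hb hy.1 (hq hy.2), det_transitionMatrix,
    ← ENNReal.ofReal_mul (abs_nonneg _), Real.sqrt_mul (sq_nonneg _), Real.sqrt_sq_eq_abs]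

lemma exists_seq_charts [SecondCountableTopology X] [Nonempty X] :
    ∃ p : ℕ → X, ⋃ k, (extChartAt (𝓡 d) (p k)).source = univ := by
  obtain ⟨s, hs, hu⟩ := TopologicalSpace.countable_cover_nhds
    (f := fun x : X => (extChartAt (𝓡 d) x).source) fun x => extChartAt_source_mem_nhds x
  have hne : s.Nonempty := by
    by_contra hc
    rw [not_nonempty_iff_eq_empty] at hc
    simp [hc] at hu
    exact (empty_ne_univ hu)
  obtain ⟨p, rfl⟩ := hs.exists_eq_range hne
  exact ⟨p, by simpa using hu⟩

variable [SecondCountableTopology X]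

/-- Second countability gives countably many covering charts, whose domains are then made disjoint.
Countability allows measures to be summed over the pieces. -/
lemma exists_measurable_partition [Nonempty X] : ∃ (p : ℕ → X) (B : ℕ → Set X),
    (∀ k, MeasurableSet (B k)) ∧ (∀ k, B k ⊆ (extChartAt (𝓡 d) (p k)).source) ∧
      Pairwise (Function.onFun Disjoint B) ∧ ⋃ k, B k = univ := by
  obtain ⟨p, hp⟩ := exists_seq_charts (d := d) (X := X)
  refine ⟨p, disjointed fun k => (extChartAt (𝓡 d) (p k)).source,
    fun k => MeasurableSet.disjointed (fun k => (isOpen_source _).measurableSet) k,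
    fun k => disjointed_subset _ _, disjoint_disjointed _, ?_⟩
  rw [iUnion_disjointed, hp]

/-- The volume measure restricts to the chart volumes. -/
lemma volumeMeasure_apply (hb : IsBilinear h) {p : X} {A : Set X} (hA : MeasurableSet A)
    (hp : A ⊆ (extChartAt (𝓡 d) p).source) : volumeMeasure h A = chartVolume h p A := by
  have : Nonempty X := ⟨p⟩
  obtain ⟨c, B, hBm, hBs, hBd, hBu⟩ := exists_measurable_partition (d := d) (X := X)
  -- `μ` glues chart volumes along the partition. It dominates each chart volume, since on `A ∩ B k`
  -- that volume only sees the overlap with the chart at `c k`; conversely each piece of `μ` is at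
  -- most the supremum. So `μ` is the supremum.
  set μ : Measure X := Measure.sum fun k => (chartVolume h (c k)).restrict (B k) with hμ
  have hμA : ∀ A, MeasurableSet A → μ A = ∑' k, chartVolume h (c k) (A ∩ B k) := by
    intro A hA
    rw [hμ, Measure.sum_apply _ hA]
    exact tsum_congr fun k => Measure.restrict_apply hA
  have split : ∀ (ν : Measure X) {A}, MeasurableSet A → ν A = ∑' k, ν (A ∩ B k) := by
    intro ν A hA
    rw [← measure_iUnion (fun i j hij => (hBd hij).mono inter_subset_right inter_subset_right)
      (fun k => hA.inter (hBm k)), ← inter_iUnion, hBu, inter_univ]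
  have hle : ∀ q, chartVolume h q ≤ μ := by
    intro q
    refine Measure.le_iff.2 fun A hA => ?_
    rw [split _ hA, hμA A hA]
    refine ENNReal.tsum_le_tsum fun k => ?_
    rw [← chartVolume_inter_source q (hA.inter (hBm k)),
      chartVolume_overlap hb ((hA.inter (hBm k)).inter (isOpen_source q).measurableSet)
        inter_subset_right (inter_subset_left.trans (inter_subset_right.trans (hBs k)))]
    exact measure_mono inter_subset_left
  have heq : volumeMeasure h = μ := by
    refine le_antisymm (iSup_le hle) (Measure.le_iff.2 fun A hA => ?_)
    rw [hμA A hA, split (volumeMeasure h) hA]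
    exact ENNReal.tsum_le_tsum fun k => Measure.le_iff'.1 (le_iSup (chartVolume h) (c k)) _
  rw [heq, hμA A hA, split _ hA]
  exact tsum_congr fun k => chartVolume_overlap hb (hA.inter (hBm k))
    (inter_subset_right.trans (hBs k)) (inter_subset_left.trans hp)

lemma volumeMeasure_restrict (hb : IsBilinear h) {p : X} {A : Set X} (hA : MeasurableSet A)
    (hp : A ⊆ (extChartAt (𝓡 d) p).source) :
    (volumeMeasure h).restrict A = (chartVolume h p).restrict A := by
  ext s hs
  rw [Measure.restrict_apply hs, Measure.restrict_apply hs,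
    volumeMeasure_apply hb (hs.inter hA) (inter_subset_right.trans hp)]

lemma aemeasurable_density {p : X}
    (hc : ContinuousOn (fun y => (metricMatrix h p y).det) (extChartAt (𝓡 d) p).target) :
    AEMeasurable (fun y => ENNReal.ofReal √(metricMatrix h p y).det)
      (volume.restrict (extChartAt (𝓡 d) p).target) :=
  (hc.sqrt.aemeasurable (measurableSet_target p)).ennreal_ofReal

/-- Change of density of a volume measure. -/
lemma volumeMeasure_eq_withDensity
    {h' : ∀ q : X, TangentSpace (𝓡 d) q → TangentSpace (𝓡 d) q → ℝ}
    (hb : IsBilinear h) (hb' : IsBilinear h')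
    (hc : ∀ p, ContinuousOn (fun y => (metricMatrix h p y).det) (extChartAt (𝓡 d) p).target)
    {J : X → ℝ} (hJ : Continuous J) (hJ0 : 0 ≤ J)
    (hJh : ∀ p, ∀ y ∈ (extChartAt (𝓡 d) p).target, √(metricMatrix h' p y).det
      = J ((extChartAt (𝓡 d) p).symm y) * √(metricMatrix h p y).det) :
    volumeMeasure h' = (volumeMeasure h).withDensity fun x => ENNReal.ofReal (J x) := by
  rcases isEmpty_or_nonempty X with hX | hX
  · exact (Measure.eq_zero_of_isEmpty _).trans (Measure.eq_zero_of_isEmpty _).symm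
  obtain ⟨c, B, hBm, hBs, hBd, hBu⟩ := exists_measurable_partition (d := d) (X := X)
  have hJm : Measurable fun x => ENNReal.ofReal (J x) := hJ.measurable.ennreal_ofReal
  -- Inside one chart domain both measures are integrals over the target, and the integrands agree
  -- by `hJh`; the general set is cut along the partition.
  have key : ∀ p A, MeasurableSet A → A ⊆ (extChartAt (𝓡 d) p).source →
      volumeMeasure h' A = ((volumeMeasure h).withDensity fun x => ENNReal.ofReal (J x)) A := by
    intro p A hA hp
    have hm := aemeasurable_chart_symm (d := d) p
    rw [withDensity_apply _ hA, volumeMeasure_restrict hb hA hp, volumeMeasure_apply hb' hA hp,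
      chartVolume_apply p hA, ← lintegral_indicator hA, chartVolume,
      lintegral_map' (hJm.indicator hA).aemeasurable
        (hm.mono_ac (withDensity_absolutelyContinuous _ _)),
      lintegral_withDensity_eq_lintegral_mul₀ (aemeasurable_density (hc p))
        (show AEMeasurable (fun y => A.indicator (fun x => ENNReal.ofReal (J x))
          ((extChartAt (𝓡 d) p).symm y)) _ from (hJm.indicator hA).comp_aemeasurable hm),
      ← lintegral_indicator (measurableSet_chart_preimage p hA),
      ← lintegral_indicator (measurableSet_target p)]
    refine lintegral_congr fun y => ?_
    by_cases hy : y ∈ (extChartAt (𝓡 d) p).target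
    · by_cases hyA : (extChartAt (𝓡 d) p).symm y ∈ A
      · rw [indicator_of_mem (by exact ⟨hy, hyA⟩), indicator_of_mem hy, Pi.mul_apply,
          indicator_of_mem hyA, hJh p y hy, ENNReal.ofReal_mul (hJ0 _), mul_comm]
      · rw [indicator_of_notMem (fun hh => hyA hh.2), indicator_of_mem hy, Pi.mul_apply,
          indicator_of_notMem hyA, mul_zero]
    · rw [indicator_of_notMem (fun hh => hy hh.1), indicator_of_notMem hy]
  ext A hA
  have split : ∀ ν : Measure X, ν A = ∑' k, ν (A ∩ B k) := by
    intro ν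
    rw [← measure_iUnion (fun i j hij => (hBd hij).mono inter_subset_right inter_subset_right)
      (fun k => hA.inter (hBm k)), ← inter_iUnion, hBu, inter_univ]
  rw [split, split]
  exact tsum_congr fun k => key (c k) _ (hA.inter (hBm k)) (inter_subset_right.trans (hBs k))

/-- The image under the inverse chart of a compact neighbourhood has finite volume, because the
density is continuous on a compact set. -/
lemma isLocallyFiniteMeasure_volumeMeasure [T2Space X] (hb : IsBilinear h)
    (hc : ∀ p, ContinuousOn (fun y => (metricMatrix h p y).det) (extChartAt (𝓡 d) p).target) :
    IsLocallyFiniteMeasure (volumeMeasure h) := by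
  refine ⟨fun x => ?_⟩
  obtain ⟨K, hK, hxK, hKt⟩ := exists_compact_subset (isOpen_target (d := d) x)
    (mem_extChartAt_target x)
  set A := (extChartAt (𝓡 d) x).symm '' K with hA
  have hAc : IsCompact A := hK.image_of_continuousOn ((continuousOn_chart_symm x).mono hKt)
  have hAm : MeasurableSet A := hAc.isClosed.measurableSet
  have hAs : A ⊆ (extChartAt (𝓡 d) x).source := by
    rintro _ ⟨y, hy, rfl⟩; exact (extChartAt (𝓡 d) x).map_target (hKt hy)
  have hAn : A ∈ 𝓝 x := by
    have h1 : (extChartAt (𝓡 d) x) ⁻¹' (interior K) ∈ 𝓝 x :=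
      (continuousAt_extChartAt x).preimage_mem_nhds (isOpen_interior.mem_nhds hxK)
    filter_upwards [h1, extChartAt_source_mem_nhds (I := 𝓡 d) x] with z hz hzs
    exact ⟨_, interior_subset hz, (extChartAt (𝓡 d) x).left_inv hzs⟩
  refine ⟨A, hAn, ?_⟩
  rw [volumeMeasure_apply hb hAm hAs, chartVolume_apply x hAm]
  have hsub : (extChartAt (𝓡 d) x).target ∩ (extChartAt (𝓡 d) x).symm ⁻¹' A ⊆ K := by
    rintro y ⟨hy, k, hk, e⟩
    have := (extChartAt (𝓡 d) x).symm.injOn (hKt hk) hy e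
    rwa [← this]
  refine (lintegral_mono_set hsub).trans_lt ?_
  have hi : IntegrableOn (fun y => √(metricMatrix h x y).det) K :=
    ((hc x).sqrt.mono hKt).integrableOn_compact hK
  exact hi.lintegral_lt_top

/-- A null open set would give a nonempty open subset of Euclidean space with zero integral of a
positive density. This is what later turns almost everywhere equality of continuous functions into
equality. -/
lemma isOpenPosMeasure_volumeMeasure (hb : IsBilinear h)
    (hc : ∀ p, ContinuousOn (fun y => (metricMatrix h p y).det) (extChartAt (𝓡 d) p).target)
    (hpos : ∀ p, ∀ y ∈ (extChartAt (𝓡 d) p).target, 0 < (metricMatrix h p y).det) :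
    (volumeMeasure h).IsOpenPosMeasure := by
  refine ⟨fun U hU hne h0 => ?_⟩
  obtain ⟨x, hx⟩ := hne
  have hm : MeasurableSet (U ∩ (extChartAt (𝓡 d) x).source) :=
    (hU.inter (isOpen_source x)).measurableSet
  have h1 : chartVolume h x (U ∩ (extChartAt (𝓡 d) x).source) = 0 := by
    rw [← volumeMeasure_apply hb hm inter_subset_right]
    exact measure_mono_null inter_subset_left h0
  rw [chartVolume_apply x hm, lintegral_eq_zero_iff'
    ((aemeasurable_density (hc x)).mono_measure (Measure.restrict_mono inter_subset_left le_rfl))]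
    at h1
  set s := (extChartAt (𝓡 d) x).target ∩
    (extChartAt (𝓡 d) x).symm ⁻¹' (U ∩ (extChartAt (𝓡 d) x).source) with hs
  have hso : IsOpen s :=
    (continuousOn_chart_symm x).isOpen_inter_preimage (isOpen_target x) (hU.inter (isOpen_source x))
  have hv : volume s = 0 := by
    have h2 : ∀ᵐ y ∂(volume.restrict s), False := by
      filter_upwards [h1, ae_restrict_mem (measurableSet_chart_preimage x hm)] with y hy hys
      have := Real.sqrt_pos.2 (hpos x y hys.1)
      simp only [Pi.zero_apply, ENNReal.ofReal_eq_zero] at hy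
      exact absurd hy (not_le.2 this)
    simpa using h2
  refine (hso.measure_pos volume ⟨extChartAt (𝓡 d) x x, mem_extChartAt_target x, ?_⟩).ne' hv
  rw [mem_preimage, extChartAt_to_inv]
  exact ⟨hx, mem_extChartAt_source x⟩

end Volume

/-! ### Families of hypersurfaces in charts -/

section Families

variable {n : ℕ}
  {M : Type*} [TopologicalSpace M] [ChartedSpace (EuclideanSpace ℝ (Fin (n + 1))) M]
  [IsManifold (𝓡 (n + 1)) ∞ M]
  {S : Type*} [TopologicalSpace S] [ChartedSpace (EuclideanSpace ℝ (Fin n)) S]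
  [IsManifold (𝓡 n) ∞ S]

/-- The family `F` in charts. -/
def famRep (F : ℝ → S → M) (p : S) (q : M) (r : ℝ × EuclideanSpace ℝ (Fin n)) :
    EuclideanSpace ℝ (Fin (n + 1)) :=
  extChartAt (𝓡 (n + 1)) q (F r.1 ((extChartAt (𝓡 n) p).symm r.2))

/-- Space directions. -/
def dirs (n : ℕ) (i : Fin n) : ℝ × EuclideanSpace ℝ (Fin n) := (0, EuclideanSpace.single i 1)

/-- Time direction. -/
def tdir (n : ℕ) : ℝ × EuclideanSpace ℝ (Fin n) := (1, 0)

/-- The family `F` is smooth at `(t, x)`. -/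
def SmoothFamilyAt (n : ℕ)
    {M : Type*} [TopologicalSpace M] [ChartedSpace (EuclideanSpace ℝ (Fin (n + 1))) M]
    {S : Type*} [TopologicalSpace S] [ChartedSpace (EuclideanSpace ℝ (Fin n)) S] (F : ℝ → S → M) (t : ℝ) (x : S) : Prop :=
  ContMDiffAt (𝓘(ℝ, ℝ).prod (𝓡 n)) (𝓡 (n + 1)) ∞ (fun q : ℝ × S => F q.1 q.2) (t, x)

lemma SmoothFamilyAt.contMDiffAt {F : ℝ → S → M} {t : ℝ} {x : S} (h : SmoothFamilyAt n F t x) :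
    ContMDiffAt (𝓡 n) (𝓡 (n + 1)) ∞ (F t) x :=
  ContMDiffAt.comp (g := fun q : ℝ × S => F q.1 q.2) (f := fun x => (t, x)) x h
    (contMDiffAt_const.prodMk contMDiffAt_id)

lemma SmoothFamilyAt.contMDiffAt_time {F : ℝ → S → M} {t : ℝ} {x : S} (h : SmoothFamilyAt n F t x) :
    ContMDiffAt 𝓘(ℝ, ℝ) (𝓡 (n + 1)) ∞ (fun s => F s x) t :=
  ContMDiffAt.comp (g := fun q : ℝ × S => F q.1 q.2) (f := fun s => (s, x)) t h
    (contMDiffAt_id.prodMk contMDiffAt_const)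

lemma smoothFamilyAt_const {φ : S → M} {x : S} (h : ContMDiffAt (𝓡 n) (𝓡 (n + 1)) ∞ φ x)
    (t : ℝ) : SmoothFamilyAt n (fun _ => φ) t x :=
  ContMDiffAt.comp (g := φ) (f := Prod.snd) (t, x) h contMDiffAt_snd

lemma contMDiffAt_prod_chart_symm {p : S} {t : ℝ} {y : EuclideanSpace ℝ (Fin n)}
    (hy : y ∈ (extChartAt (𝓡 n) p).target) :
    ContMDiffAt 𝓘(ℝ, ℝ × EuclideanSpace ℝ (Fin n)) (𝓘(ℝ, ℝ).prod (𝓡 n)) ∞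
      (fun r : ℝ × EuclideanSpace ℝ (Fin n) => (r.1, (extChartAt (𝓡 n) p).symm r.2)) (t, y) :=
  ContMDiffAt.prodMk (contDiff_fst.contMDiff.contMDiffAt)
    (ContMDiffAt.comp (g := (extChartAt (𝓡 n) p).symm) (f := Prod.snd) (t, y)
      (contMDiffAt_chart_symm hy) contDiff_snd.contMDiff.contMDiffAt)

lemma contDiffAt_famRep {F : ℝ → S → M} {p : S} {q : M} {t : ℝ} {y : EuclideanSpace ℝ (Fin n)}
    (hy : y ∈ (extChartAt (𝓡 n) p).target)
    (hF : SmoothFamilyAt n F t ((extChartAt (𝓡 n) p).symm y))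
    (hq : F t ((extChartAt (𝓡 n) p).symm y) ∈ (extChartAt (𝓡 (n + 1)) q).source) :
    ContDiffAt ℝ ∞ (famRep F p q) (t, y) := by
  have h1 := ContMDiffAt.comp (g := fun q : ℝ × S => F q.1 q.2)
    (f := fun r : ℝ × EuclideanSpace ℝ (Fin n) => (r.1, (extChartAt (𝓡 n) p).symm r.2)) (t, y)
    hF (contMDiffAt_prod_chart_symm hy)
  exact (ContMDiffAt.comp (g := extChartAt (𝓡 (n + 1)) q) (t, y) (contMDiffAt_chart hq)
    h1).contDiffAt

lemma dd_dirs_famRep {F : ℝ → S → M} {p : S} {q : M} {t : ℝ} {y : EuclideanSpace ℝ (Fin n)}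
    (h : DifferentiableAt ℝ (famRep F p q) (t, y)) (i : Fin n) :
    dd (dirs n i) (famRep F p q) (t, y)
      = fderiv ℝ (fun y => extChartAt (𝓡 (n + 1)) q (F t ((extChartAt (𝓡 n) p).symm y))) y
        (EuclideanSpace.single i 1) := by
  have h1 : HasFDerivAt (fun y : EuclideanSpace ℝ (Fin n) => (t, y))
      (ContinuousLinearMap.inr ℝ ℝ (EuclideanSpace ℝ (Fin n))) y := hasFDerivAt_prodMk_right t y
  have h2 := HasFDerivAt.comp (g := famRep F p q) y h.hasFDerivAt h1
  exact (congrArg (fun L => L (EuclideanSpace.single i 1)) h2.fderiv).symm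

lemma metricMatrix_inducedForm (g : Metric (n + 1) M) {F : S → M} {p : S} {q : M}
    {y : EuclideanSpace ℝ (Fin n)} (hy : y ∈ (extChartAt (𝓡 n) p).target)
    (hF : MDifferentiableAt (𝓡 n) (𝓡 (n + 1)) F ((extChartAt (𝓡 n) p).symm y))
    (hq : F ((extChartAt (𝓡 n) p).symm y) ∈ (extChartAt (𝓡 (n + 1)) q).source) (i j : Fin n) :
    metricMatrix (inducedForm g F) p y i j
      = chartMetric g q (extChartAt (𝓡 (n + 1)) q (F ((extChartAt (𝓡 n) p).symm y)))
        (fderiv ℝ (fun y => extChartAt (𝓡 (n + 1)) q (F ((extChartAt (𝓡 n) p).symm y))) y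
          (EuclideanSpace.single i 1))
        (fderiv ℝ (fun y => extChartAt (𝓡 (n + 1)) q (F ((extChartAt (𝓡 n) p).symm y))) y
          (EuclideanSpace.single j 1)) := by
  have hs : MDifferentiableAt (𝓡 n) (𝓡 n) (extChartAt (𝓡 n) p).symm y :=
    (contMDiffAt_chart_symm hy).mdifferentiableAt (by simp)
  have hcomp : MDifferentiableAt (𝓡 n) (𝓡 (n + 1)) (fun y => F ((extChartAt (𝓡 n) p).symm y)) y :=
    MDifferentiableAt.comp y hF hs
  have key : ∀ u, chartD q (F ((extChartAt (𝓡 n) p).symm y))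
      (mfderiv (𝓡 n) (𝓡 (n + 1)) F ((extChartAt (𝓡 n) p).symm y) (chartDSymm p y u))
      = fderiv ℝ (fun y => extChartAt (𝓡 (n + 1)) q (F ((extChartAt (𝓡 n) p).symm y))) y u := by
    intro u
    rw [← chartD_fderiv hcomp hq u]
    have := congrArg (fun L => L u) (mfderiv_comp y hF hs)
    exact (congrArg (chartD q _) this).symm
  refine (form_eq_chartMetric g hq _ _).trans ?_
  exact congrArg₂ (fun a b => chartMetric g q _ a b) (key _) (key _)

/-- The charts at `p` and `q` need not be centred at the points considered. One pair of charts thus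
covers a whole neighbourhood in `(t, y)`, and the calculus of `gram` applies. -/
lemma metricMatrix_eq_gram (g : Metric (n + 1) M) {F : ℝ → S → M} {p : S} {q : M} {t : ℝ}
    {y : EuclideanSpace ℝ (Fin n)} (hy : y ∈ (extChartAt (𝓡 n) p).target)
    (hF : SmoothFamilyAt n F t ((extChartAt (𝓡 n) p).symm y))
    (hq : F t ((extChartAt (𝓡 n) p).symm y) ∈ (extChartAt (𝓡 (n + 1)) q).source) :
    metricMatrix (inducedForm g (F t)) p y
      = gram (chartMetric g q) (famRep F p q) (dirs n) (t, y) := by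
  have hd := (contDiffAt_famRep hy hF hq).differentiableAt (by simp)
  ext i j
  rw [metricMatrix_inducedForm g hy (hF.contMDiffAt.mdifferentiableAt (by simp)) hq, gram,
    Matrix.of_apply, dd_dirs_famRep hd, dd_dirs_famRep hd]
  rfl

lemma isBilinear_inducedForm (g : Metric (n + 1) M) (F : S → M) :
    IsBilinear (inducedForm g F) := fun x =>
  ⟨ContinuousLinearMap.bilinearComp
    (@id (EuclideanSpace ℝ (Fin (n + 1)) →L[ℝ] EuclideanSpace ℝ (Fin (n + 1)) →L[ℝ] ℝ)
      (g.inner (F x)))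
    (@id (EuclideanSpace ℝ (Fin n) →L[ℝ] EuclideanSpace ℝ (Fin (n + 1)))
      (mfderiv (𝓡 n) (𝓡 (n + 1)) F x))
    (@id (EuclideanSpace ℝ (Fin n) →L[ℝ] EuclideanSpace ℝ (Fin (n + 1)))
      (mfderiv (𝓡 n) (𝓡 (n + 1)) F x)), fun _ _ => rfl⟩

lemma sum_metricMatrix (g : Metric (n + 1) M) (F : S → M) (p : S) (y : EuclideanSpace ℝ (Fin n))
    (v w : EuclideanSpace ℝ (Fin n)) :
    ∑ i, ∑ j, v i * w j * metricMatrix (inducedForm g F) p y i j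
      = inducedForm g F ((extChartAt (𝓡 n) p).symm y) (chartDSymm p y v) (chartDSymm p y w) := by
  obtain ⟨B, hB⟩ := isBilinear_inducedForm g F ((extChartAt (𝓡 n) p).symm y)
  refine Eq.trans ?_ (hB _ _).symm
  have l : ∀ i j, metricMatrix (inducedForm g F) p y i j
      = B (chartDSymm p y (EuclideanSpace.single i 1)) (chartDSymm p y (EuclideanSpace.single j 1)) :=
    fun i j => hB _ _
  conv_rhs => rw [← sum_single_smul v, ← sum_single_smul w]
  simp only [map_sum, map_smul, sum_apply, smul_apply, smul_eq_mul, Finset.mul_sum, l]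
  rw [Finset.sum_comm]
  exact Finset.sum_congr rfl fun i _ => Finset.sum_congr rfl fun j _ => by ring

/-- Injectivity of the differential makes the induced form positive definite. -/
lemma det_metricMatrix_pos (g : Metric (n + 1) M) {F : S → M} {p : S}
    {y : EuclideanSpace ℝ (Fin n)} (hy : y ∈ (extChartAt (𝓡 n) p).target)
    (hinj : Function.Injective (mfderiv (𝓡 n) (𝓡 (n + 1)) F ((extChartAt (𝓡 n) p).symm y))) :
    0 < (metricMatrix (inducedForm g F) p y).det := by
  refine Matrix.PosDef.det_pos (Matrix.PosDef.of_dotProduct_mulVec_pos ?_ fun v hv => ?_)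
  · ext i j
    exact g.symm _ _ _
  · have hu : WithLp.toLp 2 v ≠ 0 := fun h => hv (by simpa using h)
    have e : star v ⬝ᵥ (metricMatrix (inducedForm g F) p y).mulVec v
        = inducedForm g F ((extChartAt (𝓡 n) p).symm y) (chartDSymm p y (WithLp.toLp 2 v))
          (chartDSymm p y (WithLp.toLp 2 v)) := by
      rw [← sum_metricMatrix]
      simp only [dotProduct, Matrix.mulVec, Finset.mul_sum, Pi.star_apply, star_trivial]
      exact Finset.sum_congr rfl fun i _ => Finset.sum_congr rfl fun j _ => by ring
    rw [e]
    refine g.pos _ _ fun h => hu ?_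
    have h0 : chartDSymm p y (WithLp.toLp 2 v) = 0 :=
      hinj (h.trans (map_zero (mfderiv (𝓡 n) (𝓡 (n + 1)) F _)).symm)
    exact (chartD_chartDSymm hy (WithLp.toLp 2 v)).symm.trans
      ((congrArg (chartD p _) h0).trans (map_zero _))

/-- A kernel vector of the differential lies in the kernel of the Gram matrix. With the previous
lemma, being an immersion becomes an open condition on a determinant. -/
lemma injective_of_det_ne_zero (g : Metric (n + 1) M) {F : S → M} {p : S}
    {y : EuclideanSpace ℝ (Fin n)} (hy : y ∈ (extChartAt (𝓡 n) p).target)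
    (hdet : (metricMatrix (inducedForm g F) p y).det ≠ 0) :
    Function.Injective (mfderiv (𝓡 n) (𝓡 (n + 1)) F ((extChartAt (𝓡 n) p).symm y)) := by
  refine (injective_iff_map_eq_zero
    (mfderiv (𝓡 n) (𝓡 (n + 1)) F ((extChartAt (𝓡 n) p).symm y))).2 fun w hw => ?_
  let w' : EuclideanSpace ℝ (Fin n) := w
  set v := chartD p ((extChartAt (𝓡 n) p).symm y) w' with hv
  have hw' : chartDSymm p y v = w' := by
    have := chartDSymm_chartD ((extChartAt (𝓡 n) p).map_target hy) w'
    rwa [(extChartAt (𝓡 n) p).right_inv hy] at this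
  have hz : Matrix.vecMul (fun i => v i) (metricMatrix (inducedForm g F) p y) = 0 := by
    ext j
    have h1 := sum_metricMatrix g F p y v (EuclideanSpace.single j 1)
    have h2 : inducedForm g F ((extChartAt (𝓡 n) p).symm y) (chartDSymm p y v)
        (chartDSymm p y (EuclideanSpace.single j 1)) = 0 := by
      rw [hw']
      refine (congrArg (fun a => g.inner _ a _) hw).trans ?_
      exact congrArg (fun L : EuclideanSpace ℝ (Fin (n + 1)) →L[ℝ] ℝ => L _)
        (map_zero (@id (EuclideanSpace ℝ (Fin (n + 1)) →L[ℝ] EuclideanSpace ℝ (Fin (n + 1)) →L[ℝ] ℝ)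
          (g.inner (F ((extChartAt (𝓡 n) p).symm y)))))
    refine Eq.trans ?_ (h1.trans h2)
    simp only [Matrix.vecMul, dotProduct]
    refine Finset.sum_congr rfl fun i _ => ?_
    rw [Finset.sum_eq_single j (fun b _ hb => by simp [hb]) (by simp)]
    simp
  have := Matrix.eq_zero_of_vecMul_eq_zero hdet hz
  have v0 : v = 0 := by ext i; exact congrFun this i
  rw [v0, map_zero] at hw'
  exact hw'.symm

end Families

/-! ### Differentiation under the integral sign -/

section Integration

open MeasureTheory Set

variable {n : ℕ} {S : Type*} [TopologicalSpace S] [ChartedSpace (EuclideanSpace ℝ (Fin n)) S]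

/-- `D` is smooth at `(0, x)`. -/
def SmoothDensityAt (n : ℕ) {S : Type*} [TopologicalSpace S]
    [ChartedSpace (EuclideanSpace ℝ (Fin n)) S] (D : ℝ → S → ℝ) (x : S) : Prop :=
  ContDiffAt ℝ ∞ (fun r : ℝ × EuclideanSpace ℝ (Fin n) => D r.1 ((extChartAt (𝓡 n) x).symm r.2))
    (0, extChartAt (𝓡 n) x x)

lemma tendsto_prod_chart (x : S) :
    Filter.Tendsto (fun r : ℝ × S => (r.1, extChartAt (𝓡 n) x r.2)) (𝓝 (0, x))
      (𝓝 (0, extChartAt (𝓡 n) x x)) := by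
  have h : ContinuousAt (fun r : ℝ × S => (r.1, extChartAt (𝓡 n) x r.2)) (0, x) :=
    continuousAt_fst.prodMk (ContinuousAt.comp (g := extChartAt (𝓡 n) x) (f := Prod.snd)
      (x := ((0 : ℝ), x)) (continuousAt_extChartAt x) continuousAt_snd)
  exact h

lemma eventually_mem_source (x : S) :
    ∀ᶠ r : ℝ × S in 𝓝 (0, x), r.2 ∈ (extChartAt (𝓡 n) x).source :=
  (continuous_snd.tendsto ((0 : ℝ), x)).eventually
    ((isOpen_source x).mem_nhds (mem_extChartAt_source x))

lemma dd_tdir {u : ℝ × EuclideanSpace ℝ (Fin n) → ℝ} {t : ℝ} {y : EuclideanSpace ℝ (Fin n)}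
    (h : DifferentiableAt ℝ u (t, y)) : HasDerivAt (fun s => u (s, y)) (dd (tdir n) u (t, y)) t :=
  h.hasFDerivAt.comp_hasDerivAt t ((hasDerivAt_id t).prodMk (hasDerivAt_const t y))

lemma SmoothDensityAt.eventually_hasDerivAt {D : ℝ → S → ℝ} {x : S} (h : SmoothDensityAt n D x) :
    ∀ᶠ r : ℝ × S in 𝓝 (0, x), HasDerivAt (fun s => D s r.2) (deriv (fun s => D s r.2) r.1) r.1 := by
  filter_upwards [(tendsto_prod_chart x).eventually (eventually_differentiableAt h),
    eventually_mem_source (n := n) x] with r h1 h2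
  have := (dd_tdir h1).differentiableAt
  simp only [(extChartAt (𝓡 n) x).left_inv h2] at this
  exact this.hasDerivAt

lemma SmoothDensityAt.eventually_continuousAt {D : ℝ → S → ℝ} {x : S} (h : SmoothDensityAt n D x) :
    ∀ᶠ r : ℝ × S in 𝓝 (0, x), ContinuousAt (fun r : ℝ × S => D r.1 r.2) r := by
  filter_upwards [(tendsto_prod_chart x).eventually (eventually_differentiableAt h),
    eventually_mem_source (n := n) x] with r h1 h2
  have hc : ContinuousAt (fun r : ℝ × S => (r.1, extChartAt (𝓡 n) x r.2)) r :=
    continuousAt_fst.prodMk (ContinuousAt.comp (g := extChartAt (𝓡 n) x) (f := Prod.snd)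
      (x := r) (continuousAt_extChartAt' h2) continuousAt_snd)
  refine (ContinuousAt.comp (x := r) h1.continuousAt hc).congr ?_
  have : ∀ᶠ r' : ℝ × S in 𝓝 r, r'.2 ∈ (extChartAt (𝓡 n) x).source :=
    (continuous_snd.tendsto r).eventually ((isOpen_source x).mem_nhds h2)
  filter_upwards [this] with r' hr'
  simp only [Function.comp, (extChartAt (𝓡 n) x).left_inv hr']

/-- Stability under the time derivative allows `hasDerivAt_setIntegral` to be used a second time. -/
lemma SmoothDensityAt.deriv {D : ℝ → S → ℝ} {x : S} (h : SmoothDensityAt n D x) :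
    SmoothDensityAt n (fun t x => deriv (fun s => D s x) t) x := by
  refine (contDiffAt_dd h (tdir n)).congr_of_eventuallyEq ?_
  filter_upwards [eventually_differentiableAt h] with r hr
  exact (dd_tdir hr).deriv

/-- Dominated differentiation. The conclusion holds for all `t` near `0`, so that the resulting
derivative can itself be differentiated at `0`. -/
lemma hasDerivAt_setIntegral [T2Space S] [SecondCountableTopology S] [MeasurableSpace S]
    [BorelSpace S] {D : ℝ → S → ℝ} (h : ∀ x, SmoothDensityAt n D x) {μ : Measure S}
    [IsLocallyFiniteMeasure μ] {K : Set S} (hK : IsCompact K) :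
    ∀ᶠ t in 𝓝 (0 : ℝ), HasDerivAt (fun s => ∫ x in K, D s x ∂μ)
      (∫ x in K, deriv (fun s => D s x) t ∂μ) t := by
  set D' : ℝ → S → ℝ := fun t x => deriv (fun s => D s x) t with hD'
  have h' : ∀ x, SmoothDensityAt n D' x := fun x => (h x).deriv
  have c0 : Continuous (fun x => D' 0 x) := continuous_iff_continuousAt.2 fun x =>
    ContinuousAt.comp (g := fun r : ℝ × S => D' r.1 r.2) (f := fun x => (0, x)) (x := x)
      (h' x).eventually_continuousAt.self_of_nhds (by fun_prop)
  -- Each condition holds near every `(0, x)`, and compactness of `K` makes the time interval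
  -- uniform. The dominating function `‖D' 0 x‖ + 1` comes from continuity of `D'` at `(0, x)`.
  have ev : ∀ᶠ t in 𝓝 (0 : ℝ), ∀ x ∈ K, HasDerivAt (fun s => D s x) (D' t x) t ∧
      ContinuousAt (fun r : ℝ × S => D r.1 r.2) (t, x) ∧
      ContinuousAt (fun r : ℝ × S => D' r.1 r.2) (t, x) ∧ ‖D' t x‖ ≤ ‖D' 0 x‖ + 1 := by
    refine hK.eventually_forall_of_forall_eventually fun x _ => ?_
    have b : ∀ᶠ r : ℝ × S in 𝓝 (0, x), ‖D' r.1 r.2‖ - ‖D' 0 r.2‖ < 1 := by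
      have : ContinuousAt (fun r : ℝ × S => ‖D' r.1 r.2‖ - ‖D' 0 r.2‖) (0, x) :=
        (h' x).eventually_continuousAt.self_of_nhds.norm.sub
          (c0.comp continuous_snd).norm.continuousAt
      exact this.eventually (gt_mem_nhds (by simp))
    filter_upwards [(h x).eventually_hasDerivAt, (h x).eventually_continuousAt,
      (h' x).eventually_continuousAt, b] with r h1 h2 h3 h4
    exact ⟨h1, h2, h3, by linarith⟩
  have slice : ∀ {A : ℝ → S → ℝ} {t : ℝ}, (∀ x ∈ K, ContinuousAt (fun r : ℝ × S => A r.1 r.2) (t, x)) →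
      ContinuousOn (A t) K := fun {A t} hA x hx =>
    (ContinuousAt.comp (g := fun r : ℝ × S => A r.1 r.2) (f := fun x => (t, x)) (x := x)
      (hA x hx) (by fun_prop)).continuousWithinAt
  have hKm : MeasurableSet K := hK.isClosed.measurableSet
  filter_upwards [ev.eventually_nhds] with t ht
  refine (hasDerivAt_integral_of_dominated_loc_of_deriv_le (μ := μ.restrict K) (F := D) (F' := D')
    (x₀ := t) (bound := fun x => ‖D' 0 x‖ + 1) ht
    ?_ ?_ ?_ ?_ ?_ ?_).2
  · filter_upwards [ht] with s hs
    exact (slice (A := D) fun x hx => (hs x hx).2.1).aestronglyMeasurable hKm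
  · exact (slice (A := D) fun x hx => (ht.self_of_nhds x hx).2.1).integrableOn_compact hK
  · exact (slice (A := D') fun x hx => (ht.self_of_nhds x hx).2.2.1).aestronglyMeasurable hKm
  · exact (ae_restrict_mem hKm).mono fun x hx s hs => (hs x hx).2.2.2
  · exact (c0.norm.add continuous_const).continuousOn.integrableOn_compact hK
  · exact (ae_restrict_mem hKm).mono fun x hx s hs => (hs x hx).1

end Integration

/-! ### The area density of a family -/

section Density

open MeasureTheory Set

variable {n : ℕ}
  {M : Type*} [TopologicalSpace M] [ChartedSpace (EuclideanSpace ℝ (Fin (n + 1))) M]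
  [IsManifold (𝓡 (n + 1)) ∞ M]
  {S : Type*} [TopologicalSpace S] [ChartedSpace (EuclideanSpace ℝ (Fin n)) S]
  [IsManifold (𝓡 n) ∞ S]

lemma continuousOn_det_metricMatrix (g : Metric (n + 1) M) {F : S → M}
    (hF : ContMDiff (𝓡 n) (𝓡 (n + 1)) ∞ F) (p : S) :
    ContinuousOn (fun y => (metricMatrix (inducedForm g F) p y).det) (extChartAt (𝓡 n) p).target := by
  intro y hy
  refine ContinuousAt.continuousWithinAt ?_
  set q := F ((extChartAt (𝓡 n) p).symm y) with hq
  have hγ : ContDiffAt ℝ ∞ (famRep (fun _ => F) p q) ((0 : ℝ), y) :=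
    contDiffAt_famRep hy (smoothFamilyAt_const (hF _) 0) (mem_extChartAt_source q)
  have hz : famRep (fun _ => F) p q ((0 : ℝ), y) ∈ (extChartAt (𝓡 (n + 1)) q).target :=
    mem_extChartAt_target q
  have h1 : ContinuousAt (fun y => (gram (chartMetric g q) (famRep (fun _ => F) p q) (dirs n)
      ((0 : ℝ), y)).det) y :=
    ContinuousAt.comp (f := fun y => ((0 : ℝ), y)) (x := y) (contDiffAt_det fun i j =>
      contDiffAt_gram (contDiffAt_chartMetric g hz) hγ (dirs n) i j).continuousAt (by fun_prop)
  refine h1.congr ?_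
  have hs : ∀ᶠ y' in 𝓝 y, F ((extChartAt (𝓡 n) p).symm y') ∈ (extChartAt (𝓡 (n + 1)) q).source :=
    (ContinuousAt.comp (g := F) (x := y) hF.continuous.continuousAt
      (contMDiffAt_chart_symm hy).continuousAt).eventually
      ((isOpen_source q).mem_nhds (mem_extChartAt_source q))
  filter_upwards [(isOpen_target p).mem_nhds hy, hs] with y' h2 h3
  rw [← metricMatrix_eq_gram g (F := fun _ => F) h2 (smoothFamilyAt_const (hF _) 0) h3]

/-- The area density of `φ'` relative to `φ`. -/
def jacobian (g : Metric (n + 1) M) (φ φ' : S → M) (x : S) : ℝ :=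
  √((firstFF g φ' x).det / (firstFF g φ x).det)

/-- Under a change of chart both determinants acquire the same squared Jacobian. The definition uses
the chart centred at `x`, which moves with `x`; this lemma fixes one chart, as continuity and
smoothness require. -/
lemma jacobian_chart (g : Metric (n + 1) M) {φ φ' : S → M} {p : S} {y : EuclideanSpace ℝ (Fin n)}
    (hy : y ∈ (extChartAt (𝓡 n) p).target)
    (hφ : Function.Injective (mfderiv (𝓡 n) (𝓡 (n + 1)) φ ((extChartAt (𝓡 n) p).symm y))) :
    jacobian g φ φ' ((extChartAt (𝓡 n) p).symm y)
      = √((metricMatrix (inducedForm g φ') p y).det / (metricMatrix (inducedForm g φ) p y).det) := by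
  have hs := mem_extChartAt_source (I := 𝓡 n) ((extChartAt (𝓡 n) p).symm y)
  have h1 := det_metricMatrix_transition (isBilinear_inducedForm g φ) hy hs
  have h2 := det_metricMatrix_transition (isBilinear_inducedForm g φ') hy hs
  have hJ := left_ne_zero_of_mul (h1 ▸ (det_metricMatrix_pos g hy hφ).ne')
  rw [jacobian, h1, h2, mul_div_mul_left _ _ hJ]
  rfl

lemma continuous_jacobian (g : Metric (n + 1) M) {φ φ' : S → M} (hφ : IsImmersedHypersurface n φ)
    (hφ' : ContMDiff (𝓡 n) (𝓡 (n + 1)) ∞ φ') : Continuous (jacobian g φ φ') := by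
  refine continuous_iff_continuousAt.2 fun x => ?_
  have ht := mem_extChartAt_target (I := 𝓡 n) x
  have c : ∀ {F : S → M}, ContMDiff (𝓡 n) (𝓡 (n + 1)) ∞ F → ContinuousAt
      (fun x' => (metricMatrix (inducedForm g F) x (extChartAt (𝓡 n) x x')).det) x := fun {F} hF =>
    ContinuousAt.comp (g := fun y => (metricMatrix (inducedForm g F) x y).det)
      ((continuousOn_det_metricMatrix g hF x).continuousAt ((isOpen_target x).mem_nhds ht))
      (continuousAt_extChartAt x)
  refine (((c hφ').div (c hφ.smooth) (det_metricMatrix_pos g ht (hφ.injective _)).ne').sqrt).congr ?_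
  filter_upwards [extChartAt_source_mem_nhds (I := 𝓡 n) x] with x' hx'
  have := jacobian_chart g (φ' := φ') ((extChartAt (𝓡 n) x).map_source hx') (hφ.injective _)
  rw [(extChartAt (𝓡 n) x).left_inv hx'] at this
  exact this.symm

lemma isLocallyFiniteMeasure_areaMeasure [T2Space S] [SecondCountableTopology S] [MeasurableSpace S]
    [BorelSpace S] (g : Metric (n + 1) M) {φ : S → M} (hφ : IsImmersedHypersurface n φ) :
    IsLocallyFiniteMeasure (areaMeasure g φ) :=
  isLocallyFiniteMeasure_volumeMeasure (isBilinear_inducedForm g φ)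
    (continuousOn_det_metricMatrix g hφ.smooth)

lemma isOpenPosMeasure_areaMeasure [SecondCountableTopology S] [MeasurableSpace S]
    [BorelSpace S] (g : Metric (n + 1) M) {φ : S → M} (hφ : IsImmersedHypersurface n φ) :
    (areaMeasure g φ).IsOpenPosMeasure :=
  isOpenPosMeasure_volumeMeasure (isBilinear_inducedForm g φ)
    (continuousOn_det_metricMatrix g hφ.smooth)
    (fun _ _ hy => det_metricMatrix_pos g hy (hφ.injective _))

lemma areaMeasure_eq_withDensity [SecondCountableTopology S] [MeasurableSpace S]
    [BorelSpace S] (g : Metric (n + 1) M) {φ φ' : S → M} (hφ : IsImmersedHypersurface n φ)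
    (hφ' : ContMDiff (𝓡 n) (𝓡 (n + 1)) ∞ φ') :
    areaMeasure g φ' = (areaMeasure g φ).withDensity fun x => ENNReal.ofReal (jacobian g φ φ' x) := by
  refine volumeMeasure_eq_withDensity (isBilinear_inducedForm g φ) (isBilinear_inducedForm g φ')
    (continuousOn_det_metricMatrix g hφ.smooth) (continuous_jacobian g hφ hφ')
    (fun _ => Real.sqrt_nonneg _) fun p y hy => ?_
  have hp := det_metricMatrix_pos g hy (hφ.injective _)
  rw [jacobian_chart g hy (hφ.injective _), ← Real.sqrt_mul' _ hp.le, div_mul_cancel₀ _ hp.ne']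

/-- The weighted area density of the family `F`, relative to the area measure at time `0`. -/
def weightedDensity (g : Metric (n + 1) M) (f : M → ℝ) (F : ℝ → S → M) (t : ℝ) (x : S) : ℝ :=
  Real.exp (-f (F t x)) * jacobian g (F 0) (F t) x

/-- The measure no longer depends on `t`; all time dependence is in the integrand. -/
lemma weightedArea_eq [SecondCountableTopology S] [T2Space S] [MeasurableSpace S]
    [BorelSpace S] (g : Metric (n + 1) M) (f : M → ℝ) {F : ℝ → S → M} {t : ℝ}
    (h0 : IsImmersedHypersurface n (F 0)) (ht : ContMDiff (𝓡 n) (𝓡 (n + 1)) ∞ (F t))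
    {K : Set S} (hK : IsCompact K) :
    weightedArea g f (F t) K = ∫ x in K, weightedDensity g f F t x ∂(areaMeasure g (F 0)) := by
  rw [weightedArea, areaMeasure_eq_withDensity g h0 ht,
    setIntegral_withDensity_eq_setIntegral_toReal_smul
      (continuous_jacobian g h0 ht).measurable.ennreal_ofReal
      (Filter.Eventually.of_forall fun _ => ENNReal.ofReal_lt_top) _ hK.isClosed.measurableSet]
  refine integral_congr_ae (Filter.Eventually.of_forall fun x => ?_)
  simp only [weightedDensity, smul_eq_mul]
  rw [ENNReal.toReal_ofReal (show 0 ≤ jacobian g (F 0) (F t) x from Real.sqrt_nonneg _), mul_comm]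

/-- A function on `M` read in the chart at `q`. -/
def funRep (f : M → ℝ) (q : M) (z : EuclideanSpace ℝ (Fin (n + 1))) : ℝ :=
  f ((extChartAt (𝓡 (n + 1)) q).symm z)

lemma contDiffAt_funRep {f : M → ℝ} (hf : ContMDiff (𝓡 (n + 1)) 𝓘(ℝ, ℝ) ∞ f) {q : M}
    {z : EuclideanSpace ℝ (Fin (n + 1))} (hz : z ∈ (extChartAt (𝓡 (n + 1)) q).target) :
    ContDiffAt ℝ ∞ (funRep f q) z :=
  (ContMDiffAt.comp (g := f) z (hf _) (contMDiffAt_chart_symm hz)).contDiffAt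

/-- Bridge from the intrinsic density to the coordinate one, whose first and second derivatives are
known. -/
lemma weightedDensity_eq_density (g : Metric (n + 1) M) (f : M → ℝ) {F : ℝ → S → M} {t : ℝ}
    {p : S} {q : M} {y : EuclideanSpace ℝ (Fin n)} (hy : y ∈ (extChartAt (𝓡 n) p).target)
    (h0 : SmoothFamilyAt n F 0 ((extChartAt (𝓡 n) p).symm y))
    (ht : SmoothFamilyAt n F t ((extChartAt (𝓡 n) p).symm y))
    (hi : Function.Injective (mfderiv (𝓡 n) (𝓡 (n + 1)) (F 0) ((extChartAt (𝓡 n) p).symm y)))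
    (hq0 : F 0 ((extChartAt (𝓡 n) p).symm y) ∈ (extChartAt (𝓡 (n + 1)) q).source)
    (hqt : F t ((extChartAt (𝓡 n) p).symm y) ∈ (extChartAt (𝓡 (n + 1)) q).source) :
    weightedDensity g f F t ((extChartAt (𝓡 n) p).symm y)
      = density (chartMetric g q) (funRep f q) (famRep F p q) (dirs n) (tdir n) (0, y) t := by
  have e : ((0 : ℝ), y) + t • tdir n = (t, y) := by simp [tdir]
  rw [weightedDensity, jacobian_chart g hy hi, metricMatrix_eq_gram g hy ht hqt,
    metricMatrix_eq_gram g hy h0 hq0, density, e]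
  congr 3
  exact congrArg f ((extChartAt (𝓡 (n + 1)) q).left_inv hqt).symm

lemma tendsto_prod_chart_symm {p : S} {y : EuclideanSpace ℝ (Fin n)} (t : ℝ)
    (hy : y ∈ (extChartAt (𝓡 n) p).target) :
    Filter.Tendsto (fun r : ℝ × EuclideanSpace ℝ (Fin n) => (r.1, (extChartAt (𝓡 n) p).symm r.2))
      (𝓝 (t, y)) (𝓝 (t, (extChartAt (𝓡 n) p).symm y)) :=
  (contMDiffAt_prod_chart_symm hy).continuousAt

lemma smoothDensityAt_weightedDensity (g : Metric (n + 1) M) {f : M → ℝ}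
    (hf : ContMDiff (𝓡 (n + 1)) 𝓘(ℝ, ℝ) ∞ f) {F : ℝ → S → M}
    (hi : ∀ x, Function.Injective (mfderiv (𝓡 n) (𝓡 (n + 1)) (F 0) x)) {x : S}
    (h0 : ∀ x, SmoothFamilyAt n F 0 x)
    (h : ∀ᶠ r : ℝ × S in 𝓝 (0, x), SmoothFamilyAt n F r.1 r.2) :
    SmoothDensityAt n (weightedDensity g f F) x := by
  set q := F 0 x with hq
  have ht := mem_extChartAt_target (I := 𝓡 n) x
  set y₀ := extChartAt (𝓡 n) x x with hy₀
  have hx : (extChartAt (𝓡 n) x).symm y₀ = x := extChartAt_to_inv x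
  have htend := tendsto_prod_chart_symm 0 ht
  rw [hx] at htend
  have hqs : ∀ᶠ r : ℝ × S in 𝓝 (0, x), F r.1 r.2 ∈ (extChartAt (𝓡 (n + 1)) q).source :=
    (h0 x).continuousAt.eventually ((isOpen_source q).mem_nhds (mem_extChartAt_source q))
  have hqs0 : ∀ᶠ r : ℝ × S in 𝓝 (0, x), F 0 r.2 ∈ (extChartAt (𝓡 (n + 1)) q).source := by
    have : Filter.Tendsto (fun r : ℝ × S => ((0 : ℝ), r.2)) (𝓝 (0, x)) (𝓝 (0, x)) :=
      (by fun_prop : Continuous fun r : ℝ × S => ((0 : ℝ), r.2)).tendsto _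
    exact this.eventually hqs
  have hγ : ContDiffAt ℝ ∞ (famRep F x q) (0, y₀) :=
    contDiffAt_famRep ht (by rw [hx]; exact h0 x) (by rw [hx]; exact mem_extChartAt_source q)
  have hγ0 : famRep F x q (0, y₀) ∈ (extChartAt (𝓡 (n + 1)) q).target := by
    rw [famRep, hx]; exact mem_extChartAt_target q
  have hdet : ContDiffAt ℝ ∞ (fun r => (gram (chartMetric g q) (famRep F x q) (dirs n) r).det)
      (0, y₀) := contDiffAt_det fun i j =>
        contDiffAt_gram (contDiffAt_chartMetric g hγ0) hγ (dirs n) i j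
  have hpos : 0 < (gram (chartMetric g q) (famRep F x q) (dirs n) (0, y₀)).det := by
    rw [← metricMatrix_eq_gram g ht (by rw [hx]; exact h0 x)
      (by rw [hx]; exact mem_extChartAt_source q)]
    exact det_metricMatrix_pos g ht (hi _)
  have hdet0 : ContDiffAt ℝ ∞ (fun r : ℝ × EuclideanSpace ℝ (Fin n) =>
      (gram (chartMetric g q) (famRep F x q) (dirs n) (0, r.2)).det) (0, y₀) :=
    ContDiffAt.comp (f := fun r : ℝ × EuclideanSpace ℝ (Fin n) => ((0 : ℝ), r.2)) (0, y₀) hdet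
      (contDiffAt_const.prodMk contDiffAt_snd)
  have hfr : ContDiffAt ℝ ∞ (fun r => funRep f q (famRep F x q r)) (0, y₀) :=
    ContDiffAt.comp (g := funRep f q) (0, y₀) (contDiffAt_funRep hf hγ0) hγ
  -- The quotient and the square root are smooth because the Gram determinant is positive at the
  -- base point.
  have key : ContDiffAt ℝ ∞ (fun r : ℝ × EuclideanSpace ℝ (Fin n) =>
      Real.exp (-funRep f q (famRep F x q r)) *
        √((gram (chartMetric g q) (famRep F x q) (dirs n) r).det /
          (gram (chartMetric g q) (famRep F x q) (dirs n) (0, r.2)).det)) (0, y₀) :=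
    hfr.neg.exp.mul ((hdet.div hdet0 hpos.ne').sqrt (div_pos hpos hpos).ne')
  refine key.congr_of_eventuallyEq ?_
  have htar : ∀ᶠ r : ℝ × EuclideanSpace ℝ (Fin n) in 𝓝 (0, y₀), r.2 ∈ (extChartAt (𝓡 n) x).target :=
    (continuous_snd.tendsto ((0 : ℝ), y₀)).eventually ((isOpen_target x).mem_nhds ht)
  filter_upwards [htar, htend.eventually h, htend.eventually hqs, htend.eventually hqs0]
    with r h1 h2 h3 h4
  rw [weightedDensity_eq_density g f h1 (h0 _) h2 (hi _) h4 h3]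
  have e : ((0 : ℝ), r.2) + r.1 • tdir n = r := by ext <;> simp [tdir]
  rw [density, e]

end Density

/-! ### Velocities and existence of variations -/

section Velocity

variable {n : ℕ}
  {M : Type*} [TopologicalSpace M] [ChartedSpace (EuclideanSpace ℝ (Fin (n + 1))) M]
  [IsManifold (𝓡 (n + 1)) ∞ M]
  {S : Type*} [TopologicalSpace S] [ChartedSpace (EuclideanSpace ℝ (Fin n)) S]
  [IsManifold (𝓡 n) ∞ S]

/-- The initial velocity of the family `F`. -/
def velocity (n : ℕ) {M : Type*} [TopologicalSpace M]
    [ChartedSpace (EuclideanSpace ℝ (Fin (n + 1))) M] {S : Type*} (F : ℝ → S → M) (x : S) :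
    EuclideanSpace ℝ (Fin (n + 1)) :=
  mfderiv 𝓘(ℝ, ℝ) (𝓡 (n + 1)) (fun t => F t x) 0 (1 : ℝ)

/-- Once the base maps are identified, equality in the tangent bundle is equality of vectors in a
fibre. -/
lemma hasInitialVelocity_iff {φ : S → M} {F : ℝ → S → M} (h0 : F 0 = φ)
    (V : S → EuclideanSpace ℝ (Fin (n + 1))) :
    HasInitialVelocity φ F V ↔ ∀ x, velocity n F x = V x := by
  subst h0
  refine forall_congr' fun x => ⟨fun h => ?_, fun h => ?_⟩
  · exact eq_of_heq (Bundle.TotalSpace.mk.inj h).2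
  · exact congrArg (fun v : EuclideanSpace ℝ (Fin (n + 1)) =>
      (⟨F 0 x, v⟩ : TangentBundle (𝓡 (n + 1)) M)) h

lemma chartD_injective {d : ℕ} {X : Type*} [TopologicalSpace X]
    [ChartedSpace (EuclideanSpace ℝ (Fin d)) X] [IsManifold (𝓡 d) ∞ X] {q x : X}
    (hx : x ∈ (extChartAt (𝓡 d) q).source) : Function.Injective (chartD (d := d) q x) :=
  fun v w h => by rw [← chartDSymm_chartD hx v, h, chartDSymm_chartD hx]

lemma hasDerivAt_chart_velocity {F : ℝ → S → M} {x : S} (hF : SmoothFamilyAt n F 0 x) {q : M}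
    (hq : F 0 x ∈ (extChartAt (𝓡 (n + 1)) q).source) :
    HasDerivAt (fun t => extChartAt (𝓡 (n + 1)) q (F t x)) (chartD q (F 0 x) (velocity n F x)) 0 := by
  have h1 := hF.contMDiffAt_time
  have h2 : ContDiffAt ℝ ∞ (fun t => extChartAt (𝓡 (n + 1)) q (F t x)) 0 :=
    (ContMDiffAt.comp (0 : ℝ) (contMDiffAt_chart hq) h1).contDiffAt
  have h3 := chartD_fderiv (h1.mdifferentiableAt (by simp)) hq (1 : ℝ)
  exact (h2.differentiableAt (by simp)).hasDerivAt.congr_deriv h3.symm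

/-- A family of maps which is smooth near time zero and fixed off a compact set. -/
structure IsLocalVariation (n : ℕ)
    {M : Type*} [TopologicalSpace M] [ChartedSpace (EuclideanSpace ℝ (Fin (n + 1))) M]
    {S : Type*} [TopologicalSpace S] [ChartedSpace (EuclideanSpace ℝ (Fin n)) S]
    (φ : S → M) (F : ℝ → S → M) (K : Set S) : Prop where
  zero : F 0 = φ
  compact : IsCompact K
  smooth : ∀ x, ∀ᶠ r : ℝ × S in 𝓝 (0, x), SmoothFamilyAt n F r.1 r.2
  fixed : ∀ t, ∀ x ∉ K, F t x = φ x

lemma IsLocalVariation.smoothAt {φ : S → M} {F : ℝ → S → M} {K : Set S}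
    (h : IsLocalVariation n φ F K) (x : S) : SmoothFamilyAt n F 0 x := (h.smooth x).self_of_nhds

lemma isLocalVariation_const {φ : S → M} (hφ : ContMDiff (𝓡 n) (𝓡 (n + 1)) ∞ φ) :
    IsLocalVariation n φ (fun _ => φ) ∅ where
  zero := rfl
  compact := isCompact_empty
  smooth _ := Filter.Eventually.of_forall fun r => smoothFamilyAt_const (hφ r.2) r.1
  fixed _ _ _ := rfl

lemma velocity_const (φ : S → M) (x : S) : velocity n (fun _ : ℝ => φ) x = 0 :=
  congrArg (fun L : ℝ →L[ℝ] EuclideanSpace ℝ (Fin (n + 1)) => L 1)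
    (mfderiv_const (I := 𝓘(ℝ, ℝ)) (I' := 𝓡 (n + 1)) (x := (0 : ℝ)) (c := φ x))

open Classical in
/-- Adding a vector field, supported in the domain of a chart, to the velocity of a family. -/
def pushFamily (F : ℝ → S → M) (q : M) (K : Set S) (v : S → EuclideanSpace ℝ (Fin (n + 1)))
    (t : ℝ) (x : S) : M :=
  if x ∈ K then (extChartAt (𝓡 (n + 1)) q).symm (extChartAt (𝓡 (n + 1)) q (F t x) + t • v x)
  else F t x

/-- In the chart at `q` the family is translated by `t v`, so its velocity there increases by `v`.
Cutting off at `K` does no harm since `v` vanishes outside `K`. -/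
lemma IsLocalVariation.push [T2Space S] {φ : S → M} {F : ℝ → S → M} {C : Set S}
    (h : IsLocalVariation n φ F C) {q : M} {K : Set S} (hK : IsCompact K)
    (hKq : ∀ x ∈ K, φ x ∈ (extChartAt (𝓡 (n + 1)) q).source)
    {v : S → EuclideanSpace ℝ (Fin (n + 1))} (hv0 : ∀ x ∉ K, v x = 0)
    (hv : ∀ x, φ x ∈ (extChartAt (𝓡 (n + 1)) q).source →
      ContMDiffAt (𝓡 n) 𝓘(ℝ, EuclideanSpace ℝ (Fin (n + 1))) ∞ v x) :
    IsLocalVariation n φ (pushFamily F q K v) (C ∪ K) ∧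
    (∀ x ∉ K, velocity n (pushFamily F q K v) x = velocity n F x) ∧
    ∀ x ∈ K, chartD q (φ x) (velocity n (pushFamily F q K v) x)
      = chartD q (φ x) (velocity n F x) + v x := by
  have hz : pushFamily F q K v 0 = φ := by
    ext x
    by_cases hx : x ∈ K
    · simp only [pushFamily, if_pos hx, zero_smul, add_zero, h.zero]
      exact (extChartAt (𝓡 (n + 1)) q).left_inv (hKq x hx)
    · simp only [pushFamily, if_neg hx, h.zero]
  have near : ∀ x ∈ K, ∀ᶠ r : ℝ × S in 𝓝 (0, x), F r.1 r.2 ∈ (extChartAt (𝓡 (n + 1)) q).source ∧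
      extChartAt (𝓡 (n + 1)) q (F r.1 r.2) + r.1 • v r.2 ∈ (extChartAt (𝓡 (n + 1)) q).target ∧
      φ r.2 ∈ (extChartAt (𝓡 (n + 1)) q).source ∧ SmoothFamilyAt n F r.1 r.2 := by
    intro x hx
    have hq0 : F 0 x ∈ (extChartAt (𝓡 (n + 1)) q).source := by rw [h.zero]; exact hKq x hx
    have c1 : ContinuousAt (fun r : ℝ × S => F r.1 r.2) (0, x) := (h.smoothAt x).continuousAt
    have cψ : ContinuousAt (fun r : ℝ × S => extChartAt (𝓡 (n + 1)) q (F r.1 r.2)) (0, x) :=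
      ContinuousAt.comp (f := fun r : ℝ × S => F r.1 r.2) (x := ((0 : ℝ), x))
        (contMDiffAt_chart hq0).continuousAt c1
    have cv : ContinuousAt (fun r : ℝ × S => v r.2) (0, x) :=
      ContinuousAt.comp (f := Prod.snd) (x := ((0 : ℝ), x)) (hv x (hKq x hx)).continuousAt
        continuousAt_snd
    have c2 := cψ.add (continuousAt_fst.smul cv)
    have c3 : ContinuousAt (fun r : ℝ × S => φ r.2) (0, x) := by
      rw [← h.zero]
      exact ContinuousAt.comp (f := Prod.snd) (x := ((0 : ℝ), x))
        (h.smoothAt x).contMDiffAt.continuousAt continuousAt_snd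
    refine (c1.eventually ((isOpen_source q).mem_nhds hq0)).and
      ((c2.eventually ((isOpen_target q).mem_nhds ?_)).and
      ((c3.eventually ((isOpen_source q).mem_nhds (hKq x hx))).and (h.smooth x)))
    simpa using (extChartAt (𝓡 (n + 1)) q).map_source hq0
  -- Both branches of the definition agree wherever `F` lies in the chart domain, so near points of
  -- `K` the new family is given by a single smooth formula.
  have eqn : ∀ r : ℝ × S, F r.1 r.2 ∈ (extChartAt (𝓡 (n + 1)) q).source →
      pushFamily F q K v r.1 r.2 = (extChartAt (𝓡 (n + 1)) q).symm
        (extChartAt (𝓡 (n + 1)) q (F r.1 r.2) + r.1 • v r.2) := by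
    intro r hr
    by_cases hx : r.2 ∈ K
    · simp only [pushFamily, if_pos hx]
    · simp only [pushFamily, if_neg hx, hv0 _ hx, smul_zero, add_zero]
      exact ((extChartAt (𝓡 (n + 1)) q).left_inv hr).symm
  have off : ∀ x ∉ K, ∀ᶠ r : ℝ × S in 𝓝 (0, x), pushFamily F q K v r.1 r.2 = F r.1 r.2 := by
    intro x hx
    filter_upwards [(continuous_snd.tendsto ((0 : ℝ), x)).eventually
      (hK.isClosed.isOpen_compl.mem_nhds hx)] with r hr
    simp only [pushFamily, if_neg hr]
  have hloc : IsLocalVariation n φ (pushFamily F q K v) (C ∪ K) := by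
    refine ⟨hz, h.compact.union hK, fun x => ?_, fun t x hx => ?_⟩
    · by_cases hx : x ∈ K
      · filter_upwards [(near x hx).eventually_nhds] with r hr
        obtain ⟨h1, h2, h3, h4⟩ := hr.self_of_nhds
        have s1 : ContMDiffAt (𝓘(ℝ, ℝ).prod (𝓡 n)) 𝓘(ℝ, EuclideanSpace ℝ (Fin (n + 1))) ∞
            (fun r : ℝ × S => extChartAt (𝓡 (n + 1)) q (F r.1 r.2)) r :=
          ContMDiffAt.comp (f := fun r : ℝ × S => F r.1 r.2) r (contMDiffAt_chart h1) h4
        have s2 : ContMDiffAt (𝓘(ℝ, ℝ).prod (𝓡 n)) 𝓘(ℝ, EuclideanSpace ℝ (Fin (n + 1))) ∞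
            (fun r : ℝ × S => v r.2) r :=
          ContMDiffAt.comp (f := Prod.snd) r (hv r.2 h3) contMDiffAt_snd
        have s3 := s1.add ((contMDiffAt_fst (I := 𝓘(ℝ, ℝ)) (J := 𝓡 n) (p := r)).smul s2)
        have s4 := ContMDiffAt.comp (g := (extChartAt (𝓡 (n + 1)) q).symm) r
          (contMDiffAt_chart_symm h2) s3
        exact s4.congr_of_eventuallyEq (hr.mono fun r' hr' => eqn r' hr'.1)
      · filter_upwards [(off x hx).eventually_nhds, h.smooth x] with r h1 h2
        exact ContMDiffAt.congr_of_eventuallyEq h2 h1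
    · simp only [pushFamily, if_neg fun h => hx (Or.inr h)]
      exact h.fixed t x fun h => hx (Or.inl h)
  refine ⟨hloc, fun x hx => ?_, fun x hx => ?_⟩
  · have : (fun t => pushFamily F q K v t x) = fun t => F t x := by
      ext t; simp only [pushFamily, if_neg hx]
    rw [velocity, this]; rfl
  · have hq0 : F 0 x ∈ (extChartAt (𝓡 (n + 1)) q).source := by rw [h.zero]; exact hKq x hx
    have hq1 : pushFamily F q K v 0 x ∈ (extChartAt (𝓡 (n + 1)) q).source := by
      rw [hz]; exact hKq x hx
    have d1 := hasDerivAt_chart_velocity (hloc.smoothAt x) hq1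
    have d2 := (hasDerivAt_chart_velocity (h.smoothAt x) hq0).add
      ((hasDerivAt_id (0 : ℝ)).smul_const (v x))
    rw [hz] at d1
    rw [h.zero, one_smul] at d2
    refine d1.unique (d2.congr_of_eventuallyEq ?_)
    have tl : Filter.Tendsto (fun t : ℝ => (t, x)) (𝓝 0) (𝓝 (0, x)) :=
      (by fun_prop : Continuous fun t : ℝ => (t, x)).tendsto 0
    filter_upwards [tl.eventually (near x hx)] with t ht
    rw [eqn (t, x) ht.1, (extChartAt (𝓡 (n + 1)) q).right_inv ht.2.1]
    rfl

end Velocity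

/-! ### Variations with prescribed velocity -/

section Existence

variable {n : ℕ}
  {M : Type*} [TopologicalSpace M] [ChartedSpace (EuclideanSpace ℝ (Fin (n + 1))) M]
  [IsManifold (𝓡 (n + 1)) ∞ M]
  {S : Type*} [TopologicalSpace S] [ChartedSpace (EuclideanSpace ℝ (Fin n)) S]
  [IsManifold (𝓡 n) ∞ S]

/-- `V` is a smooth vector field along `φ`. -/
def IsSmoothAlong (φ : S → M) (V : S → EuclideanSpace ℝ (Fin (n + 1))) : Prop :=
  ∀ x q, φ x ∈ (extChartAt (𝓡 (n + 1)) q).source →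
    ContMDiffAt (𝓡 n) 𝓘(ℝ, EuclideanSpace ℝ (Fin (n + 1))) ∞ (fun x => chartD q (φ x) (V x)) x

/-- A partition of unity subordinate to preimages of chart domains splits `V` into pieces, each of
which can be added to the velocity in its own chart by `push`. Only finitely many pieces meet the
compact support of `V`. Using translations in charts avoids the exponential map. -/
lemma exists_localVariation [T2Space S] [SecondCountableTopology S] {φ : S → M}
    (hφ : ContMDiff (𝓡 n) (𝓡 (n + 1)) ∞ φ) {V : S → EuclideanSpace ℝ (Fin (n + 1))}
    (hV : IsSmoothAlong φ V) (hc : HasCompactSupport V) :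
    ∃ F C, IsLocalVariation n φ F C ∧ ∀ x, velocity n F x = V x := by
  have : LocallyCompactSpace S := ChartedSpace.locallyCompactSpace (EuclideanSpace ℝ (Fin n)) S
  have : SigmaCompactSpace S := sigmaCompactSpace_of_locallyCompact_secondCountable
  obtain ⟨ρ, hρ⟩ := SmoothPartitionOfUnity.exists_isSubordinate (𝓡 n)
    (s := tsupport V) (isClosed_tsupport V) (fun x : S => φ ⁻¹' (extChartAt (𝓡 (n + 1)) (φ x)).source)
    (fun x => (isOpen_source _).preimage hφ.continuous)
    (fun x _ => Set.mem_iUnion.2 ⟨x, mem_extChartAt_source (φ x)⟩)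
  have step : ∀ s : Finset S, ∃ F C, IsLocalVariation n φ F C ∧
      ∀ x, velocity n F x = (∑ i ∈ s, ρ i x) • V x := by
    intro s
    classical
    induction s using Finset.induction_on with
    | empty => exact ⟨_, _, isLocalVariation_const hφ, fun x => by simp [velocity_const]⟩
    | insert i s hi ih =>
      obtain ⟨F, C, hF, hFV⟩ := ih
      have hK : IsCompact (tsupport V ∩ tsupport (ρ i)) :=
        IsCompact.inter_right hc (isClosed_tsupport _)
      have hKq : ∀ x ∈ tsupport V ∩ tsupport (ρ i),
          φ x ∈ (extChartAt (𝓡 (n + 1)) (φ i)).source := fun x hx => hρ i hx.2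
      have h0 : ∀ x ∉ tsupport V ∩ tsupport (ρ i), ρ i x • V x = 0 := by
        intro x hx
        by_cases h1 : x ∈ tsupport V
        · rw [image_eq_zero_of_notMem_tsupport fun h2 => hx ⟨h1, h2⟩, zero_smul]
        · rw [image_eq_zero_of_notMem_tsupport h1, smul_zero]
      obtain ⟨h1, h2, h3⟩ := hF.push hK hKq
        (v := fun x => chartD (φ i) (φ x) (ρ i x • V x))
        (fun x hx => by rw [h0 x hx, map_zero]) (fun x hx => by
          simp only [map_smul]
          exact (ρ i).contMDiff.contMDiffAt.smul (hV x _ hx))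
      refine ⟨_, _, h1, fun x => ?_⟩
      rw [Finset.sum_insert hi, add_smul, add_comm (ρ i x • V x), ← hFV x]
      by_cases hx : x ∈ tsupport V ∩ tsupport (ρ i)
      · refine chartD_injective (hKq x hx) ?_
        rw [h3 x hx, map_add]
      · rw [h2 x hx, h0 x hx, add_zero]
  have hfin : {i | (Function.support (ρ i) ∩ tsupport V).Nonempty}.Finite :=
    ρ.locallyFinite.finite_nonempty_inter_compact hc
  obtain ⟨F, C, hF, hFV⟩ := step hfin.toFinset
  refine ⟨F, C, hF, fun x => ?_⟩
  rw [hFV x]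
  by_cases hx : x ∈ tsupport V
  · have h1 := ρ.sum_eq_one hx
    rw [finsum_eq_sum_of_support_subset (s := hfin.toFinset)] at h1
    · rw [h1, one_smul]
    · intro i hi
      exact hfin.mem_toFinset.2 ⟨x, hi, hx⟩
  · rw [image_eq_zero_of_notMem_tsupport hx, smul_zero]

/-- The Gram determinant in fixed charts is continuous in `(t, y)` and positive at the base point,
hence positive nearby. -/
lemma eventually_injective_mfderiv (g : Metric (n + 1) M) {F : ℝ → S → M} {x : S}
    (h : ∀ᶠ r : ℝ × S in 𝓝 (0, x), SmoothFamilyAt n F r.1 r.2)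
    (hi : Function.Injective (mfderiv (𝓡 n) (𝓡 (n + 1)) (F 0) x)) :
    ∀ᶠ r : ℝ × S in 𝓝 (0, x), Function.Injective (mfderiv (𝓡 n) (𝓡 (n + 1)) (F r.1) r.2) := by
  set q := F 0 x with hq
  have ht := mem_extChartAt_target (I := 𝓡 n) x
  set y₀ := extChartAt (𝓡 n) x x with hy₀
  have hx : (extChartAt (𝓡 n) x).symm y₀ = x := extChartAt_to_inv x
  have h0 : SmoothFamilyAt n F 0 x := h.self_of_nhds
  have hqs : ∀ᶠ r : ℝ × S in 𝓝 (0, x), F r.1 r.2 ∈ (extChartAt (𝓡 (n + 1)) q).source :=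
    h0.continuousAt.eventually ((isOpen_source q).mem_nhds (mem_extChartAt_source q))
  have hγ : ContDiffAt ℝ ∞ (famRep F x q) (0, y₀) :=
    contDiffAt_famRep ht (by rw [hx]; exact h0) (by rw [hx]; exact mem_extChartAt_source q)
  have hγ0 : famRep F x q (0, y₀) ∈ (extChartAt (𝓡 (n + 1)) q).target := by
    rw [famRep, hx]; exact mem_extChartAt_target q
  have hdet : ContDiffAt ℝ ∞ (fun r => (gram (chartMetric g q) (famRep F x q) (dirs n) r).det)
      (0, y₀) := contDiffAt_det fun i j =>
        contDiffAt_gram (contDiffAt_chartMetric g hγ0) hγ (dirs n) i j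
  have hpos : 0 < (gram (chartMetric g q) (famRep F x q) (dirs n) (0, y₀)).det := by
    rw [← metricMatrix_eq_gram g ht (by rw [hx]; exact h0)
      (by rw [hx]; exact mem_extChartAt_source q)]
    exact det_metricMatrix_pos g ht (by rw [hx]; exact hi)
  have hev := hdet.continuousAt.eventually (lt_mem_nhds hpos)
  filter_upwards [(tendsto_prod_chart x).eventually hev, h, hqs, eventually_mem_source (n := n) x]
    with r h1 h2 h3 h4
  have e := (extChartAt (𝓡 n) x).left_inv h4
  have hy := (extChartAt (𝓡 n) x).map_source h4
  rw [← metricMatrix_eq_gram g hy (by rw [e]; exact h2) (by rw [e]; exact h3)] at h1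
  have := injective_of_det_ne_zero g hy h1.ne'
  rwa [e] at this

lemma IsLocalVariation.isVariation [T2Space S] (g : Metric (n + 1) M) {φ : S → M}
    {F : ℝ → S → M} {C : Set S} (h : IsLocalVariation n φ F C) (hφ : IsImmersedHypersurface n φ) :
    IsVariation n φ F C := by
  refine ⟨h.zero, h.compact, ?_⟩
  -- Compactness of `C` gives one `ε` for all points of `C`; off `C`, an open set, the family
  -- coincides with `φ` for all times.
  have ev : ∀ᶠ t in 𝓝 (0 : ℝ), ∀ x ∈ C, SmoothFamilyAt n F t x ∧
      Function.Injective (mfderiv (𝓡 n) (𝓡 (n + 1)) (F t) x) :=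
    h.compact.eventually_forall_of_forall_eventually fun x _ => (h.smooth x).and
      (eventually_injective_mfderiv g (h.smooth x) (by rw [h.zero]; exact hφ.injective x))
  obtain ⟨ε, hε, hb⟩ := Metric.eventually_nhds_iff_ball.1 ev
  rw [Real.ball_eq_Ioo, zero_sub, zero_add] at hb
  have hout : ∀ x ∉ C, ∀ᶠ x' in 𝓝 x, ∀ t, F t x' = φ x' := fun x hx => by
    filter_upwards [h.compact.isClosed.isOpen_compl.mem_nhds hx] with x' hx' t
    exact h.fixed t x' hx'
  refine ⟨ε, hε, ?_, fun t ht x => ?_, fun t _ x hx => h.fixed t x hx⟩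
  · rintro ⟨t, x⟩ ⟨ht, -⟩
    refine ContMDiffAt.contMDiffWithinAt ?_
    by_cases hx : x ∈ C
    · exact (hb t ht x hx).1
    · refine ContMDiffAt.congr_of_eventuallyEq (smoothFamilyAt_const (hφ.smooth x) t) ?_
      filter_upwards [(continuous_snd.tendsto (t, x)).eventually (hout x hx)] with r hr
      exact hr r.1
  · by_cases hx : x ∈ C
    · exact (hb t ht x hx).2
    · have : F t =ᶠ[𝓝 x] φ := (hout x hx).mono fun x' hx' => hx' t
      intro v w hvw
      refine hφ.injective x ?_
      have e := this.mfderiv_eq (I := 𝓡 n) (I' := 𝓡 (n + 1))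
      exact (congrArg (fun L : EuclideanSpace ℝ (Fin n) →L[ℝ] EuclideanSpace ℝ (Fin (n + 1)) => L v)
        e).symm.trans (Eq.trans hvw (congrArg (fun L : EuclideanSpace ℝ (Fin n) →L[ℝ]
        EuclideanSpace ℝ (Fin (n + 1)) => L w) e))

lemma IsVariation.eventually_smooth {φ : S → M} {F : ℝ → S → M} {K : Set S}
    (h : IsVariation n φ F K) (x : S) : ∀ᶠ r : ℝ × S in 𝓝 (0, x), SmoothFamilyAt n F r.1 r.2 := by
  obtain ⟨ε, hε, hs, -, -⟩ := h.family
  have ho : IsOpen (Set.Ioo (-ε) ε ×ˢ (Set.univ : Set S)) := isOpen_Ioo.prod isOpen_univ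
  filter_upwards [ho.mem_nhds (show ((0 : ℝ), x) ∈ _ from ⟨⟨by linarith, hε⟩, trivial⟩)] with r hr
  exact hs.contMDiffAt (ho.mem_nhds hr)

lemma IsVariation.eventually_contMDiff {φ : S → M} {F : ℝ → S → M} {K : Set S}
    (h : IsVariation n φ F K) : ∀ᶠ t in 𝓝 (0 : ℝ), ContMDiff (𝓡 n) (𝓡 (n + 1)) ∞ (F t) := by
  obtain ⟨ε, hε, hs, -, -⟩ := h.family
  have ho : IsOpen (Set.Ioo (-ε) ε ×ˢ (Set.univ : Set S)) := isOpen_Ioo.prod isOpen_univ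
  filter_upwards [Ioo_mem_nhds (show -ε < 0 by linarith) hε] with t ht x
  have : SmoothFamilyAt n F t x := hs.contMDiffAt (ho.mem_nhds ⟨ht, trivial⟩)
  exact this.contMDiffAt

lemma IsVariation.eventually_fixed {φ : S → M} {F : ℝ → S → M} {K : Set S}
    (h : IsVariation n φ F K) : ∀ᶠ t in 𝓝 (0 : ℝ), ∀ x ∉ K, F t x = φ x := by
  obtain ⟨ε, hε, -, -, hf⟩ := h.family
  filter_upwards [Ioo_mem_nhds (show -ε < 0 by linarith) hε] with t ht
  exact hf t ht

end Existence

/-! ### The acceleration of a variation -/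

section Acceleration

/-- Covariant acceleration at time `0` of a curve. -/
def curveAcc {E : Type*} [NormedAddCommGroup E] [NormedSpace ℝ E] (Γ : E → E →L[ℝ] E →L[ℝ] E)
    (c : ℝ → E) : E :=
  deriv (deriv c) 0 + Γ (c 0) (deriv c 0) (deriv c 0)

/-- The time covariant derivative at `(0, y)` only involves the curve `t ↦ γ (t, y)`. -/
lemma cov_tdir_eq_curveAcc {n : ℕ} {E : Type*} [NormedAddCommGroup E] [NormedSpace ℝ E]
    {Γ : E → E →L[ℝ] E →L[ℝ] E} {γ : ℝ × EuclideanSpace ℝ (Fin n) → E}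
    {y : EuclideanSpace ℝ (Fin n)} (hγ : ContDiffAt ℝ ∞ γ (0, y)) :
    cov Γ γ (tdir n) (dd (tdir n) γ) (0, y) = curveAcc Γ (fun t => γ (t, y)) := by
  have tl : Filter.Tendsto (fun t : ℝ => (t, y)) (𝓝 0) (𝓝 (0, y)) :=
    (by fun_prop : Continuous fun t : ℝ => (t, y)).tendsto 0
  have line : ∀ {u : ℝ × EuclideanSpace ℝ (Fin n) → E} {t : ℝ}, DifferentiableAt ℝ u (t, y) →
      HasDerivAt (fun s => u (s, y)) (dd (tdir n) u (t, y)) t := fun h =>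
    h.hasFDerivAt.comp_hasDerivAt _ ((hasDerivAt_id _).prodMk (hasDerivAt_const _ y))
  have ev : deriv (fun t => γ (t, y)) =ᶠ[𝓝 0] fun t => dd (tdir n) γ (t, y) := by
    filter_upwards [tl.eventually (eventually_differentiableAt hγ)] with t ht
    exact (line ht).deriv
  have h2 := (line ((contDiffAt_dd hγ (tdir n)).differentiableAt (by simp))).deriv
  rw [cov, curveAcc, ev.deriv_eq, h2, ev.eq_of_nhds]

/-- The second derivative of `τ` produced by the chain rule is exactly the inhomogeneous term in the
transformation law of the connection, so the acceleration is a genuine vector. -/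
lemma curveAcc_transition {E : Type*} [NormedAddCommGroup E] [NormedSpace ℝ E]
    {Γ Γ' : E → E →L[ℝ] E →L[ℝ] E} {c : ℝ → E} {τ : E → E} (hc : ContDiffAt ℝ ∞ c 0)
    (hτ : ContDiffAt ℝ ∞ τ (c 0))
    (hΓ : ∀ u v, fderiv ℝ τ (c 0) (Γ (c 0) u v) = fderiv ℝ (fderiv ℝ τ) (c 0) u v
      + Γ' (τ (c 0)) (fderiv ℝ τ (c 0) u) (fderiv ℝ τ (c 0) v)) :
    curveAcc Γ' (fun t => τ (c t)) = fderiv ℝ τ (c 0) (curveAcc Γ c) := by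
  have d1 : ∀ᶠ t in 𝓝 (0 : ℝ), HasDerivAt (fun t => τ (c t)) (fderiv ℝ τ (c t) (deriv c t)) t := by
    filter_upwards [eventually_differentiableAt hc,
      hc.continuousAt.eventually (eventually_differentiableAt hτ)] with t h1 h2
    exact h2.hasFDerivAt.comp_hasDerivAt t h1.hasDerivAt
  have ev : deriv (fun t => τ (c t)) =ᶠ[𝓝 0] fun t => fderiv ℝ τ (c t) (deriv c t) :=
    d1.mono fun t ht => ht.deriv
  have hτ' : DifferentiableAt ℝ (fderiv ℝ τ) (c 0) :=
    (hτ.fderiv_right (m := ∞) (by simp)).differentiableAt (by simp)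
  have hc' : DifferentiableAt ℝ (deriv c) 0 := by
    have : ContDiffAt ℝ ∞ (dd (1 : ℝ) c) 0 := contDiffAt_dd hc 1
    exact this.differentiableAt (by simp)
  have d2 : HasDerivAt (fun t => fderiv ℝ τ (c t) (deriv c t))
      (fderiv ℝ (fderiv ℝ τ) (c 0) (deriv c 0) (deriv c 0) + fderiv ℝ τ (c 0) (deriv (deriv c) 0))
      0 :=
    HasDerivAt.clm_apply
      (hτ'.hasFDerivAt.comp_hasDerivAt 0 (hc.differentiableAt (by simp)).hasDerivAt) hc'.hasDerivAt
  rw [curveAcc, ev.deriv_eq, d2.deriv, ev.eq_of_nhds, curveAcc, map_add, hΓ]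
  abel

variable {n : ℕ}
  {M : Type*} [TopologicalSpace M] [ChartedSpace (EuclideanSpace ℝ (Fin (n + 1))) M]
  [IsManifold (𝓡 (n + 1)) ∞ M]
  {S : Type*} [TopologicalSpace S] [ChartedSpace (EuclideanSpace ℝ (Fin n)) S]
  [IsManifold (𝓡 n) ∞ S]

/-- The covariant acceleration of the family `F` at time `0`. -/
def acceleration (g : Metric (n + 1) M) (F : ℝ → S → M) (x : S) : EuclideanSpace ℝ (Fin (n + 1)) :=
  chartDSymm (F 0 x) (extChartAt (𝓡 (n + 1)) (F 0 x) (F 0 x))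
    (curveAcc (chartConn g (F 0 x)) fun t => extChartAt (𝓡 (n + 1)) (F 0 x) (F t x))

/-- The acceleration is defined in the chart at `F 0 x`, which varies with `x`. Being able to
compute it in any fixed chart `q` is what yields its smoothness. -/
lemma chartD_acceleration (g : Metric (n + 1) M) {F : ℝ → S → M} {x : S}
    (hF : SmoothFamilyAt n F 0 x) {q : M} (hq : F 0 x ∈ (extChartAt (𝓡 (n + 1)) q).source) :
    chartD q (F 0 x) (acceleration g F x)
      = curveAcc (chartConn g q) fun t => extChartAt (𝓡 (n + 1)) q (F t x) := by
  set p := F 0 x with hp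
  have hps := mem_extChartAt_source (I := 𝓡 (n + 1)) p
  have hpt := mem_extChartAt_target (I := 𝓡 (n + 1)) p
  have hpi : (extChartAt (𝓡 (n + 1)) p).symm (extChartAt (𝓡 (n + 1)) p p) = p := extChartAt_to_inv p
  have hqi : (extChartAt (𝓡 (n + 1)) p).symm (extChartAt (𝓡 (n + 1)) p p)
      ∈ (extChartAt (𝓡 (n + 1)) q).source := by rwa [hpi]
  have hc : ContDiffAt ℝ ∞ (fun t => extChartAt (𝓡 (n + 1)) p (F t x)) 0 :=
    (ContMDiffAt.comp (0 : ℝ) (contMDiffAt_chart hps) hF.contMDiffAt_time).contDiffAt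
  have hev : ∀ᶠ t in 𝓝 (0 : ℝ), F t x ∈ (extChartAt (𝓡 (n + 1)) p).source :=
    hF.contMDiffAt_time.continuousAt.eventually ((isOpen_source p).mem_nhds hps)
  have ht := curveAcc_transition (Γ := chartConn g p) (Γ' := chartConn g q) hc
    (τ := fun z => extChartAt (𝓡 (n + 1)) q ((extChartAt (𝓡 (n + 1)) p).symm z))
    (contDiffAt_transition hpt hqi) (chartConn_transition g hpt hqi)
  have e : (fun t => extChartAt (𝓡 (n + 1)) q ((extChartAt (𝓡 (n + 1)) p).symm
      (extChartAt (𝓡 (n + 1)) p (F t x)))) =ᶠ[𝓝 0] fun t => extChartAt (𝓡 (n + 1)) q (F t x) := by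
    filter_upwards [hev] with t ht
    rw [(extChartAt (𝓡 (n + 1)) p).left_inv ht]
  have e' : curveAcc (chartConn g q) (fun t => extChartAt (𝓡 (n + 1)) q
      ((extChartAt (𝓡 (n + 1)) p).symm (extChartAt (𝓡 (n + 1)) p (F t x))))
      = curveAcc (chartConn g q) fun t => extChartAt (𝓡 (n + 1)) q (F t x) := by
    simp only [curveAcc]
    rw [e.deriv.deriv_eq, e.deriv_eq, e.eq_of_nhds]
  have ft := fderiv_transition hpt hqi
    (curveAcc (chartConn g p) fun t => extChartAt (𝓡 (n + 1)) p (F t x))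
  rw [← e', ht]
  refine Eq.trans ?_ ft.symm
  rw [hpi, acceleration]

lemma isSmoothAlong_of_contMDiffAt {φ : S → M} {V : S → EuclideanSpace ℝ (Fin (n + 1))}
    (h : ∀ x, ContMDiffAt (𝓡 n) (𝓡 (n + 1)).tangent ∞
      (fun x => (⟨φ x, V x⟩ : TangentBundle (𝓡 (n + 1)) M)) x)
    (hφ : ContMDiff (𝓡 n) (𝓡 (n + 1)) ∞ φ) : IsSmoothAlong φ V := fun x _ hq =>
  (contMDiffAt_tangent_iff (hφ x) hq).1 (h x)

lemma contMDiffAt_of_chart {E : Type*} [NormedAddCommGroup E] [NormedSpace ℝ E] {u : S → E} {x : S}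
    {U : EuclideanSpace ℝ (Fin n) → E} (hU : ContDiffAt ℝ ∞ U (extChartAt (𝓡 n) x x))
    (e : ∀ᶠ x' in 𝓝 x, u x' = U (extChartAt (𝓡 n) x x')) :
    ContMDiffAt (𝓡 n) 𝓘(ℝ, E) ∞ u x :=
  (ContMDiffAt.comp (g := U) x hU.contMDiffAt (contMDiffAt_chart
    (mem_extChartAt_source x))).congr_of_eventuallyEq e

lemma isSmoothAlong_acceleration (g : Metric (n + 1) M) {F : ℝ → S → M}
    (h : ∀ x, SmoothFamilyAt n F 0 x) : IsSmoothAlong (F 0) (acceleration g F) := by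
  intro x q hq
  have ht := mem_extChartAt_target (I := 𝓡 n) x
  set y₀ := extChartAt (𝓡 n) x x with hy₀
  have hx : (extChartAt (𝓡 n) x).symm y₀ = x := extChartAt_to_inv x
  have hγ : ContDiffAt ℝ ∞ (famRep F x q) (0, y₀) :=
    contDiffAt_famRep ht (h _) (by rw [hx]; exact hq)
  have hγ0 : famRep F x q (0, y₀) ∈ (extChartAt (𝓡 (n + 1)) q).target := by
    rw [famRep, hx]; exact (extChartAt (𝓡 (n + 1)) q).map_source hq
  have hcov := contDiffAt_cov (contDiffAt_chartConn g hγ0) hγ (contDiffAt_dd hγ (tdir n)) (tdir n)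
  refine contMDiffAt_of_chart (U := fun y => cov (chartConn g q) (famRep F x q) (tdir n)
    (dd (tdir n) (famRep F x q)) (0, y))
    (ContDiffAt.comp (f := fun y : EuclideanSpace ℝ (Fin n) => ((0 : ℝ), y)) y₀ hcov
      (contDiffAt_const.prodMk contDiffAt_id)) ?_
  have hqs : ∀ᶠ x' in 𝓝 x, F 0 x' ∈ (extChartAt (𝓡 (n + 1)) q).source :=
    (h x).contMDiffAt.continuousAt.eventually ((isOpen_source q).mem_nhds hq)
  filter_upwards [hqs, extChartAt_source_mem_nhds (I := 𝓡 n) x] with x' h1 h2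
  have e := (extChartAt (𝓡 n) x).left_inv h2
  rw [chartD_acceleration g (h x') h1, cov_tdir_eq_curveAcc
    (contDiffAt_famRep ((extChartAt (𝓡 n) x).map_source h2) (h _) (by rw [e]; exact h1))]
  simp only [famRep, e]

lemma acceleration_eq_zero (g : Metric (n + 1) M) {F : ℝ → S → M} {x : S}
    (h : ∀ᶠ t in 𝓝 (0 : ℝ), F t x = F 0 x) : acceleration g F x = 0 := by
  have e : (fun t => extChartAt (𝓡 (n + 1)) (F 0 x) (F t x)) =ᶠ[𝓝 0]
      fun _ => extChartAt (𝓡 (n + 1)) (F 0 x) (F 0 x) := by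
    filter_upwards [h] with t ht
    rw [ht]
  have : curveAcc (chartConn g (F 0 x)) (fun t => extChartAt (𝓡 (n + 1)) (F 0 x) (F t x)) = 0 := by
    simp only [curveAcc]
    rw [e.deriv.deriv_eq, e.deriv_eq]
    simp
  rw [acceleration, this, map_zero]

end Acceleration

/-! ### The normal field in charts -/

section NormalField

variable {n : ℕ}
  {M : Type*} [TopologicalSpace M] [ChartedSpace (EuclideanSpace ℝ (Fin (n + 1))) M]
  [IsManifold (𝓡 (n + 1)) ∞ M]
  {S : Type*} [TopologicalSpace S] [ChartedSpace (EuclideanSpace ℝ (Fin n)) S]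
  [IsManifold (𝓡 n) ∞ S]

lemma dd_dirs_eq {E : Type*} [NormedAddCommGroup E] [NormedSpace ℝ E]
    {u : ℝ × EuclideanSpace ℝ (Fin n) → E} {t : ℝ} {y : EuclideanSpace ℝ (Fin n)}
    (h : DifferentiableAt ℝ u (t, y)) (i : Fin n) :
    dd (dirs n i) u (t, y) = fderiv ℝ (fun y => u (t, y)) y (EuclideanSpace.single i 1) := by
  have h1 : HasFDerivAt (fun y : EuclideanSpace ℝ (Fin n) => (t, y))
      (ContinuousLinearMap.inr ℝ ℝ (EuclideanSpace ℝ (Fin n))) y := hasFDerivAt_prodMk_right t y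
  have h2 := HasFDerivAt.comp (g := u) y h.hasFDerivAt h1
  exact (congrArg (fun L => L (EuclideanSpace.single i 1)) h2.fderiv).symm

/-- Space derivatives only see the slice of fixed `t`. A family may thus be replaced by the constant
family `baseRep`, although their time derivatives differ. -/
lemma dd_dirs_congr {E : Type*} [NormedAddCommGroup E] [NormedSpace ℝ E]
    {u v : ℝ × EuclideanSpace ℝ (Fin n) → E} {t : ℝ} {y : EuclideanSpace ℝ (Fin n)}
    (hu : DifferentiableAt ℝ u (t, y)) (hv : DifferentiableAt ℝ v (t, y))
    (h : ∀ᶠ y' in 𝓝 y, u (t, y') = v (t, y')) (i : Fin n) :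
    dd (dirs n i) u (t, y) = dd (dirs n i) v (t, y) := by
  rw [dd_dirs_eq hu, dd_dirs_eq hv, Filter.EventuallyEq.fderiv_eq h]

lemma tdiv_congr {E : Type*} [NormedAddCommGroup E] [NormedSpace ℝ E]
    (G : E → E →L[ℝ] E →L[ℝ] ℝ) (Γ : E → E →L[ℝ] E →L[ℝ] E)
    {γ γ' X X' : ℝ × EuclideanSpace ℝ (Fin n) → E} {t : ℝ} {y : EuclideanSpace ℝ (Fin n)}
    (hγ : DifferentiableAt ℝ γ (t, y)) (hγ' : DifferentiableAt ℝ γ' (t, y))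
    (hX : DifferentiableAt ℝ X (t, y)) (hX' : DifferentiableAt ℝ X' (t, y))
    (h : ∀ᶠ y' in 𝓝 y, γ (t, y') = γ' (t, y')) (h' : ∀ᶠ y' in 𝓝 y, X (t, y') = X' (t, y')) :
    tdiv G Γ γ (dirs n) X (t, y) = tdiv G Γ γ' (dirs n) X' (t, y) := by
  have e0 := h.self_of_nhds
  have e1 := h'.self_of_nhds
  have e2 := dd_dirs_congr hγ hγ' h
  have e3 := dd_dirs_congr hX hX' h'
  simp only [tdiv, gram, cov, e0, e1, e2, e3]

/-- A vector field along `φ` in charts. -/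
def fieldRep (φ : S → M) (V : S → EuclideanSpace ℝ (Fin (n + 1))) (p : S) (q : M)
    (r : ℝ × EuclideanSpace ℝ (Fin n)) : EuclideanSpace ℝ (Fin (n + 1)) :=
  chartD q (φ ((extChartAt (𝓡 n) p).symm r.2)) (V ((extChartAt (𝓡 n) p).symm r.2))

lemma contDiffAt_fieldRep {φ : S → M} {V : S → EuclideanSpace ℝ (Fin (n + 1))}
    (hV : IsSmoothAlong φ V) {p : S} {q : M} (t : ℝ) {y : EuclideanSpace ℝ (Fin n)}
    (hy : y ∈ (extChartAt (𝓡 n) p).target)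
    (hq : φ ((extChartAt (𝓡 n) p).symm y) ∈ (extChartAt (𝓡 (n + 1)) q).source) :
    ContDiffAt ℝ ∞ (fieldRep φ V p q) (t, y) := by
  have h1 : ContDiffAt ℝ ∞ (fun y => chartD q (φ ((extChartAt (𝓡 n) p).symm y))
      (V ((extChartAt (𝓡 n) p).symm y))) y :=
    (ContMDiffAt.comp (g := fun x => chartD q (φ x) (V x)) y (hV _ q hq)
      (contMDiffAt_chart_symm hy)).contDiffAt
  exact ContDiffAt.comp (f := Prod.snd) (t, y) h1 contDiffAt_snd

/-- The point of space-time coordinates corresponding to `x` at time `0`. -/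
def basePt (n : ℕ) {S : Type*} [TopologicalSpace S] [ChartedSpace (EuclideanSpace ℝ (Fin n)) S]
    (x : S) : ℝ × EuclideanSpace ℝ (Fin n) := (0, extChartAt (𝓡 n) x x)

/-- `φ` in the preferred charts at `x` and `φ x`, as a constant family. -/
def baseRep (φ : S → M) (x : S) : ℝ × EuclideanSpace ℝ (Fin n) → EuclideanSpace ℝ (Fin (n + 1)) :=
  famRep (fun _ => φ) x (φ x)

lemma baseRep_basePt (φ : S → M) (x : S) :
    baseRep φ x (basePt n x) = extChartAt (𝓡 (n + 1)) (φ x) (φ x) := by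
  simp only [baseRep, famRep, basePt, extChartAt_to_inv]

lemma mem_target_basePt (φ : S → M) (x : S) :
    baseRep φ x (basePt n x) ∈ (extChartAt (𝓡 (n + 1)) (φ x)).target := by
  rw [baseRep_basePt]; exact mem_extChartAt_target _

lemma contDiffAt_baseRep {φ : S → M} (hφ : ContMDiff (𝓡 n) (𝓡 (n + 1)) ∞ φ) (x : S) :
    ContDiffAt ℝ ∞ (baseRep φ x) (basePt n x) :=
  contDiffAt_famRep (mem_extChartAt_target x) (smoothFamilyAt_const (hφ _) 0)
    (by rw [extChartAt_to_inv]; exact mem_extChartAt_source _)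

lemma fieldRep_basePt (φ : S → M) (V : S → EuclideanSpace ℝ (Fin (n + 1))) (x : S) :
    fieldRep φ V x (φ x) (basePt n x) = chartD (φ x) (φ x) (V x) := by
  simp only [fieldRep, basePt, extChartAt_to_inv]

lemma contDiffAt_fieldRep_basePt {φ : S → M} {V : S → EuclideanSpace ℝ (Fin (n + 1))}
    (hV : IsSmoothAlong φ V) (x : S) : ContDiffAt ℝ ∞ (fieldRep φ V x (φ x)) (basePt n x) :=
  contDiffAt_fieldRep hV 0 (mem_extChartAt_target x)
    (by rw [extChartAt_to_inv]; exact mem_extChartAt_source _)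

lemma eventually_basePt {φ : S → M} (hφ : Continuous φ) (x : S) :
    ∀ᶠ r in 𝓝 (basePt n x), r.2 ∈ (extChartAt (𝓡 n) x).target ∧
      φ ((extChartAt (𝓡 n) x).symm r.2) ∈ (extChartAt (𝓡 (n + 1)) (φ x)).source := by
  have ht := mem_extChartAt_target (I := 𝓡 n) x
  have h1 : ∀ᶠ y in 𝓝 (extChartAt (𝓡 n) x x), y ∈ (extChartAt (𝓡 n) x).target ∧
      φ ((extChartAt (𝓡 n) x).symm y) ∈ (extChartAt (𝓡 (n + 1)) (φ x)).source := by
    refine Filter.Eventually.and ((isOpen_target x).mem_nhds ht) ?_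
    refine (ContinuousAt.comp (g := φ) hφ.continuousAt
      (contMDiffAt_chart_symm ht).continuousAt).eventually ((isOpen_source _).mem_nhds ?_)
    simp only [Function.comp, extChartAt_to_inv]
    exact mem_extChartAt_source _
  exact (continuous_snd.tendsto (basePt n x)).eventually h1

lemma fderiv_chart_map {φ : S → M} (hφ : ContMDiff (𝓡 n) (𝓡 (n + 1)) ∞ φ) {p : S} {q : M}
    {y : EuclideanSpace ℝ (Fin n)} (hy : y ∈ (extChartAt (𝓡 n) p).target)
    (hq : φ ((extChartAt (𝓡 n) p).symm y) ∈ (extChartAt (𝓡 (n + 1)) q).source)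
    (u : EuclideanSpace ℝ (Fin n)) :
    fderiv ℝ (fun y => extChartAt (𝓡 (n + 1)) q (φ ((extChartAt (𝓡 n) p).symm y))) y u
      = chartD q (φ ((extChartAt (𝓡 n) p).symm y))
        (mfderiv (𝓡 n) (𝓡 (n + 1)) φ ((extChartAt (𝓡 n) p).symm y) (chartDSymm p y u)) := by
  have hs : MDifferentiableAt (𝓡 n) (𝓡 n) (extChartAt (𝓡 n) p).symm y :=
    (contMDiffAt_chart_symm hy).mdifferentiableAt (by simp)
  have hF : MDifferentiableAt (𝓡 n) (𝓡 (n + 1)) φ ((extChartAt (𝓡 n) p).symm y) :=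
    (hφ _).mdifferentiableAt (by simp)
  refine (chartD_fderiv (MDifferentiableAt.comp y hF hs) hq u).symm.trans ?_
  exact congrArg (chartD q _) (congrArg (fun L => L u) (mfderiv_comp y hF hs))

variable {g : Metric (n + 1) M} {φ : S → M} {N : S → EuclideanSpace ℝ (Fin (n + 1))}

lemma IsUnitNormal.isSmoothAlong (hN : IsUnitNormal g φ N)
    (hφ : ContMDiff (𝓡 n) (𝓡 (n + 1)) ∞ φ) : IsSmoothAlong φ N :=
  isSmoothAlong_of_contMDiffAt (fun x => hN.smooth x) hφ

lemma IsUnitNormal.eventually_unit (hN : IsUnitNormal g φ N)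
    (hφ : ContMDiff (𝓡 n) (𝓡 (n + 1)) ∞ φ) (x : S) :
    ∀ᶠ r in 𝓝 (basePt n x), chartMetric g (φ x) (baseRep φ x r) (fieldRep φ N x (φ x) r)
      (fieldRep φ N x (φ x) r) = 1 := by
  filter_upwards [eventually_basePt hφ.continuous x] with r hr
  exact (form_eq_chartMetric g hr.2 _ _).symm.trans (hN.unit _)

lemma IsUnitNormal.eventually_normal (hN : IsUnitNormal g φ N)
    (hφ : ContMDiff (𝓡 n) (𝓡 (n + 1)) ∞ φ) (x : S) (i : Fin n) :
    ∀ᶠ r in 𝓝 (basePt n x), chartMetric g (φ x) (baseRep φ x r) (fieldRep φ N x (φ x) r)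
      (dd (dirs n i) (baseRep φ x) r) = 0 := by
  filter_upwards [eventually_basePt hφ.continuous x,
    eventually_differentiableAt (contDiffAt_baseRep hφ x)] with r hr hd
  have h1 : dd (dirs n i) (baseRep φ x) r = _ :=
    (dd_dirs_famRep (t := r.1) (y := r.2) hd i).trans
      (fderiv_chart_map hφ hr.1 hr.2 (EuclideanSpace.single i 1))
  rw [h1]
  exact (form_eq_chartMetric g hr.2 _ _).symm.trans (hN.normal _ _)

/-- The covariant derivative of the normal field. -/
def normalCov (g : Metric (n + 1) M) (φ : S → M) (N : S → EuclideanSpace ℝ (Fin (n + 1))) (x : S)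
    (i : Fin n) : EuclideanSpace ℝ (Fin (n + 1)) :=
  cov (chartConn g (φ x)) (baseRep φ x) (dirs n i) (fieldRep φ N x (φ x)) (basePt n x)

lemma dd_const_eventually {Q E : Type*} [NormedAddCommGroup Q] [NormedSpace ℝ Q]
    [NormedAddCommGroup E] [NormedSpace ℝ E] {u : Q → E} {q : Q} {c : E}
    (h : ∀ᶠ r in 𝓝 q, u r = c) (a : Q) : dd a u q = 0 := by
  have : u =ᶠ[𝓝 q] fun _ => c := h
  rw [dd_congr this, dd]; simp

/-- Differentiate `⟨N, N⟩ = 1`. -/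
lemma IsUnitNormal.inner_normalCov (hN : IsUnitNormal g φ N)
    (hφ : ContMDiff (𝓡 n) (𝓡 (n + 1)) ∞ φ) (x : S) (i : Fin n) :
    chartMetric g (φ x) (baseRep φ x (basePt n x)) (normalCov g φ N x i)
      (fieldRep φ N x (φ x) (basePt n x)) = 0 := by
  have hz := mem_target_basePt (n := n) φ x
  have dN := (contDiffAt_fieldRep_basePt (hN.isSmoothAlong hφ) x).differentiableAt (by simp)
  have h1 := dd_inner (isLeviCivitaAt_chartConn g hz)
    ((contDiffAt_chartMetric g hz).differentiableAt (by simp))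
    ((contDiffAt_baseRep hφ x).differentiableAt (by simp)) dN dN (dirs n i)
  rw [dd_const_eventually (hN.eventually_unit hφ x)] at h1
  have h2 := chartMetric_symm g (φ x) (baseRep φ x (basePt n x)) (fieldRep φ N x (φ x) (basePt n x))
    (normalCov g φ N x i)
  unfold normalCov at *
  linarith

/-- Differentiate `⟨N, ∂_j⟩ = 0`. The right side is the second fundamental form in the sign
convention used here, `A_ij = -⟨∇_i ∂_j, N⟩ = ⟨∇_i N, ∂_j⟩`. -/
lemma IsUnitNormal.inner_normalCov_tangent (hN : IsUnitNormal g φ N)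
    (hφ : ContMDiff (𝓡 n) (𝓡 (n + 1)) ∞ φ) (x : S) (i j : Fin n) :
    chartMetric g (φ x) (baseRep φ x (basePt n x)) (normalCov g φ N x i)
      (dd (dirs n j) (baseRep φ x) (basePt n x))
      = -chartMetric g (φ x) (baseRep φ x (basePt n x)) (fieldRep φ N x (φ x) (basePt n x))
        (cov (chartConn g (φ x)) (baseRep φ x) (dirs n i) (dd (dirs n j) (baseRep φ x))
          (basePt n x)) := by
  have hz := mem_target_basePt (n := n) φ x
  have dN := (contDiffAt_fieldRep_basePt (hN.isSmoothAlong hφ) x).differentiableAt (by simp)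
  have hb := contDiffAt_baseRep hφ x
  have h1 := dd_inner (isLeviCivitaAt_chartConn g hz)
    ((contDiffAt_chartMetric g hz).differentiableAt (by simp))
    (hb.differentiableAt (by simp)) dN
    ((contDiffAt_dd hb (dirs n j)).differentiableAt (by simp)) (dirs n i)
  rw [dd_const_eventually (hN.eventually_normal hφ x j)] at h1
  unfold normalCov
  linarith

lemma IsUnitNormal.shape_symm (hN : IsUnitNormal g φ N)
    (hφ : ContMDiff (𝓡 n) (𝓡 (n + 1)) ∞ φ) (x : S) (i j : Fin n) :
    chartMetric g (φ x) (baseRep φ x (basePt n x)) (normalCov g φ N x i)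
      (dd (dirs n j) (baseRep φ x) (basePt n x))
      = chartMetric g (φ x) (baseRep φ x (basePt n x)) (normalCov g φ N x j)
      (dd (dirs n i) (baseRep φ x) (basePt n x)) := by
  rw [hN.inner_normalCov_tangent hφ, hN.inner_normalCov_tangent hφ,
    cov_dd_comm (isLeviCivitaAt_chartConn g (mem_target_basePt φ x))
      ((contDiffAt_baseRep hφ x).of_le two_le_infty)]

lemma firstFF_eq_gram (g : Metric (n + 1) M) {φ : S → M} (hφ : ContMDiff (𝓡 n) (𝓡 (n + 1)) ∞ φ)
    (x : S) : firstFF g φ x = gram (chartMetric g (φ x)) (baseRep φ x) (dirs n) (basePt n x) :=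
  metricMatrix_eq_gram g (F := fun _ => φ) (mem_extChartAt_target x) (smoothFamilyAt_const (hφ _) 0)
    (by rw [extChartAt_to_inv]; exact mem_extChartAt_source _)

lemma IsUnitNormal.isAdaptedFrame (hN : IsUnitNormal g φ N) (hφ : IsImmersedHypersurface n φ)
    (x : S) : IsAdaptedFrame (chartMetric g (φ x) (baseRep φ x (basePt n x)))
      (fun i => dd (dirs n i) (baseRep φ x) (basePt n x)) (fieldRep φ N x (φ x) (basePt n x)) where
  symm := chartMetric_symm g _ _
  normal i := by
    rw [chartMetric_symm]
    exact (hN.eventually_normal hφ.smooth x i).self_of_nhds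
  unit := (hN.eventually_unit hφ.smooth x).self_of_nhds
  det_ne := by
    have h := firstFF_eq_gram g hφ.smooth x
    have h2 := (det_metricMatrix_pos g (mem_extChartAt_target (I := 𝓡 n) x) (hφ.injective _)).ne'
    rw [firstFF] at h
    rw [h] at h2
    exact h2

lemma pd_coord {d m : ℕ} {u : EuclideanSpace ℝ (Fin d) → EuclideanSpace ℝ (Fin m)}
    {y : EuclideanSpace ℝ (Fin d)} (h : DifferentiableAt ℝ u y) (i : Fin d) (a : Fin m) :
    pd i (fun y => u y a) y = fderiv ℝ u y (EuclideanSpace.single i 1) a := by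
  have h1 : HasFDerivAt (fun y => u y a)
      ((EuclideanSpace.proj a : EuclideanSpace ℝ (Fin m) →L[ℝ] ℝ).comp (fderiv ℝ u y)) y :=
    (EuclideanSpace.proj a : EuclideanSpace ℝ (Fin m) →L[ℝ] ℝ).hasFDerivAt.comp y h.hasFDerivAt
  rw [pd, h1.fderiv]; rfl

lemma covDerivCoord_eq (g : Metric (n + 1) M) {φ : S → M} (hφ : ContMDiff (𝓡 n) (𝓡 (n + 1)) ∞ φ)
    (x : S) (i j : Fin n) (a : Fin (n + 1)) :
    covDerivCoord g φ x i j a = cov (chartConn g (φ x)) (baseRep φ x) (dirs n i)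
      (dd (dirs n j) (baseRep φ x)) (basePt n x) a := by
  have hb := contDiffAt_baseRep hφ x
  have hev : ∀ᶠ y in 𝓝 (extChartAt (𝓡 n) x x), DifferentiableAt ℝ (baseRep φ x) ((0 : ℝ), y) :=
    ((by fun_prop : Continuous fun y : EuclideanSpace ℝ (Fin n) => ((0 : ℝ), y)).tendsto
      _).eventually (eventually_differentiableAt hb)
  have hsl : ∀ {y}, DifferentiableAt ℝ (baseRep φ x) ((0 : ℝ), y) →
      DifferentiableAt ℝ (inCharts (n := n) φ x) y := fun {y} h =>
    DifferentiableAt.comp (f := fun y => ((0 : ℝ), y)) y h (by fun_prop)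
  have h1 : ∀ j b, ∀ᶠ y in 𝓝 (extChartAt (𝓡 n) x x),
      pd j (fun y => inCharts φ x y b) y = dd (dirs n j) (baseRep φ x) ((0 : ℝ), y) b := by
    intro j b
    filter_upwards [hev] with y hy
    rw [pd_coord (hsl hy), dd_dirs_eq hy]
    rfl
  have h2 : pd i (pd j (fun y => inCharts φ x y a)) (extChartAt (𝓡 n) x x)
      = dd (dirs n i) (dd (dirs n j) (baseRep φ x)) (basePt n x) a := by
    have hd : DifferentiableAt ℝ (dd (dirs n j) (baseRep φ x)) (basePt n x) :=
      (contDiffAt_dd hb (dirs n j)).differentiableAt (by simp)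
    have e : pd j (fun y => inCharts φ x y a) =ᶠ[𝓝 (extChartAt (𝓡 n) x x)]
        fun y => dd (dirs n j) (baseRep φ x) ((0 : ℝ), y) a := h1 j a
    rw [pd, e.fderiv_eq, basePt, dd_dirs_eq hd]
    exact pd_coord (u := fun y => dd (dirs n j) (baseRep φ x) ((0 : ℝ), y))
      (DifferentiableAt.comp (f := fun y => ((0 : ℝ), y)) _ hd (by fun_prop)) i a
  have hi := fun b => (h1 i b).self_of_nhds
  have hj := fun b => (h1 j b).self_of_nhds
  rw [covDerivCoord, h2, cov]
  simp only [hi, hj]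
  rw [PiLp.add_apply, chartConn, christoffelMap_apply, baseRep_basePt]
  rfl

lemma secondFF_apply (g : Metric (n + 1) M) (φ : S → M) (N : S → EuclideanSpace ℝ (Fin (n + 1)))
    (x : S) (i j : Fin n) : secondFF g φ N x i j = -∑ a, ∑ b,
      metricMatrix g.form (φ x) (extChartAt (𝓡 (n + 1)) (φ x) (φ x)) a b
        * covDerivCoord g φ x i j a * chartD (φ x) (φ x) (N x) b := rfl

lemma secondFF_eq (hN : IsUnitNormal g φ N) (hφ : ContMDiff (𝓡 n) (𝓡 (n + 1)) ∞ φ) (x : S) :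
    secondFF g φ N x
      = IsNormalVariationAt.shape (chartMetric g (φ x)) (baseRep φ x) (dirs n) (basePt n x)
        (normalCov g φ N x) := by
  ext i j
  rw [IsNormalVariationAt.shape, Matrix.of_apply, hN.inner_normalCov_tangent hφ, secondFF_apply,
    neg_inj, chartMetric_symm, baseRep_basePt, fieldRep_basePt]
  conv_rhs => rw [← sum_single_smul (cov _ _ _ _ _), ← sum_single_smul (chartD _ _ (N x))]
  simp only [map_sum, map_smul, sum_apply, smul_apply, smul_eq_mul, Finset.mul_sum,
    covDerivCoord_eq g hφ, metricMatrix_eq_chartMetric]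
  rw [Finset.sum_comm]
  refine Finset.sum_congr rfl fun a _ => Finset.sum_congr rfl fun b _ => ?_
  ring

/-- The contraction `h^{ik} h^{jl} A_ij A_kl` becomes `tr(h⁻¹A h⁻¹A)` after reordering indices, by
symmetry of `A` and of `h⁻¹`. -/
lemma normSqSecondFF_eq (hN : IsUnitNormal g φ N) (hφ : IsImmersedHypersurface n φ) (x : S) :
    normSqSecondFF g φ N x =
      ((gram (chartMetric g (φ x)) (baseRep φ x) (dirs n) (basePt n x))⁻¹ *
      IsNormalVariationAt.shape (chartMetric g (φ x)) (baseRep φ x) (dirs n) (basePt n x)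
        (normalCov g φ N x) * ((gram (chartMetric g (φ x)) (baseRep φ x) (dirs n) (basePt n x))⁻¹ *
      IsNormalVariationAt.shape (chartMetric g (φ x)) (baseRep φ x) (dirs n) (basePt n x)
        (normalCov g φ N x))).trace := by
  have hs : ∀ i j, secondFF g φ N x i j = secondFF g φ N x j i := fun i j => by
    rw [secondFF_eq hN hφ.smooth]; exact hN.shape_symm hφ.smooth x i j
  have hi : ∀ i j, (firstFF g φ x)⁻¹ i j = (firstFF g φ x)⁻¹ j i := fun i j => by
    rw [firstFF_eq_gram g hφ.smooth]; exact (hN.isAdaptedFrame hφ x).inv_symm i j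
  rw [← secondFF_eq hN hφ.smooth, ← firstFF_eq_gram g hφ.smooth, trace_mul_mul_eq_sum]
  have e : normSqSecondFF g φ N x = ∑ i, ∑ j, ∑ k, ∑ l, (firstFF g φ x)⁻¹ i k *
    (firstFF g φ x)⁻¹ j l * secondFF g φ N x i j * secondFF g φ N x k l := rfl
  rw [e]
  refine Finset.sum_congr rfl fun i _ => ?_
  rw [Finset.sum_comm]
  refine Finset.sum_congr rfl fun k _ => ?_
  rw [Finset.sum_comm]
  refine Finset.sum_congr rfl fun l _ => Finset.sum_congr rfl fun j _ => ?_
  rw [hs j i, hi l j]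
  ring

end NormalField

/-! ### Variation of the area density -/

section DensityVariation

variable {n : ℕ}
  {M : Type*} [TopologicalSpace M] [ChartedSpace (EuclideanSpace ℝ (Fin (n + 1))) M]
  [IsManifold (𝓡 (n + 1)) ∞ M]
  {S : Type*} [TopologicalSpace S] [ChartedSpace (EuclideanSpace ℝ (Fin n)) S]
  [IsManifold (𝓡 n) ∞ S]

lemma ricciF_eq (g : Metric (n + 1) M) {f : M → ℝ} (hf : ContMDiff (𝓡 (n + 1)) 𝓘(ℝ, ℝ) ∞ f)
    (q : M) (v : EuclideanSpace ℝ (Fin (n + 1))) :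
    ricciF g f q v v
      = ric (chartConn g q) (extChartAt (𝓡 (n + 1)) q q) (chartD q q v) (chartD q q v)
        + hess (chartConn g q) (funRep f q) (extChartAt (𝓡 (n + 1)) q q) (chartD q q v)
          (chartD q q v) := by
  have hz := mem_extChartAt_target (I := 𝓡 (n + 1)) q
  rw [chartConn, ← toMatrix_chartMetric, ric_christoffelMap (fun k i j => (contDiffAt_christoffel
    (contDiffAt_chartMetric g hz) (det_toMatrix_chartMetric_ne g hz) k i j).differentiableAt
    (by simp)) ((contDiffAt_chartConn g hz).differentiableAt (by simp))
    (fun y i j => chartMetric_symm g q y _ _), hess_christoffelMap (contDiffAt_funRep hf hz)]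
  rfl

lemma mfderiv_eq_funRep {f : M → ℝ} (hf : ContMDiff (𝓡 (n + 1)) 𝓘(ℝ, ℝ) ∞ f) (q : M)
    (v : EuclideanSpace ℝ (Fin (n + 1))) :
    (mfderiv (𝓡 (n + 1)) 𝓘(ℝ, ℝ) f q : EuclideanSpace ℝ (Fin (n + 1)) →L[ℝ] ℝ) v
      = fderiv ℝ (funRep f q) (extChartAt (𝓡 (n + 1)) q q) (chartD q q v) := by
  have hz := mem_extChartAt_target (I := 𝓡 (n + 1)) q
  have hs := mem_extChartAt_source (I := 𝓡 (n + 1)) q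
  have h1 : MDifferentiableAt (𝓡 (n + 1)) 𝓘(ℝ, ℝ) (funRep f q) (extChartAt (𝓡 (n + 1)) q q) :=
    ((contDiffAt_funRep hf hz).differentiableAt (by simp)).mdifferentiableAt
  have h2 := mfderiv_comp q h1 ((contMDiffAt_chart hs).mdifferentiableAt (by simp))
  have e : funRep f q ∘ extChartAt (𝓡 (n + 1)) q =ᶠ[𝓝 q] f := by
    filter_upwards [(isOpen_source q).mem_nhds hs] with x hx
    exact congrArg f ((extChartAt (𝓡 (n + 1)) q).left_inv hx)
  have h3 := e.mfderiv_eq (I := 𝓡 (n + 1)) (I' := 𝓘(ℝ, ℝ))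
  have h4 := congrArg (fun L : EuclideanSpace ℝ (Fin (n + 1)) →L[ℝ] ℝ => L v) (h3.symm.trans h2)
  refine h4.trans ?_
  exact congrArg (fun L : EuclideanSpace ℝ (Fin (n + 1)) →L[ℝ] ℝ => L (chartD q q v))
    (mfderiv_eq_fderiv (f := funRep f q))

lemma dd_tdir_famRep {F : ℝ → S → M} {p : S} {q : M} {y : EuclideanSpace ℝ (Fin n)}
    (hy : y ∈ (extChartAt (𝓡 n) p).target)
    (hF : SmoothFamilyAt n F 0 ((extChartAt (𝓡 n) p).symm y))
    (hq : F 0 ((extChartAt (𝓡 n) p).symm y) ∈ (extChartAt (𝓡 (n + 1)) q).source) :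
    dd (tdir n) (famRep F p q) (0, y) = fieldRep (F 0) (velocity n F) p q (0, y) := by
  have h1 := ((contDiffAt_famRep hy hF hq).differentiableAt (by simp)).hasFDerivAt.comp_hasDerivAt
    (0 : ℝ) ((hasDerivAt_id (0 : ℝ)).prodMk (hasDerivAt_const (0 : ℝ) y))
  exact h1.unique (hasDerivAt_chart_velocity hF hq)

lemma cov_tdir_famRep (g : Metric (n + 1) M) {F : ℝ → S → M} {p : S} {q : M}
    {y : EuclideanSpace ℝ (Fin n)}
    (hy : y ∈ (extChartAt (𝓡 n) p).target)
    (hF : SmoothFamilyAt n F 0 ((extChartAt (𝓡 n) p).symm y))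
    (hq : F 0 ((extChartAt (𝓡 n) p).symm y) ∈ (extChartAt (𝓡 (n + 1)) q).source) :
    cov (chartConn g q) (famRep F p q) (tdir n) (dd (tdir n) (famRep F p q)) (0, y)
      = fieldRep (F 0) (acceleration g F) p q (0, y) := by
  rw [cov_tdir_eq_curveAcc (contDiffAt_famRep hy hF hq)]
  exact (chartD_acceleration g hF hq).symm

lemma isSmoothAlong_velocity {F : ℝ → S → M} (h : ∀ x, SmoothFamilyAt n F 0 x) :
    IsSmoothAlong (F 0) (velocity n F) := by
  intro x q hq
  have ht := mem_extChartAt_target (I := 𝓡 n) x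
  set y₀ := extChartAt (𝓡 n) x x with hy₀
  have hx : (extChartAt (𝓡 n) x).symm y₀ = x := extChartAt_to_inv x
  have hγ : ContDiffAt ℝ ∞ (famRep F x q) (0, y₀) :=
    contDiffAt_famRep ht (h _) (by rw [hx]; exact hq)
  refine contMDiffAt_of_chart (U := fun y => dd (tdir n) (famRep F x q) (0, y))
    (ContDiffAt.comp (f := fun y : EuclideanSpace ℝ (Fin n) => ((0 : ℝ), y)) y₀
      (contDiffAt_dd hγ (tdir n)) (contDiffAt_const.prodMk contDiffAt_id)) ?_
  have hqs : ∀ᶠ x' in 𝓝 x, F 0 x' ∈ (extChartAt (𝓡 (n + 1)) q).source :=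
    (h x).contMDiffAt.continuousAt.eventually ((isOpen_source q).mem_nhds hq)
  filter_upwards [hqs, extChartAt_source_mem_nhds (I := 𝓡 n) x] with x' h1 h2
  have e := (extChartAt (𝓡 n) x).left_inv h2
  rw [dd_tdir_famRep ((extChartAt (𝓡 n) x).map_source h2) (h _) (by rw [e]; exact h1)]
  simp only [fieldRep, e]

/-- The first variation integrand `(div V - df(V)) e^{-f}` of a vector field along `φ`. -/
def firstVariation (g : Metric (n + 1) M) (f : M → ℝ) (φ : S → M)
    (V : S → EuclideanSpace ℝ (Fin (n + 1))) (x : S) : ℝ :=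
  (tdiv (chartMetric g (φ x)) (chartConn g (φ x)) (baseRep φ x) (dirs n)
      (fieldRep φ V x (φ x)) (basePt n x)
    - fderiv ℝ (funRep f (φ x)) (baseRep φ x (basePt n x)) (fieldRep φ V x (φ x) (basePt n x)))
    * Real.exp (-f (φ x))

variable (g : Metric (n + 1) M) {f : M → ℝ} {F : ℝ → S → M}

lemma contDiffAt_famRep_basePt (h : ∀ x, SmoothFamilyAt n F 0 x) (x : S) :
    ContDiffAt ℝ ∞ (famRep F x (F 0 x)) (basePt n x) :=
  contDiffAt_famRep (mem_extChartAt_target x) (h _)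
    (by rw [extChartAt_to_inv]; exact mem_extChartAt_source _)

lemma SmoothFamilyAt.contMDiff (h : ∀ x, SmoothFamilyAt n F 0 x) :
    ContMDiff (𝓡 n) (𝓡 (n + 1)) ∞ (F 0) := fun x => (h x).contMDiffAt

lemma dd_dirs_famRep_basePt (h : ∀ x, SmoothFamilyAt n F 0 x) (x : S) (i : Fin n) :
    dd (dirs n i) (famRep F x (F 0 x)) (basePt n x) = dd (dirs n i) (baseRep (F 0) x) (basePt n x) :=
  dd_dirs_congr ((contDiffAt_famRep_basePt h x).differentiableAt (by simp))
    ((contDiffAt_baseRep (SmoothFamilyAt.contMDiff h) x).differentiableAt (by simp))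
    (Filter.Eventually.of_forall fun _ => rfl) i

lemma gram_famRep_basePt (h : ∀ x, SmoothFamilyAt n F 0 x) (x : S) :
    gram (chartMetric g (F 0 x)) (famRep F x (F 0 x)) (dirs n) (basePt n x)
      = gram (chartMetric g (F 0 x)) (baseRep (F 0) x) (dirs n) (basePt n x) := by
  ext i j
  simp only [gram, Matrix.of_apply, dd_dirs_famRep_basePt h]
  rfl

lemma eventually_basePt_space (h : ∀ x, SmoothFamilyAt n F 0 x) (x : S) :
    ∀ᶠ y in 𝓝 (extChartAt (𝓡 n) x x), y ∈ (extChartAt (𝓡 n) x).target ∧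
      F 0 ((extChartAt (𝓡 n) x).symm y) ∈ (extChartAt (𝓡 (n + 1)) (F 0 x)).source :=
  ((by fun_prop : Continuous fun y : EuclideanSpace ℝ (Fin n) => ((0 : ℝ), y)).tendsto
    _).eventually (eventually_basePt (SmoothFamilyAt.contMDiff h).continuous x)

/-- On the slice `t = 0` the time derivative of the family is the velocity field, and the tangential
divergence depends on that slice alone. The same argument applies to the acceleration below. -/
lemma tdiv_velocity_eq (h : ∀ x, SmoothFamilyAt n F 0 x) (x : S) :
    tdiv (chartMetric g (F 0 x)) (chartConn g (F 0 x)) (famRep F x (F 0 x)) (dirs n)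
      (dd (tdir n) (famRep F x (F 0 x))) (basePt n x)
    = tdiv (chartMetric g (F 0 x)) (chartConn g (F 0 x)) (baseRep (F 0) x) (dirs n)
      (fieldRep (F 0) (velocity n F) x (F 0 x)) (basePt n x) :=
  tdiv_congr _ _ ((contDiffAt_famRep_basePt h x).differentiableAt (by simp))
    ((contDiffAt_baseRep (SmoothFamilyAt.contMDiff h) x).differentiableAt (by simp))
    ((contDiffAt_dd (contDiffAt_famRep_basePt h x) _).differentiableAt (by simp))
    ((contDiffAt_fieldRep_basePt (isSmoothAlong_velocity h) x).differentiableAt (by simp))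
    (Filter.Eventually.of_forall fun _ => rfl)
    ((eventually_basePt_space h x).mono fun _ hy => dd_tdir_famRep hy.1 (h _) hy.2)

lemma tdiv_acceleration_eq (h : ∀ x, SmoothFamilyAt n F 0 x) (x : S) :
    tdiv (chartMetric g (F 0 x)) (chartConn g (F 0 x)) (famRep F x (F 0 x)) (dirs n)
      (cov (chartConn g (F 0 x)) (famRep F x (F 0 x)) (tdir n)
        (dd (tdir n) (famRep F x (F 0 x)))) (basePt n x)
    = tdiv (chartMetric g (F 0 x)) (chartConn g (F 0 x)) (baseRep (F 0) x) (dirs n)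
      (fieldRep (F 0) (acceleration g F) x (F 0 x)) (basePt n x) := by
  have hz : famRep F x (F 0 x) (basePt n x) ∈ (extChartAt (𝓡 (n + 1)) (F 0 x)).target :=
    mem_target_basePt (F 0) x
  exact tdiv_congr _ _ ((contDiffAt_famRep_basePt h x).differentiableAt (by simp))
    ((contDiffAt_baseRep (SmoothFamilyAt.contMDiff h) x).differentiableAt (by simp))
    ((contDiffAt_cov (contDiffAt_chartConn g hz)
      (contDiffAt_famRep_basePt h x) (contDiffAt_dd (contDiffAt_famRep_basePt h x) _)
      _).differentiableAt (by simp))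
    ((contDiffAt_fieldRep_basePt (isSmoothAlong_acceleration g h) x).differentiableAt (by simp))
    (Filter.Eventually.of_forall fun _ => rfl)
    ((eventually_basePt_space h x).mono fun _ hy => cov_tdir_famRep g hy.1 (h _) hy.2)

lemma funRep_basePt (f : M → ℝ) (φ : S → M) (x : S) :
    funRep f (φ x) (baseRep φ x (basePt n x)) = f (φ x) := by
  rw [baseRep_basePt, funRep, extChartAt_to_inv]

lemma weightedDensity_eventuallyEq (f : M → ℝ) (h0 : ∀ x, SmoothFamilyAt n F 0 x) {x : S}
    (h : ∀ᶠ r : ℝ × S in 𝓝 (0, x), SmoothFamilyAt n F r.1 r.2)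
    (hi : Function.Injective (mfderiv (𝓡 n) (𝓡 (n + 1)) (F 0) x)) :
    (fun t => weightedDensity g f F t x) =ᶠ[𝓝 0]
      density (chartMetric g (F 0 x)) (funRep f (F 0 x)) (famRep F x (F 0 x)) (dirs n) (tdir n)
        (basePt n x) := by
  have tl : Filter.Tendsto (fun t : ℝ => (t, x)) (𝓝 0) (𝓝 (0, x)) :=
    (by fun_prop : Continuous fun t : ℝ => (t, x)).tendsto 0
  have hs : ∀ᶠ r : ℝ × S in 𝓝 (0, x), F r.1 r.2 ∈ (extChartAt (𝓡 (n + 1)) (F 0 x)).source :=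
    (h0 x).continuousAt.eventually ((isOpen_source _).mem_nhds (mem_extChartAt_source (F 0 x)))
  have e := extChartAt_to_inv (I := 𝓡 n) x
  filter_upwards [tl.eventually h, tl.eventually hs] with t h1 h2
  have := weightedDensity_eq_density g f (p := x) (q := F 0 x) (F := F) (t := t)
    (mem_extChartAt_target x) (by rw [e]; exact h0 x) (by rw [e]; exact h1) (by rw [e]; exact hi)
    (by rw [e]; exact mem_extChartAt_source _) (by rw [e]; exact h2)
  rw [e] at this
  exact this

lemma gram_det_pos (h : ∀ x, SmoothFamilyAt n F 0 x) {x : S}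
    (hi : Function.Injective (mfderiv (𝓡 n) (𝓡 (n + 1)) (F 0) x)) :
    0 < (gram (chartMetric g (F 0 x)) (famRep F x (F 0 x)) (dirs n) (basePt n x)).det := by
  rw [gram_famRep_basePt g h, ← firstFF_eq_gram g (SmoothFamilyAt.contMDiff h)]
  exact det_metricMatrix_pos g (mem_extChartAt_target x) (by rw [extChartAt_to_inv]; exact hi)

/-- The first variation of the weighted area density. -/
lemma hasDerivAt_weightedDensity (hf : ContMDiff (𝓡 (n + 1)) 𝓘(ℝ, ℝ) ∞ f)
    (h0 : ∀ x, SmoothFamilyAt n F 0 x) {x : S}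
    (h : ∀ᶠ r : ℝ × S in 𝓝 (0, x), SmoothFamilyAt n F r.1 r.2)
    (hi : Function.Injective (mfderiv (𝓡 n) (𝓡 (n + 1)) (F 0) x)) :
    HasDerivAt (fun t => weightedDensity g f F t x) (firstVariation g f (F 0) (velocity n F) x) 0 := by
  have hz : famRep F x (F 0 x) (basePt n x) ∈ (extChartAt (𝓡 (n + 1)) (F 0 x)).target :=
    mem_target_basePt (F 0) x
  refine HasDerivAt.congr_of_eventuallyEq ?_ (weightedDensity_eventuallyEq g f h0 h hi)
  have hd := hasDerivAt_density (isLocalGeometry_chart g hz) (contDiffAt_famRep_basePt h0 x)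
    (contDiffAt_funRep hf hz) (dirs n) (tdir n) (gram_det_pos g h0 hi)
  have e := funRep_basePt (n := n) f (F 0) x
  have e2 : dd (tdir n) (famRep F x (F 0 x)) (basePt n x)
    = fieldRep (F 0) (velocity n F) x (F 0 x) (basePt n x) :=
    dd_tdir_famRep (mem_extChartAt_target x) (h0 _)
      (by rw [extChartAt_to_inv]; exact mem_extChartAt_source _)
  refine hd.congr_deriv ?_
  rw [tdiv_velocity_eq g h0, e2, firstVariation, ← e]
  rfl

variable {N : S → EuclideanSpace ℝ (Fin (n + 1))} {u : S → ℝ}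

/-- Checks the hypotheses of the coordinate computation, with `B i = ∇_i N` and `dlam` the partial
derivatives of `u`. -/
lemma isNormalVariationAt (h : ∀ x, SmoothFamilyAt n F 0 x) (hi : IsImmersedHypersurface n (F 0))
    (hN : IsUnitNormal g (F 0) N) (hu : ContMDiff (𝓡 n) 𝓘(ℝ, ℝ) ∞ u)
    (hv : ∀ x, velocity n F x = u x • N x) (x : S) :
    IsNormalVariationAt (chartMetric g (F 0 x)) (chartConn g (F 0 x)) (famRep F x (F 0 x)) (dirs n)
      (tdir n) (basePt n x) (fieldRep (F 0) N x (F 0 x) (basePt n x)) (normalCov g (F 0) N x) (u x)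
      (fun i => pd i (fun y => u ((extChartAt (𝓡 n) x).symm y)) (extChartAt (𝓡 n) x x)) := by
  have ht := mem_extChartAt_target (I := 𝓡 n) x
  have hb : famRep F x (F 0 x) (basePt n x) = baseRep (F 0) x (basePt n x) := rfl
  have hf0 : ∀ r, fieldRep (F 0) (velocity n F) x (F 0 x) r
      = u ((extChartAt (𝓡 n) x).symm r.2) • fieldRep (F 0) N x (F 0 x) r := fun r => by
    simp only [fieldRep, hv, map_smul]
  -- The velocity is `u N` at `t = 0` only; this suffices, since just its space derivatives are
  -- taken.
  have hvel : ∀ᶠ y in 𝓝 (extChartAt (𝓡 n) x x), dd (tdir n) (famRep F x (F 0 x)) ((0 : ℝ), y)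
      = u ((extChartAt (𝓡 n) x).symm y) • fieldRep (F 0) N x (F 0 x) ((0 : ℝ), y) :=
    (eventually_basePt_space h x).mono fun y hy =>
      (dd_tdir_famRep hy.1 (h _) hy.2).trans (hf0 (0, y))
  have hN' := (contDiffAt_fieldRep_basePt (hN.isSmoothAlong hi.smooth) x).differentiableAt
    (n := ∞) (by simp)
  have hu' : DifferentiableAt ℝ (fun y => u ((extChartAt (𝓡 n) x).symm y)) (extChartAt (𝓡 n) x x) :=
    (ContMDiffAt.comp (g := u) _ (hu _) (contMDiffAt_chart_symm ht)).contDiffAt.differentiableAt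
      (n := ∞) (by simp)
  have hu2 : HasFDerivAt (fun r : ℝ × EuclideanSpace ℝ (Fin n) => u ((extChartAt (𝓡 n) x).symm r.2))
      ((fderiv ℝ (fun y => u ((extChartAt (𝓡 n) x).symm y)) (extChartAt (𝓡 n) x x)).comp
        (ContinuousLinearMap.snd ℝ ℝ (EuclideanSpace ℝ (Fin n)))) (basePt n x) :=
    HasFDerivAt.comp (g := fun y => u ((extChartAt (𝓡 n) x).symm y)) (basePt n x)
      hu'.hasFDerivAt hasFDerivAt_snd
  have hprod := hu2.smul hN'.hasFDerivAt
  have hx := extChartAt_to_inv (I := 𝓡 n) x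
  have hx' : u ((extChartAt (𝓡 n) x).symm (basePt n x).2) = u x := congrArg u hx
  refine ⟨?_, ?_, fun i => ?_, fun i => ?_, fun i j => ?_⟩
  · simp only [dd_dirs_famRep_basePt h]
    exact hN.isAdaptedFrame hi x
  · have := hvel.self_of_nhds
    rw [hx] at this
    exact this
  -- Leibniz rule: `∇_i (u N) = (∂_i u) N + u ∇_i N`.
  · have e1 : dd (dirs n i) (dd (tdir n) (famRep F x (F 0 x))) (basePt n x)
        = dd (dirs n i) (fun r : ℝ × EuclideanSpace ℝ (Fin n) =>
          u ((extChartAt (𝓡 n) x).symm r.2) • fieldRep (F 0) N x (F 0 x) r) (basePt n x) :=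
      dd_dirs_congr ((contDiffAt_dd (contDiffAt_famRep_basePt h x) _).differentiableAt (by simp))
        hprod.differentiableAt hvel i
    have e2 : dd (dirs n i) (fun r : ℝ × EuclideanSpace ℝ (Fin n) =>
          u ((extChartAt (𝓡 n) x).symm r.2) • fieldRep (F 0) N x (F 0 x) r) (basePt n x)
        = u x • dd (dirs n i) (fieldRep (F 0) N x (F 0 x)) (basePt n x)
          + pd i (fun y => u ((extChartAt (𝓡 n) x).symm y)) (extChartAt (𝓡 n) x x) •
            fieldRep (F 0) N x (F 0 x) (basePt n x) := by
      refine (congrArg (fun L => L (dirs n i)) hprod.fderiv).trans ?_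
      simp only [add_apply, smul_apply, ContinuousLinearMap.smulRight_apply, hx']
      rfl
    have e3 : dd (tdir n) (famRep F x (F 0 x)) (basePt n x)
        = u x • fieldRep (F 0) N x (F 0 x) (basePt n x) := by
      have := hvel.self_of_nhds
      rw [hx] at this
      exact this
    rw [cov, e1, e2, e3, dd_dirs_famRep_basePt h, hb, normalCov, cov, map_smul]
    module
  · rw [hb]; exact hN.inner_normalCov hi.smooth x i
  · rw [hb, dd_dirs_famRep_basePt h, dd_dirs_famRep_basePt h]
    exact hN.shape_symm hi.smooth x i j

lemma shape_famRep_basePt (h : ∀ x, SmoothFamilyAt n F 0 x) (hi : IsImmersedHypersurface n (F 0))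
    (hN : IsUnitNormal g (F 0) N) (x : S) :
    IsNormalVariationAt.shape (chartMetric g (F 0 x)) (famRep F x (F 0 x)) (dirs n) (basePt n x)
      (normalCov g (F 0) N x) = secondFF g (F 0) N x := by
  rw [secondFF_eq hN hi.smooth]
  ext i j
  simp only [IsNormalVariationAt.shape, Matrix.of_apply, dd_dirs_famRep_basePt h]
  rfl

/-- The derivative `f_n` of `f` in the direction of `N`. -/
def normalDeriv (f : M → ℝ) (φ : S → M) (N : S → EuclideanSpace ℝ (Fin (n + 1))) (x : S) : ℝ :=
  (mfderiv (𝓡 (n + 1)) 𝓘(ℝ, ℝ) f (φ x) : EuclideanSpace ℝ (Fin (n + 1)) →L[ℝ] ℝ) (N x)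

lemma fderiv_funRep_normal (hf : ContMDiff (𝓡 (n + 1)) 𝓘(ℝ, ℝ) ∞ f) (φ : S → M)
    (N : S → EuclideanSpace ℝ (Fin (n + 1))) (x : S) :
    fderiv ℝ (funRep f (φ x)) (baseRep φ x (basePt n x)) (fieldRep φ N x (φ x) (basePt n x))
      = normalDeriv f φ N x := by
  rw [baseRep_basePt, fieldRep_basePt]
  exact (mfderiv_eq_funRep hf _ _).symm

lemma firstVariation_normal (hf : ContMDiff (𝓡 (n + 1)) 𝓘(ℝ, ℝ) ∞ f)
    (h : ∀ x, SmoothFamilyAt n F 0 x) (hi : IsImmersedHypersurface n (F 0))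
    (hN : IsUnitNormal g (F 0) N) (hu : ContMDiff (𝓡 n) 𝓘(ℝ, ℝ) ∞ u)
    (hv : ∀ x, velocity n F x = u x • N x) (x : S) :
    firstVariation g f (F 0) (velocity n F) x
      = u x * (meanCurvature g (F 0) N x - normalDeriv f (F 0) N x) * Real.exp (-f (F 0 x)) := by
  have hNV := isNormalVariationAt g h hi hN hu hv x
  have e2 : fieldRep (F 0) (velocity n F) x (F 0 x) (basePt n x)
      = u x • fieldRep (F 0) N x (F 0 x) (basePt n x) := by
    simp only [fieldRep_basePt, hv, map_smul]
  rw [firstVariation, ← tdiv_velocity_eq g h, hNV.tdiv_velocity, e2, map_smul,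
    fderiv_funRep_normal hf, gram_famRep_basePt g h, shape_famRep_basePt g h hi hN,
    ← firstFF_eq_gram g hi.smooth, smul_eq_mul, ← mul_sub]
  rfl

/-- The second variation of the weighted area density, for a normal variation. -/
lemma hasDerivAt_deriv_weightedDensity (hf : ContMDiff (𝓡 (n + 1)) 𝓘(ℝ, ℝ) ∞ f)
    (h0 : ∀ x, SmoothFamilyAt n F 0 x) (hi : IsImmersedHypersurface n (F 0))
    (hN : IsUnitNormal g (F 0) N) (hu : ContMDiff (𝓡 n) 𝓘(ℝ, ℝ) ∞ u)
    (hv : ∀ x, velocity n F x = u x • N x) {x : S}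
    (h : ∀ᶠ r : ℝ × S in 𝓝 (0, x), SmoothFamilyAt n F r.1 r.2) :
    HasDerivAt (deriv fun t => weightedDensity g f F t x)
      ((u x * (meanCurvature g (F 0) N x - normalDeriv f (F 0) N x)) ^ 2 * Real.exp (-f (F 0 x))
        + firstVariation g f (F 0) (acceleration g F) x + stabilityIntegrand g f (F 0) N u x) 0 := by
  have hz : famRep F x (F 0 x) (basePt n x) ∈ (extChartAt (𝓡 (n + 1)) (F 0 x)).target :=
    mem_target_basePt (F 0) x
  have hev := weightedDensity_eventuallyEq g f h0 h (hi.injective x)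
  refine HasDerivAt.congr_of_eventuallyEq ?_ hev.deriv
  have hd := (isNormalVariationAt g h0 hi hN hu hv x).hasDerivAt_deriv_density (by simp)
    (isLocalGeometry_chart g hz) (contDiffAt_famRep_basePt h0 x) (contDiffAt_funRep hf hz)
    (gram_det_pos g h0 (hi.injective x))
  refine hd.congr_deriv ?_
  have hb : famRep F x (F 0 x) (basePt n x) = baseRep (F 0) x (basePt n x) := rfl
  have e2 : cov (chartConn g (F 0 x)) (famRep F x (F 0 x)) (tdir n)
        (dd (tdir n) (famRep F x (F 0 x))) (basePt n x)
    = fieldRep (F 0) (acceleration g F) x (F 0 x) (basePt n x) :=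
    cov_tdir_famRep g (mem_extChartAt_target x) (h0 _)
      (by rw [extChartAt_to_inv]; exact mem_extChartAt_source _)
  have e3 := normSqSecondFF_eq hN hi x
  rw [← firstFF_eq_gram g hi.smooth, ← secondFF_eq hN hi.smooth] at e3
  have e4 := ricciF_eq g hf (F 0 x) (N x)
  have e5 : stabilityIntegrand g f (F 0) N u x
    = (normSqGrad g (F 0) u x - u x ^ 2 * (ricciF g f (F 0 x) (N x) (N x)
      + normSqSecondFF g (F 0) N x)) * Real.exp (-f (F 0 x)) := rfl
  have e6 : meanCurvature g (F 0) N x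
    = ∑ i, ∑ j, (firstFF g (F 0) x)⁻¹ i j * secondFF g (F 0) N x i j := rfl
  rw [tdiv_acceleration_eq g h0, e2, gram_famRep_basePt g h0, shape_famRep_basePt g h0 hi hN, hb,
    funRep_basePt, fderiv_funRep_normal hf, ← firstFF_eq_gram g hi.smooth, ← e3, e5, e4, e6,
    normSqGrad, firstVariation, fieldRep_basePt (F 0) N, fieldRep_basePt, baseRep_basePt]
  ring

end DensityVariation

/-! ### Variation of the weighted area -/

section AreaVariation

open MeasureTheory

variable {n : ℕ}
  {M : Type*} [TopologicalSpace M] [ChartedSpace (EuclideanSpace ℝ (Fin (n + 1))) M]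
  [IsManifold (𝓡 (n + 1)) ∞ M]
  {S : Type*} [TopologicalSpace S] [T2Space S] [SecondCountableTopology S]
  [ChartedSpace (EuclideanSpace ℝ (Fin n)) S] [IsManifold (𝓡 n) ∞ S] [MeasurableSpace S]
  [BorelSpace S] (g : Metric (n + 1) M) {f : M → ℝ} {φ : S → M} {F : ℝ → S → M} {K : Set S}

lemma SmoothDensityAt.continuous {D : ℝ → S → ℝ} (h : ∀ x, SmoothDensityAt n D x) :
    Continuous (D 0) :=
  continuous_iff_continuousAt.2 fun x =>
    ContinuousAt.comp (g := fun r : ℝ × S => D r.1 r.2) (f := fun x => (0, x)) (x := x)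
      (h x).eventually_continuousAt.self_of_nhds (by fun_prop)

lemma IsVariation.smoothDensityAt (h : IsVariation n φ F K) (hφ : IsImmersedHypersurface n φ)
    (hf : ContMDiff (𝓡 (n + 1)) 𝓘(ℝ, ℝ) ∞ f) (x : S) :
    SmoothDensityAt n (weightedDensity g f F) x := by
  obtain rfl := h.zero
  exact smoothDensityAt_weightedDensity g hf hφ.injective
    (fun x => (h.eventually_smooth x).self_of_nhds) (h.eventually_smooth x)

lemma IsVariation.eventually_weightedArea (h : IsVariation n φ F K)
    (hφ : IsImmersedHypersurface n φ) (f : M → ℝ) :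
    ∀ᶠ t in 𝓝 (0 : ℝ), weightedArea g f (F t) K
      = ∫ x in K, weightedDensity g f F t x ∂(areaMeasure g φ) := by
  obtain rfl := h.zero
  exact h.eventually_contMDiff.mono fun t ht => weightedArea_eq g f hφ ht h.compact

lemma IsVariation.hasDerivAt_weightedArea (h : IsVariation n φ F K)
    (hφ : IsImmersedHypersurface n φ) (hf : ContMDiff (𝓡 (n + 1)) 𝓘(ℝ, ℝ) ∞ f) :
    ∀ᶠ t in 𝓝 (0 : ℝ), HasDerivAt (fun t => weightedArea g f (F t) K)
      (∫ x in K, deriv (fun s => weightedDensity g f F s x) t ∂(areaMeasure g φ)) t := by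
  have := isLocallyFiniteMeasure_areaMeasure g hφ
  filter_upwards [(h.eventually_weightedArea g hφ f).eventually_nhds,
    hasDerivAt_setIntegral (h.smoothDensityAt g hφ hf) (μ := areaMeasure g φ) h.compact] with t h1 h2
  exact h2.congr_of_eventuallyEq h1

/-- Near `0` the first derivative is again an integral of a smooth density over `K`, so the same
differentiation theorem applies. -/
lemma IsVariation.hasDerivAt_deriv_weightedArea (h : IsVariation n φ F K)
    (hφ : IsImmersedHypersurface n φ) (hf : ContMDiff (𝓡 (n + 1)) 𝓘(ℝ, ℝ) ∞ f) :
    HasDerivAt (deriv fun t => weightedArea g f (F t) K)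
      (∫ x in K, deriv (deriv fun s => weightedDensity g f F s x) 0 ∂(areaMeasure g φ)) 0 := by
  have := isLocallyFiniteMeasure_areaMeasure g hφ
  have h1 := (hasDerivAt_setIntegral (fun x => (h.smoothDensityAt g hφ hf x).deriv)
    (μ := areaMeasure g φ) h.compact).self_of_nhds
  exact h1.congr_of_eventuallyEq ((h.hasDerivAt_weightedArea g hφ hf).mono fun t ht => ht.deriv)

lemma IsVariation.deriv_weightedDensity (h : IsVariation n φ F K)
    (hφ : IsImmersedHypersurface n φ) (hf : ContMDiff (𝓡 (n + 1)) 𝓘(ℝ, ℝ) ∞ f) (x : S) :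
    deriv (fun s => weightedDensity g f F s x) 0 = firstVariation g f φ (velocity n F) x := by
  obtain rfl := h.zero
  exact (hasDerivAt_weightedDensity g hf (fun x => (h.eventually_smooth x).self_of_nhds)
    (h.eventually_smooth x) (hφ.injective x)).deriv

/-- The defining formula uses a chart depending on `x`, so continuity is obtained from the time
derivative of the smooth density instead. -/
lemma IsVariation.continuous_firstVariation (h : IsVariation n φ F K)
    (hφ : IsImmersedHypersurface n φ) (hf : ContMDiff (𝓡 (n + 1)) 𝓘(ℝ, ℝ) ∞ f) :
    Continuous (firstVariation g f φ (velocity n F)) := by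
  have := SmoothDensityAt.continuous fun x => (h.smoothDensityAt g hφ hf x).deriv
  exact this.congr (h.deriv_weightedDensity g hφ hf)

/-- The divergence involves a derivative of `V`, hence the assumption that `V` vanishes near `x` and
not merely at `x`. -/
lemma firstVariation_eq_zero {V : S → EuclideanSpace ℝ (Fin (n + 1))} {x : S} (f : M → ℝ)
    (φ : S → M) (h : ∀ᶠ x' in 𝓝 x, V x' = 0) : firstVariation g f φ V x = 0 := by
  have ht := mem_extChartAt_target (I := 𝓡 n) x
  have ev : ∀ᶠ r in 𝓝 (basePt n x), fieldRep φ V x (φ x) r = 0 := by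
    have c := (contMDiffAt_chart_symm ht).continuousAt
    rw [ContinuousAt, extChartAt_to_inv] at c
    have h1 : ∀ᶠ y in 𝓝 (extChartAt (𝓡 n) x x), V ((extChartAt (𝓡 n) x).symm y) = 0 :=
      c.eventually h
    filter_upwards [(continuous_snd.tendsto (basePt n x)).eventually h1] with r hr
    rw [fieldRep, hr, map_zero]
  have h0 := ev.self_of_nhds
  have hc : ∀ i, cov (chartConn g (φ x)) (baseRep φ x) (dirs n i) (fieldRep φ V x (φ x))
      (basePt n x) = 0 := fun i => by
    rw [cov, dd_const_eventually ev, h0, map_zero, add_zero]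
  simp only [firstVariation, tdiv, hc, h0, map_zero, zero_apply, mul_zero, Finset.sum_const_zero,
    sub_zero, zero_mul]

lemma IsVariation.velocity_eq_zero (h : IsVariation n φ F K) {x : S} (hx : x ∉ K) :
    velocity n F x = 0 := by
  have e : (fun t => F t x) =ᶠ[𝓝 0] fun _ => φ x := h.eventually_fixed.mono fun t ht => ht x hx
  have h1 := e.mfderiv_eq (I := 𝓘(ℝ, ℝ)) (I' := 𝓡 (n + 1))
  exact (congrArg (fun L : ℝ →L[ℝ] EuclideanSpace ℝ (Fin (n + 1)) => L 1) h1).trans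
    (velocity_const φ x)

lemma IsVariation.acceleration_eq_zero (h : IsVariation n φ F K) {x : S} (hx : x ∉ K) :
    acceleration g F x = 0 :=
  WeightedHypersurface.acceleration_eq_zero g (h.eventually_fixed.mono fun t ht => by
    rw [ht x hx, h.zero])

lemma setIntegral_firstVariation {V : S → EuclideanSpace ℝ (Fin (n + 1))} (hK : IsCompact K)
    (hV : ∀ x ∉ K, V x = 0) (f : M → ℝ) (φ : S → M) :
    ∫ x in K, firstVariation g f φ V x ∂(areaMeasure g φ)
      = ∫ x, firstVariation g f φ V x ∂(areaMeasure g φ) :=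
  setIntegral_eq_integral_of_forall_compl_eq_zero fun x hx =>
    firstVariation_eq_zero g f φ (by
      filter_upwards [hK.isClosed.isOpen_compl.mem_nhds hx] with x' hx'
      exact hV x' hx')

lemma exists_isVariation (g : Metric (n + 1) M) (hφ : IsImmersedHypersurface n φ)
    {V : S → EuclideanSpace ℝ (Fin (n + 1))} (hV : IsSmoothAlong φ V) (hc : HasCompactSupport V) :
    ∃ F K, IsVariation n φ F K ∧ ∀ x, velocity n F x = V x := by
  obtain ⟨F, K, hF, hv⟩ := exists_localVariation hφ.smooth hV hc
  exact ⟨F, K, hF.isVariation g hφ, hv⟩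

/-- `V` is realised as the velocity of a variation, to which minimality applies. Tangential
components are allowed, as needed for the acceleration; continuity is recorded as well, for
integrability. -/
lemma IsFMinimal.integral_firstVariation (hmin : IsFMinimal g f φ)
    (hφ : IsImmersedHypersurface n φ) (hf : ContMDiff (𝓡 (n + 1)) 𝓘(ℝ, ℝ) ∞ f)
    {V : S → EuclideanSpace ℝ (Fin (n + 1))} (hV : IsSmoothAlong φ V) (hc : HasCompactSupport V) :
    ∫ x, firstVariation g f φ V x ∂(areaMeasure g φ) = 0 ∧
      Continuous (firstVariation g f φ V) := by
  obtain ⟨F, K, hF, hv⟩ := exists_isVariation g hφ hV hc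
  obtain rfl : velocity n F = V := funext hv
  refine ⟨?_, hF.continuous_firstVariation g hφ hf⟩
  rw [← setIntegral_firstVariation g hF.compact (fun x hx => hF.velocity_eq_zero hx)]
  have h1 := (hF.hasDerivAt_weightedArea g hφ hf).self_of_nhds
  simp only [hF.deriv_weightedDensity g hφ hf] at h1
  exact h1.unique (hmin F K hF)

variable {N : S → EuclideanSpace ℝ (Fin (n + 1))} {u : S → ℝ}

lemma IsUnitNormal.isSmoothAlong_smul {g : Metric (n + 1) M} (hN : IsUnitNormal g φ N)
    (hφ : IsImmersedHypersurface n φ) (hu : ContMDiff (𝓡 n) 𝓘(ℝ, ℝ) ∞ u) :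
    IsSmoothAlong φ (fun x => u x • N x) := fun x q hq => by
  simp only [map_smul]
  exact (hu x).smul (hN.isSmoothAlong hφ.smooth x q hq)

/-- Fundamental lemma of the calculus of variations, applied to `k = (H - f_n) e^{-f}` with the
normal fields `u N`. -/
lemma IsFMinimal.meanCurvature_eq (hmin : IsFMinimal g f φ)
    (hφ : IsImmersedHypersurface n φ) (hf : ContMDiff (𝓡 (n + 1)) 𝓘(ℝ, ℝ) ∞ f)
    (hN : IsUnitNormal g φ N) (x : S) : meanCurvature g φ N x = normalDeriv f φ N x := by
  have := isLocallyFiniteMeasure_areaMeasure g hφ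
  have := isOpenPosMeasure_areaMeasure g hφ
  have : LocallyCompactSpace S := ChartedSpace.locallyCompactSpace (EuclideanSpace ℝ (Fin n)) S
  have : SigmaCompactSpace S := sigmaCompactSpace_of_locallyCompact_secondCountable
  set k : S → ℝ := fun x =>
    (meanCurvature g φ N x - normalDeriv f φ N x) * Real.exp (-f (φ x)) with hk
  have fv : ∀ u : S → ℝ, ContMDiff (𝓡 n) 𝓘(ℝ, ℝ) ∞ u → HasCompactSupport u →
      ∫ x, u x * k x ∂(areaMeasure g φ) = 0 ∧ Continuous fun x => u x * k x := by
    intro u hu hc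
    have hV := hN.isSmoothAlong_smul hφ hu
    have hVc : HasCompactSupport fun x => u x • N x := hc.smul_right
    obtain ⟨F, K, hF, hv⟩ := exists_isVariation g hφ hV hVc
    have e : firstVariation g f φ (fun x => u x • N x) = fun x => u x * k x := by
      rw [← funext hv]
      obtain rfl := hF.zero
      ext x
      rw [firstVariation_normal g hf (fun x => (hF.eventually_smooth x).self_of_nhds) hφ hN hu hv,
        mul_assoc]
    have := hmin.integral_firstVariation g hφ hf hV hVc
    rwa [e] at this
  -- Near `x`, `k` equals `u k` for a bump function `u`, and `u k` is a first variation integrand,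
  -- hence continuous.
  have hkc : Continuous k := by
    refine continuous_iff_continuousAt.2 fun x => ?_
    obtain ⟨b⟩ : Nonempty (SmoothBumpFunction (𝓡 n) x) := inferInstance
    refine ((fv b b.contMDiff b.hasCompactSupport).2.continuousAt (x := x)).congr ?_
    filter_upwards [b.eventuallyEq_one] with x' hx'
    rw [hx', Pi.one_apply, one_mul]
  have h0 : ∀ᵐ x ∂(areaMeasure g φ), k x = 0 :=
    ae_eq_zero_of_integral_contMDiff_smul_eq_zero (𝓡 n) hkc.locallyIntegrable
      fun u hu hc => (fv u hu hc).1
  -- Area charges every nonempty open set, so a continuous function vanishing almost everywhere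
  -- vanishes identically.
  have h1 : k = fun _ => 0 := (hkc.ae_eq_iff_eq (areaMeasure g φ) continuous_const).1 h0
  have h2 : k x = 0 := congrFun h1 x
  exact sub_eq_zero.1 ((mul_eq_zero.1 h2).resolve_right (Real.exp_pos _).ne')

lemma stabilityIntegrand_eq_zero (f : M → ℝ) (φ : S → M) (N : S → EuclideanSpace ℝ (Fin (n + 1)))
    {x : S} (h : ∀ᶠ x' in 𝓝 x, u x' = 0) : stabilityIntegrand g f φ N u x = 0 := by
  have ht := mem_extChartAt_target (I := 𝓡 n) x
  have c := (contMDiffAt_chart_symm ht).continuousAt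
  rw [ContinuousAt, extChartAt_to_inv] at c
  have h1 : (fun y => u ((extChartAt (𝓡 n) x).symm y)) =ᶠ[𝓝 (extChartAt (𝓡 n) x x)] fun _ => 0 :=
    c.eventually h
  have h2 : ∀ i, pd i (fun y => u ((extChartAt (𝓡 n) x).symm y)) (extChartAt (𝓡 n) x x) = 0 :=
    fun i => by rw [pd, h1.fderiv_eq]; simp
  have e : stabilityIntegrand g f φ N u x
    = (normSqGrad g φ u x - u x ^ 2 * (ricciF g f (φ x) (N x) (N x)
      + normSqSecondFF g φ N x)) * Real.exp (-f (φ x)) := rfl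
  rw [e, h.self_of_nhds]
  simp only [normSqGrad, h2, mul_zero, Finset.sum_const_zero]
  simp

lemma IsUnitNormal.ne_zero {g : Metric (n + 1) M} (hN : IsUnitNormal g φ N) (x : S) : N x ≠ 0 := by
  intro h
  have h1 : (0 : ℝ) = 1 := by
    refine Eq.trans ?_ (hN.unit x)
    refine Eq.symm ((congrArg (fun v => g.inner (φ x) v v) h).trans ?_)
    exact congrArg (fun L : EuclideanSpace ℝ (Fin (n + 1)) →L[ℝ] ℝ => L 0)
        (map_zero (@id (EuclideanSpace ℝ (Fin (n + 1)) →L[ℝ] EuclideanSpace ℝ (Fin (n + 1)) →L[ℝ] ℝ)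
          (g.inner (φ x))))
  exact zero_ne_one h1

/-- The velocity `u N` vanishes off `K` and `N` has no zeros, so the support of `u` is controlled by
`K`. -/
lemma IsVariation.eventually_eq_zero (h : IsVariation n φ F K) (hN : IsUnitNormal g φ N)
    (hv : ∀ x, velocity n F x = u x • N x) {x : S} (hx : x ∉ K) : ∀ᶠ x' in 𝓝 x, u x' = 0 := by
  filter_upwards [h.compact.isClosed.isOpen_compl.mem_nhds hx] with x' hx'
  have := (hv x').symm.trans (h.velocity_eq_zero hx')
  exact (smul_eq_zero.1 this).resolve_right (hN.ne_zero x')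

/-- The second variation of the weighted area, for a normal variation of an `f`-minimal
hypersurface. -/
lemma IsFMinimal.hasDerivAt_deriv_weightedArea (hmin : IsFMinimal g f φ)
    (hφ : IsImmersedHypersurface n φ) (hf : ContMDiff (𝓡 (n + 1)) 𝓘(ℝ, ℝ) ∞ f)
    (hN : IsUnitNormal g φ N) (hu : ContMDiff (𝓡 n) 𝓘(ℝ, ℝ) ∞ u) (h : IsVariation n φ F K)
    (hv : ∀ x, velocity n F x = u x • N x) :
    Integrable (stabilityIntegrand g f φ N u) (areaMeasure g φ) ∧
    HasDerivAt (deriv fun t => weightedArea g f (F t) K)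
      (∫ x, stabilityIntegrand g f φ N u x ∂(areaMeasure g φ)) 0 := by
  have := isLocallyFiniteMeasure_areaMeasure g hφ
  have hH := hmin.meanCurvature_eq g hφ hf hN
  have hs : ∀ x ∉ K, stabilityIntegrand g f φ N u x = 0 := fun x hx =>
    stabilityIntegrand_eq_zero g f φ N (h.eventually_eq_zero g hN hv hx)
  have hacc : IsSmoothAlong φ (acceleration g F) := by
    have := isSmoothAlong_acceleration g (F := F) fun x => (h.eventually_smooth x).self_of_nhds
    rwa [h.zero] at this
  have haccK : ∀ x ∉ K, acceleration g F x = 0 := fun x hx => h.acceleration_eq_zero g hx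
  obtain ⟨hint, hcont⟩ := hmin.integral_firstVariation g hφ hf hacc
    (HasCompactSupport.intro h.compact haccK)
  -- The square `(u (H - f_n))²` in the second derivative vanishes by `hH`.
  have hD : ∀ x, deriv (deriv fun s => weightedDensity g f F s x) 0
      = firstVariation g f φ (acceleration g F) x + stabilityIntegrand g f φ N u x := by
    intro x
    obtain rfl := h.zero
    rw [(hasDerivAt_deriv_weightedDensity g hf (fun x => (h.eventually_smooth x).self_of_nhds) hφ hN
      hu hv (h.eventually_smooth x)).deriv, hH x]
    ring
  have hDc : Continuous fun x => deriv (deriv fun s => weightedDensity g f F s x) 0 :=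
    SmoothDensityAt.continuous fun x => (h.smoothDensityAt g hφ hf x).deriv.deriv
  -- The integrand is continuous as the difference of two functions already known to be continuous;
  -- its own formula uses a chart that moves with `x`.
  have hsc : Continuous (stabilityIntegrand g f φ N u) :=
    (hDc.sub hcont).congr fun x => by rw [Pi.sub_apply, hD x]; ring
  have hi : Integrable (stabilityIntegrand g f φ N u) (areaMeasure g φ) :=
    hsc.integrable_of_hasCompactSupport (HasCompactSupport.intro h.compact hs)
  refine ⟨hi, (h.hasDerivAt_deriv_weightedArea g hφ hf).congr_deriv ?_⟩
  simp only [hD]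
  -- The acceleration term integrates to zero by minimality. Both integrands vanish off `K`, so
  -- integrals over `K` and over the whole hypersurface agree.
  rw [integral_add (hcont.continuousOn.integrableOn_compact h.compact) hi.integrableOn,
    setIntegral_firstVariation g h.compact haccK, hint, zero_add]
  exact setIntegral_eq_integral_of_forall_compl_eq_zero hs

end AreaVariation

end WeightedHypersurface

end

/-! ### ### The main theorem: `H = f_n`, the second variation formula and stability -/

open WeightedHypersurface
theorem corollary1 {n : ℕ}
    {M : Type*} [TopologicalSpace M] [T2Space M] [SecondCountableTopology M]
    [ChartedSpace (EuclideanSpace ℝ (Fin (n + 1))) M] [IsManifold (𝓡 (n + 1)) ∞ M]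
    {S : Type*} [TopologicalSpace S] [T2Space S] [SecondCountableTopology S]
    [ChartedSpace (EuclideanSpace ℝ (Fin n)) S] [IsManifold (𝓡 n) ∞ S]
    [MeasurableSpace S] [BorelSpace S]
    (g : WeightedHypersurface.Metric (n + 1) M)
    (f : M → ℝ) (hf : ContMDiff (𝓡 (n + 1)) 𝓘(ℝ, ℝ) ∞ f)
    (φ : S → M) (hφ : IsImmersedHypersurface n φ)
    (N : ∀ x : S, TangentSpace (𝓡 (n + 1)) (φ x)) (hN : IsUnitNormal g φ N)
    (hmin : IsFMinimal g f φ) :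
    -- `H = f_n`
    (∀ x, meanCurvature g φ N x = mfderiv (𝓡 (n + 1)) 𝓘(ℝ, ℝ) f (φ x) (N x)) ∧
    -- the second variation formula
    (∀ u : S → ℝ, ContMDiff (𝓡 n) 𝓘(ℝ, ℝ) ∞ u → HasCompactSupport u →
      MeasureTheory.Integrable (stabilityIntegrand g f φ N u) (areaMeasure g φ) ∧
      ∀ (F : ℝ → S → M) (K : Set S), IsVariation n φ F K →
        HasInitialVelocity φ F (fun x => u x • N x) →
          (∀ᶠ t in 𝓝 0, DifferentiableAt ℝ (fun s => weightedArea g f (F s) K) t) ∧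
          HasDerivAt (deriv fun t => weightedArea g f (F t) K)
            (∫ x, stabilityIntegrand g f φ N u x ∂(areaMeasure g φ)) 0) ∧
    -- stability
    (IsStable g f φ N ↔
      ∀ u : S → ℝ, ContMDiff (𝓡 n) 𝓘(ℝ, ℝ) ∞ u → HasCompactSupport u →
        0 ≤ ∫ x, stabilityIntegrand g f φ N u x ∂(areaMeasure g φ)) := by

  -- Existence of a variation for every `u` is needed twice: integrability of the integrand is
  -- extracted from such a variation, and stability yields the inequality for `u` only through one.
  have h2 : ∀ u : S → ℝ, ContMDiff (𝓡 n) 𝓘(ℝ, ℝ) ∞ u → HasCompactSupport u →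
      ∃ F K, IsVariation n φ F K ∧ HasInitialVelocity φ F (fun x => u x • N x) := by
    intro u hu hc
    have hc' : HasCompactSupport fun x => (u x • N x : EuclideanSpace ℝ (Fin (n + 1))) :=
      HasCompactSupport.intro (K := tsupport u) hc fun x hx => by
        rw [image_eq_zero_of_notMem_tsupport hx]; exact zero_smul ℝ (N x)
    obtain ⟨F, K, hF, hv⟩ := exists_isVariation g hφ (hN.isSmoothAlong_smul hφ hu) hc'
    exact ⟨F, K, hF, (hasInitialVelocity_iff hF.zero _).2 hv⟩
  have h3 : ∀ u : S → ℝ, ContMDiff (𝓡 n) 𝓘(ℝ, ℝ) ∞ u → ∀ (F : ℝ → S → M) (K : Set S),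
      IsVariation n φ F K → HasInitialVelocity φ F (fun x => u x • N x) →
      MeasureTheory.Integrable (stabilityIntegrand g f φ N u) (areaMeasure g φ) ∧
      HasDerivAt (deriv fun t => weightedArea g f (F t) K)
        (∫ x, stabilityIntegrand g f φ N u x ∂(areaMeasure g φ)) 0 := fun u hu F K hF hv =>
    hmin.hasDerivAt_deriv_weightedArea g hφ hf hN hu hF ((hasInitialVelocity_iff hF.zero _).1 hv)
  refine ⟨fun x => hmin.meanCurvature_eq g hφ hf hN x, fun u hu hc => ⟨?_, fun F K hF hv =>
    ⟨(hF.hasDerivAt_weightedArea g hφ hf).mono fun t ht => ht.differentiableAt,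
      (h3 u hu F K hF hv).2⟩⟩, fun hst u hu hc => ?_, fun hpos u hu hc F K hF hv => ?_⟩
  · obtain ⟨F, K, hF, hv⟩ := h2 u hu hc
    exact (h3 u hu F K hF hv).1
  · obtain ⟨F, K, hF, hv⟩ := h2 u hu hc
    rw [← (h3 u hu F K hF hv).2.deriv]
    exact hst u hu hc F K hF hv
  · rw [(h3 u hu F K hF hv).2.deriv]
    exact hpos u hu hc
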